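/- Write $(z,w)=(z,w_1,w_2,w_3)$ for points of $\mathbb C^4$. Let $M\subset\mathbb C^4$ be an embedded real analytic submanifold of real dimension $5$, i.e. of codimension $3$. With $J$ the standard complex structure, put $T^cM=TM\cap J(TM)$. $M$ is called CR-generic if $T_qM+J(T_qM)=T_q\mathbb C^4$ for every $q\in M$. A CR-generic $M$ is called maximally minimal if at every point of $M$ $$D^1M=T^cM,\qquad D^2M=T^cM+[T^cM,T^cM],\qquad D^3M=T^cM+[T^cM,T^cM]+\big[T^cM,[T^cM,T^cM]\big]$$ have ranks $2$, $3$ and $5$ respectively; here brackets are taken of local real analytic sections of $T^cM$, and sums mean the spans of the values of these sections and brackets. Put $$\ell_1(z,\zeta)=2i\,z\zeta,\qquad \ell_2(z,\zeta)=2i\,z\zeta(z+\zeta),\qquad \ell_3(z,\zeta)=2\,z\zeta(z-\zeta).$$ Call a triple $(\Pi_1,\Pi_2,\Pi_3)$ of functions $\Pi_j(z,\zeta,\tau)$, holomorphic near the origin of $\mathbb C\times\mathbb C\times\mathbb C^3$, admissible if, near the origin, for $j=1,2,3$: * (order) $\Pi_j=A_j+z\zeta\,B_j$ with $A_j,B_j$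 holomorphic near $0$, $A_j=\mathrm O(|(z,\zeta)|^4)$ and $B_j=\mathrm O(|\tau|)$; on $\zeta=\bar z$, $\tau=\bar w$ this reads $\Pi_j=\mathrm O(|z|^4)+z\bar z\,\mathrm O(|w|)$; * (normality) $\Pi_j(0,\zeta,\tau)\equiv 0\equiv\Pi_j(z,0,\tau)$; * (reality) the functions $\Theta_j(z,\zeta,\tau):=\tau_j+\ell_j(z,\zeta)+\Pi_j(z,\zeta,\tau)$ satisfy $\tau_j\equiv\overline\Theta_j\big(\zeta,z,\Theta(z,\zeta,\tau)\big)$, where $\overline\Theta_j$ is obtained from $\Theta_j$ by conjugating its Taylor coefficients, i.e. $\overline\Theta_j(t)=\overline{\Theta_j(\bar t)}$. **(i)** Let $M\subset\mathbb C^4$ be a real analytic CR-generic submanifold of dimension $5$ which is maximally minimal. Then for every $p\in M$ there are local holomorphic coordinates $(z,w_1,w_2,w_3)$ of $\mathbb C^4$ centered at $p$ and an admissible triple $(\Pi_1,\Pi_2,\Pi_3)$ such that, near $p$, $M$ is exactly the set of points satisfying $$\begin{aligned} w_1-\overline w_1&=2i\,z\bar z+\Pi_1(z,\bar z,\overline w_1,\overline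 w_2,\overline w_3),\\ w_2-\overline w_2&=2i\,z\bar z(z+\bar z)+\Pi_2(z,\bar z,\overline w_1,\overline w_2,\overline w_3),\\ w_3-\overline w_3&=2\,z\bar z(z-\bar z)+\Pi_3(z,\bar z,\overline w_1,\overline w_2,\overline w_3). \end{aligned}$$ **(ii)** Conversely, for every admissible triple $(\Pi_1,\Pi_2,\Pi_3)$ there is an open neighbourhood $U$ of the origin of $\mathbb C^4$ such that the set of points of $U$ satisfying these three equations contains the origin and is a connected real analytic CR-generic submanifold of dimension $5$ (codimension $3$) which is maximally minimal. -/

import Mathlib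

open Filter Topology

noncomputable section

namespace CRGeom

/-- Complex four-space, a point being written `(z, w)` with `w = (w₁, w₂, w₃)`. -/
abbrev C4 : Type := ℂ × (Fin 3 → ℂ)

/-- Complex five-space, a point being written `(z, ζ, τ)`. The variables `ζ` and `τ` are independent
complex variables which take the places of the conjugates of `z` and `w`. -/
abbrev C5 : Type := ℂ × ℂ × (Fin 3 → ℂ)

/-! ### Real analytic submanifolds of complex four-space -/

/-- `M` is an embedded real analytic submanifold of real codimension `d`: near each of its points it
is the zero set of a real analytic submersion to `ℝᵈ`. -/
def IsRealAnalyticSubmanifold (d : ℕ) (M : Set C4) : Prop :=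
  ∀ p ∈ M, ∃ ρ : C4 → (Fin d → ℝ), AnalyticAt ℝ ρ p ∧
    Function.Surjective (fderiv ℝ ρ p) ∧ ∀ᶠ x in 𝓝 p, (x ∈ M ↔ ρ x = 0)

/-- The tangent space `T_q M`: the real vectors killed by the differentials at `q` of all real
analytic functions that vanish on `M` near `q`. -/
def tangentSpaceAt (M : Set C4) (q : C4) : Submodule ℝ C4 where
  carrier := {v | ∀ f : C4 → ℝ, AnalyticAt ℝ f q → (∀ᶠ x in 𝓝[M] q, f x = 0) →
    fderiv ℝ f q v = 0}
  add_mem' := by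
    intro a b ha hb f hf h0
    rw [map_add, ha f hf h0, hb f hf h0, add_zero]
  zero_mem' := by
    intro f _ _
    exact map_zero _
  smul_mem' := by
    intro c a ha f hf h0
    rw [map_smul, ha f hf h0, smul_zero]

/-- The standard complex structure `J`, multiplication by `i`. -/
def J : C4 →ₗ[ℝ] C4 where
  toFun v := Complex.I • v
  map_add' a b := smul_add _ a b
  map_smul' c a := smul_comm Complex.I c a

/-- The complex tangent space `T^c_q M = T_q M ∩ J (T_q M)`. -/
def complexTangentAt (M : Set C4) (q : C4) : Submodule ℝ C4 :=
  tangentSpaceAt M q ⊓ (tangentSpaceAt M q).map J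

/-- `M` is CR-generic: `T_q M + J (T_q M)` is the whole ambient tangent space for all `q ∈ M`. -/
def IsCRGeneric (M : Set C4) : Prop :=
  ∀ q ∈ M, tangentSpaceAt M q ⊔ (tangentSpaceAt M q).map J = ⊤

/-- `X` is (an ambient real analytic extension of) a real analytic section of `T^c M` near `q`.
Brackets of such fields at points of `M` depend only on their restrictions to `M`. -/
def IsLocalSection (M : Set C4) (q : C4) (X : C4 → C4) : Prop :=
  AnalyticAt ℝ X q ∧ ∀ᶠ x in 𝓝[M] q, X x ∈ complexTangentAt M x

/-- The fibre at `q` of `D¹M = T^c M`. -/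
def D1 (M : Set C4) (q : C4) : Submodule ℝ C4 := complexTangentAt M q

/-- The fibre at `q` of `D²M = T^c M + [T^c M, T^c M]`. -/
def D2 (M : Set C4) (q : C4) : Submodule ℝ C4 :=
  D1 M q ⊔ Submodule.span ℝ {v | ∃ X Y : C4 → C4, IsLocalSection M q X ∧ IsLocalSection M q Y ∧
    v = VectorField.lieBracket ℝ X Y q}

/-- The fibre at `q` of `D³M = T^c M + [T^c M, T^c M] + [T^c M, [T^c M, T^c M]]`. -/
def D3 (M : Set C4) (q : C4) : Submodule ℝ C4 :=
  D2 M q ⊔ Submodule.span ℝ {v | ∃ X Y Z : C4 → C4, IsLocalSection M q X ∧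
    IsLocalSection M q Y ∧ IsLocalSection M q Z ∧
    v = VectorField.lieBracket ℝ X (VectorField.lieBracket ℝ Y Z) q}

/-- `M` is maximally minimal: `D¹M`, `D²M`, `D³M` have ranks 2, 3, 5 at every point. -/
def IsMaximallyMinimal (M : Set C4) : Prop :=
  ∀ q ∈ M, Module.finrank ℝ (D1 M q) = 2 ∧ Module.finrank ℝ (D2 M q) = 3 ∧
    Module.finrank ℝ (D3 M q) = 5

/-! ### The complex defining equations -/

/-- The leading terms `2i z ζ`, `2i z ζ (z + ζ)`, `2 z ζ (z - ζ)`. -/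
def leading (j : Fin 3) (p : C5) : ℂ :=
  ![2 * Complex.I * p.1 * p.2.1,
    2 * Complex.I * p.1 * p.2.1 * (p.1 + p.2.1),
    2 * p.1 * p.2.1 * (p.1 - p.2.1)] j

/-- `Θ_j (z, ζ, τ) = τ_j + leading_j (z, ζ) + Π_j (z, ζ, τ)`, for remainders `P = (Π₁, Π₂, Π₃)`. -/
def theta (P : Fin 3 → C5 → ℂ) (j : Fin 3) (p : C5) : ℂ :=
  p.2.2 j + leading j p + P j p

/-- The series with conjugated Taylor coefficients, `f̄ (t) = conj (f (conj t))`; here `star` is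
the componentwise complex conjugation. -/
def conjSeries (f : C5 → ℂ) (p : C5) : ℂ := star (f (star p))

/-- The reality condition `τ_j ≡ Θ̄_j (ζ, z, Θ (z, ζ, τ))` near the origin. -/
def RealityCondition (P : Fin 3 → C5 → ℂ) : Prop :=
  ∀ᶠ p in 𝓝 (0 : C5), ∀ j : Fin 3,
    p.2.2 j = conjSeries (theta P j) (p.2.1, p.1, fun k => theta P k p)

/-- The normality conditions `f (0, ζ, τ) ≡ 0 ≡ f (z, 0, τ)` near the origin. -/
def IsNormal (f : C5 → ℂ) : Prop :=
  ∀ᶠ p in 𝓝 (0 : C5), f (0, p.2.1, p.2.2) = 0 ∧ f (p.1, 0, p.2.2) = 0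

/-- `f = O(|z|⁴) + z z̄ O(|w|)`, with analytic `O` terms. -/
def HasRemainderOrder (f : C5 → ℂ) : Prop :=
  ∃ A B : C5 → ℂ, AnalyticAt ℂ A 0 ∧ AnalyticAt ℂ B 0 ∧
    Asymptotics.IsBigO (𝓝 (0 : C5)) A (fun p => ‖(p.1, p.2.1)‖ ^ 4) ∧
    Asymptotics.IsBigO (𝓝 (0 : C5)) B (fun p => ‖p.2.2‖) ∧
    ∀ᶠ p in 𝓝 (0 : C5), f p = A p + p.1 * p.2.1 * B p

/-- The conditions imposed on the triple of remainders `P = (Π₁, Π₂, Π₃)`. -/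
def AdmissibleRemainders (P : Fin 3 → C5 → ℂ) : Prop :=
  (∀ j, AnalyticAt ℂ (P j) 0 ∧ HasRemainderOrder (P j) ∧ IsNormal (P j)) ∧ RealityCondition P

/-- The three equations `w_j - w̄_j = leading_j (z, z̄) + Π_j (z, z̄, w̄)` at the point `(z, w)`. -/
def SatisfiesEquations (P : Fin 3 → C5 → ℂ) (x : C4) : Prop :=
  ∀ j : Fin 3, x.2 j - star (x.2 j) =
    leading j (x.1, star x.1, star x.2) + P j (x.1, star x.1, star x.2)

end CRGeom

end

/-!
# Normal forms of maximally minimal CR-generic submanifolds of `ℂ⁴`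

A generic submanifold of codimension three is described near each of its points by a complex
equation `w = Θ (z, conj z, conj w)`, with `Θ` holomorphic and subject to a reality condition. Its
complex tangent line at a point is spanned by `(1, Λ)`, where `Λ` is the derivative of `Θ` in `z`.
Writing the sections of `T^c M` as `(a, a Λ)`, one finds that modulo `T^c M` all brackets of two
sections are real multiples of one vector (`leviVector`, multiplied by `i`), and that modulo `D²M`
all brackets of length three are values of a map that is real linear in a complex number
(`thirdVector`). Hence the submanifold is maximally minimal at a point exactly when the three
vectors `i leviVector`, `thirdVector 1`, `thirdVector i` are independent (`D1_eq_lineSpan`,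
`D2_eq_lineSpan`, `D3_eq_lineSpan`, `finrank_lineSpan_iff`). This is an open condition.

In normal coordinates, `Θ = τ + z ζ G`, and at the origin the three vectors are `i G`,
`2 i (A + B)` and `-2 (A - B)`, where `A` and `B` are the derivatives of `G` in `z` and `ζ`
(`leviVector_slope_zero`, `thirdVector_slope_zero`).

For an admissible triple, the order condition forces `G`, `A`, `B` to have the values of the model
(`factor_eq_zero_of_hasRemainderOrder`), and for these values the three vectors are independent.
This gives the second part (`AdmissibleRemainders.exists_nhd`); connectedness is seen in real
coordinates in which the submanifold is flat.

For the first part, let `M` be maximally minimal.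
* A linear change of coordinates makes `T M` equal to `Im w = 0` at the given point; complexifying
  the real equations (`exists_complexification`) and solving them for `w` by the inverse function
  theorem yields `Θ` (`exists_isRealDefining`).
* The coordinate change `normalCoord`, constant along the Segre varieties of the points with
  `ζ = 0`, makes `Θ` normal (`IsRealDefining.exists_normal`), whence `Θ - τ` is divisible by `z ζ`
  (`exists_factor_of_normal`).
* The rank of `D³M` is a biholomorphic invariant (`finrank_D3_le`), so that the three vectors are
  independent. The reality condition makes them real (`reality_of_normal`). Therefore a real linear
  change of the coordinates `w` takes them to the vectors of the model. Then `G` agrees with the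
  factor of the model to first order in `(z, ζ)`, which is the order condition on the remainders
  (`exists_admissible`).
-/

noncomputable section

namespace CRGeom

/-! ### Power series with conjugated coefficients -/

section PowerSeries

variable {𝕜 𝕜' E E' F F' : Type*} [NontriviallyNormedField 𝕜] [NontriviallyNormedField 𝕜']
  [NormedAddCommGroup E] [NormedSpace 𝕜 E] [NormedAddCommGroup F] [NormedSpace 𝕜 F]
  [NormedAddCommGroup E'] [NormedSpace 𝕜' E'] [NormedAddCommGroup F'] [NormedSpace 𝕜' F']

/-- A geometric comparison of coefficients preserves positivity of the radius of convergence. -/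
theorem radius_pos_of_norm_le {p : FormalMultilinearSeries 𝕜 E F}
    {P : FormalMultilinearSeries 𝕜' E' F'} (hp : 0 < p.radius) {C K : ℝ} (hC : 0 ≤ C) (hK : 0 < K)
    (m : ℕ) (h : ∀ n, ‖P n‖ ≤ C * K ^ n * ‖p (n + m)‖) : 0 < P.radius := by
  obtain ⟨r, hr0, hr⟩ := ENNReal.lt_iff_exists_nnreal_btwn.1 hp
  have hr0 : 0 < r := by exact_mod_cast hr0
  obtain ⟨C', hC', hb⟩ := p.norm_mul_pow_le_of_lt_radius hr
  have hr0' : (0 : ℝ) < r := hr0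
  let s : NNReal := ⟨r / K, by positivity⟩
  have hs : (s : ℝ) = r / K := rfl
  have hs0 : 0 < s := by
    rw [← NNReal.coe_pos, hs]; positivity
  refine lt_of_lt_of_le (ENNReal.coe_pos.2 hs0)
    (P.le_radius_of_bound (C * (C' / r ^ m)) fun n => ?_)
  have hpm : ‖p (n + m)‖ * (r : ℝ) ^ n ≤ C' / r ^ m := by
    rw [le_div_iff₀ (by positivity), mul_assoc, ← pow_add]; exact hb _
  calc ‖P n‖ * (s : ℝ) ^ n ≤ C * K ^ n * ‖p (n + m)‖ * (s : ℝ) ^ n := by gcongr; exact h n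
    _ = C * (‖p (n + m)‖ * (r : ℝ) ^ n) := by
      rw [hs, div_pow]; field_simp
    _ ≤ _ := by gcongr

/-- A function which is near `0` the pointwise sum of a power series with positive radius of
convergence is analytic at `0`. -/
theorem analyticAt_zero_of_hasSum [CompleteSpace F] {P : FormalMultilinearSeries 𝕜 E F}
    (hP : 0 < P.radius) {f : E → F}
    (h : ∀ᶠ x in 𝓝 (0 : E), HasSum (fun n => P n fun _ => x) (f x)) :
    AnalyticAt 𝕜 f 0 := by
  have h1 := P.hasFPowerSeriesOnBall hP
  refine h1.analyticAt.congr ?_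
  filter_upwards [h, Metric.eball_mem_nhds (0 : E) hP] with x hx hx'
  have := h1.hasSum hx'
  rw [zero_add] at this
  exact this.unique hx

theorem eventually_hasSum_of_hasFPowerSeriesAt {f : E → F} {p : FormalMultilinearSeries 𝕜 E F}
    (h : HasFPowerSeriesAt f p 0) : ∀ᶠ x in 𝓝 (0 : E), HasSum (fun n => p n fun _ => x) (f x) := by
  simpa using h.eventually_hasSum

end PowerSeries

section Conj

variable {E F : Type*} [NormedAddCommGroup E] [NormedSpace ℂ E] [StarAddMonoid E]
  [NormedStarGroup E] [StarModule ℂ E] [NormedAddCommGroup F] [NormedSpace ℂ F] [StarAddMonoid F]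
  [NormedStarGroup F] [StarModule ℂ F]

/-- The multilinear map `v ↦ conj (m (conj v))`. -/
def conjMultilinear {n : ℕ} (m : ContinuousMultilinearMap ℂ (fun _ : Fin n => E) F) :
    ContinuousMultilinearMap ℂ (fun _ : Fin n => E) F where
  toFun v := star (m fun i => star (v i))
  map_update_add' := by
    intro _ v i x y
    have (x : E) : (fun j => star (Function.update v i x j))
        = Function.update (fun j => star (v j)) i (star x) := by
      ext j; by_cases h : j = i
      · subst h; simp
      · simp [h]
    cases Subsingleton.elim ‹DecidableEq (Fin n)› (instDecidableEqFin n)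
    simp [this]
  map_update_smul' := by
    intro _ v i c x
    have (x : E) : (fun j => star (Function.update v i x j))
        = Function.update (fun j => star (v j)) i (star x) := by
      ext j; by_cases h : j = i
      · subst h; simp
      · simp [h]
    cases Subsingleton.elim ‹DecidableEq (Fin n)› (instDecidableEqFin n)
    simp [this]
  cont := continuous_star.comp (m.cont.comp (continuous_pi fun i =>
    continuous_star.comp (continuous_apply i)))

theorem norm_conjMultilinear_le {n : ℕ} (m : ContinuousMultilinearMap ℂ (fun _ : Fin n => E) F) :
    ‖conjMultilinear m‖ ≤ ‖m‖ := by
  refine ContinuousMultilinearMap.opNorm_le_bound (norm_nonneg _) fun v => ?_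
  change ‖star (m fun i => star (v i))‖ ≤ _
  simpa using m.le_opNorm fun i => star (v i)

/-- Conjugating the Taylor coefficients of an analytic function gives an analytic function. -/
theorem analyticAt_star_comp_star [CompleteSpace F] {f : E → F} (hf : AnalyticAt ℂ f 0) :
    AnalyticAt ℂ (fun x => star (f (star x))) 0 := by
  obtain ⟨p, hp⟩ := hf
  refine analyticAt_zero_of_hasSum (P := fun n => conjMultilinear (p n))
    (radius_pos_of_norm_le hp.radius_pos zero_le_one one_pos 0 fun n => ?_) ?_
  · simpa using norm_conjMultilinear_le (p n)
  · have h0 : Tendsto (star : E → E) (𝓝 0) (𝓝 0) := by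
      simpa using (continuous_star (R := E)).tendsto 0
    filter_upwards [h0.eventually (eventually_hasSum_of_hasFPowerSeriesAt hp)] with x hx
    exact hx.star

end Conj

/-! ### Division of analytic functions by linear forms -/

section Division

variable {𝕜 E F : Type*} [NontriviallyNormedField 𝕜]
  [NormedAddCommGroup E] [NormedSpace 𝕜 E] [NormedAddCommGroup F] [NormedSpace 𝕜 F]

/-- The `n`-th coefficient of the quotient by a linear form `ℓ` of a power series `p` that vanishes
on the kernel of `ℓ`. Here `e` is a vector with `ℓ e = 1` and `π` is the projection to `ker ℓ`
along `e`; the coefficient arises from telescoping `p (x, …, x) - p (π x, …, π x)`. -/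
def divCoeff (p : FormalMultilinearSeries 𝕜 E F) (e : E) (π : E →L[𝕜] E) :
    FormalMultilinearSeries 𝕜 E F := fun n =>
  ∑ k : Fin (n + 1), ((p (n + 1)).curryMid k e).compContinuousLinearMap
    fun j => if j.castSucc < k then ContinuousLinearMap.id 𝕜 E else π

/-- Telescoping: replacing the arguments `x` by `π x` one after the other changes each time one
argument by `x - π x = ℓ x • e`. -/
theorem smul_divCoeff_apply (p : FormalMultilinearSeries 𝕜 E F) (e : E) (ℓ : E →L[𝕜] 𝕜)
    (π : E →L[𝕜] E) (hπ : ∀ x, x = π x + ℓ x • e) (n : ℕ) (x : E) :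
    ℓ x • divCoeff p e π n (fun _ => x) = p (n + 1) (fun _ => x) - p (n + 1) (fun _ => π x) := by
  let g : ℕ → F := fun k => p (n + 1) fun j => if (j : ℕ) < k then x else π x
  have h1 : p (n + 1) (fun _ => x) = g (n + 1) := by
    simp only [g]; congr 1; ext j; rw [if_pos j.2]
  have h2 : p (n + 1) (fun _ => π x) = g 0 := by simp [g]
  rw [h1, h2, ← Finset.sum_range_sub, Finset.sum_range]
  simp only [divCoeff, sum_apply, Finset.smul_sum]
  refine Finset.sum_congr rfl fun k _ => ?_
  rw [ContinuousMultilinearMap.compContinuousLinearMap_apply,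
    ContinuousMultilinearMap.curryMid_apply]
  let v : Fin (n + 1) → E := fun j => if (j : ℕ) < k then x else π x
  -- `v` has the arguments `x` before the position `k` and `π x` from `k` on.
  have e1 (y : E) : k.insertNth (α := fun _ => E) y (fun j : Fin n =>
      (if j.castSucc < k then ContinuousLinearMap.id 𝕜 E else π) x) = Function.update v k y := by
    rw [Fin.insertNth_eq_iff]
    refine ⟨by simp, ?_⟩
    ext j
    simp only [Fin.removeNth, Function.update_of_ne (Fin.succAbove_ne k j), v]
    by_cases hj : j.castSucc < k
    · have hj' : (j : ℕ) < k := hj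
      rw [Fin.succAbove_of_castSucc_lt _ _ hj]
      simp [hj, hj']
    · have hj' : ¬ ((j : ℕ) + 1 < k) := by
        have : ¬ ((j : ℕ) < k) := hj
        omega
      rw [Fin.succAbove_of_le_castSucc _ _ (not_lt.1 hj)]
      simp [hj, hj']
  have e2 : g (k + 1) = p (n + 1) (Function.update v k x) := by
    simp only [g]; congr 1; ext j
    by_cases hj : j = k
    · subst hj; simp
    · have : (j : ℕ) ≠ k := fun h => hj (Fin.ext h)
      simp only [v, Function.update_of_ne hj]
      congr 1
      apply propext; omega
  have e3 : g k = p (n + 1) (Function.update v k (π x)) := by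
    simp only [g]; congr 1; ext j
    by_cases hj : j = k
    · subst hj; simp
    · simp [v, Function.update_of_ne hj]
  have hx : x - π x = ℓ x • e := sub_eq_of_eq_add' (hπ x)
  rw [e2, e3, ← ContinuousMultilinearMap.map_update_sub, hx,
    ContinuousMultilinearMap.map_update_smul, ← e1 e]

theorem prod_le_pow_of_le {n : ℕ} {a : Fin n → ℝ} {K : ℝ} (h0 : ∀ i, 0 ≤ a i) (h : ∀ i, a i ≤ K) :
    ∏ i, a i ≤ K ^ n :=
  (Finset.prod_le_prod (fun i _ => h0 i) fun i _ => h i).trans (by simp)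

theorem norm_divCoeff_le (p : FormalMultilinearSeries 𝕜 E F) (e : E) (π : E →L[𝕜] E) (n : ℕ) :
    ‖divCoeff p e π n‖ ≤ ‖e‖ * (2 * (1 + ‖π‖)) ^ n * ‖p (n + 1)‖ := by
  have h1 (k : Fin (n + 1)) : ‖((p (n + 1)).curryMid k e).compContinuousLinearMap
      fun j => if j.castSucc < k then ContinuousLinearMap.id 𝕜 E else π‖
      ≤ ‖p (n + 1)‖ * ‖e‖ * (1 + ‖π‖) ^ n := by
    refine (ContinuousMultilinearMap.norm_compContinuousLinearMap_le _ _).trans ?_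
    gcongr
    · refine (ContinuousLinearMap.le_opNorm _ _).trans ?_
      gcongr
      exact (ContinuousMultilinearMap.norm_curryMid k _).le
    · refine prod_le_pow_of_le (fun _ => norm_nonneg _) fun j => ?_
      split_ifs
      · exact ContinuousLinearMap.norm_id_le.trans (by simp)
      · simp
  refine (norm_sum_le_of_le _ fun k _ => h1 k).trans ?_
  have h2 : ((n + 1 : ℕ) : ℝ) ≤ 2 ^ n := by exact_mod_cast Nat.lt_two_pow_self
  rw [Finset.sum_const, Finset.card_univ, Fintype.card_fin, nsmul_eq_mul, mul_pow]
  calc ((n + 1 : ℕ) : ℝ) * (‖p (n + 1)‖ * ‖e‖ * (1 + ‖π‖) ^ n)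
      ≤ 2 ^ n * (‖p (n + 1)‖ * ‖e‖ * (1 + ‖π‖) ^ n) := by gcongr
    _ = _ := by ring

/-- An analytic function that vanishes on the kernel of a linear form is divisible by it. -/
theorem exists_analyticAt_smul_eq [CompleteSpace F] {f : E → F} (hf : AnalyticAt 𝕜 f 0) (e : E)
    (ℓ : E →L[𝕜] 𝕜) (h0 : ∀ᶠ x in 𝓝 (0 : E), f (x - ℓ x • e) = 0) :
    ∃ g : E → F, AnalyticAt 𝕜 g 0 ∧ ∀ᶠ x in 𝓝 (0 : E), f x = ℓ x • g x := by
  obtain ⟨p, hp⟩ := hf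
  let π : E →L[𝕜] E := ContinuousLinearMap.id 𝕜 E - ℓ.smulRight e
  have hπ (x : E) : x = π x + ℓ x • e := by simp [π]
  have hr : 0 < FormalMultilinearSeries.radius (divCoeff p e π) :=
    radius_pos_of_norm_le hp.radius_pos (norm_nonneg e) (by positivity) 1
      fun n => norm_divCoeff_le p e π n
  have hg := (divCoeff p e π).hasFPowerSeriesOnBall hr
  refine ⟨_, hg.analyticAt, ?_⟩
  have hs := eventually_hasSum_of_hasFPowerSeriesAt hp
  have hπ0 : Tendsto π (𝓝 0) (𝓝 0) := by simpa using π.continuous.tendsto 0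
  filter_upwards [hs, hπ0.eventually hs,
    eventually_hasSum_of_hasFPowerSeriesAt hg.hasFPowerSeriesAt, h0] with x h1 h2 h3 h4
  have h5 : f (π x) = 0 := h4
  rw [h5] at h2
  have h6 := (hasSum_nat_add_iff' 1).2 (h1.sub h2)
  have h7 : p 0 (fun _ => x) = p 0 fun _ => π x := by
    congr 1; ext i; exact i.elim0
  simp only [Finset.range_one, Finset.sum_singleton, h7, sub_self, sub_zero] at h6
  have h8 := h3.const_smul (ℓ x)
  simp only [smul_divCoeff_apply p e ℓ π hπ] at h8
  exact h6.unique h8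

end Division

/-! ### Complexification of real analytic functions -/

section Complexification

/-- The complex linear form on `C4 × C4` which extends a real linear form `l` on the totally real
subspace of the points `(x, conj x)`. -/
def complexifyForm (l : C4 →ₗ[ℝ] ℝ) : (C4 × C4) →L[ℂ] ℂ :=
  LinearMap.toContinuousLinearMap
  { toFun := fun v => ((l v.1 - Complex.I * l (Complex.I • v.1))
      + star ((l (star v.2) - Complex.I * l (Complex.I • star v.2) : ℂ))) / 2
    map_add' := by
      intro v w
      simp only [Prod.fst_add, Prod.snd_add, map_add, smul_add, star_add, Complex.ofReal_add,
        star_sub, mul_add]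
      ring
    map_smul' := by
      intro c v
      have h (a b : ℝ) (x : C4) :
          l ((a + b * Complex.I : ℂ) • x) = a * l x + b * l (Complex.I • x) := by
        have : (a + b * Complex.I : ℂ) • x = a • x + b • (Complex.I • x) := by
          rw [add_smul, mul_smul]; rfl
        rw [this, map_add, map_smul, map_smul, smul_eq_mul, smul_eq_mul]
      obtain ⟨a, b, rfl⟩ : ∃ a b : ℝ, c = a + b * Complex.I := ⟨c.re, c.im, by simp⟩
      have h1 : star (((a : ℂ) + b * Complex.I) • v.2)
          = ((a : ℂ) + ((-b : ℝ) : ℂ) * Complex.I) • star v.2 := by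
        rw [star_smul]; simp
      have h2 (a b : ℝ) : Complex.I * (a + b * Complex.I) = ((-b : ℝ) : ℂ) + a * Complex.I := by
        push_cast; linear_combination (b : ℂ) * Complex.I_mul_I
      simp only [Prod.smul_fst, Prod.smul_snd, h1, smul_smul, h2, h, RingHom.id_apply, smul_eq_mul]
      simp only [Complex.star_def, map_sub, map_mul, Complex.conj_I, Complex.conj_ofReal]
      push_cast
      linear_combination ((b : ℂ) * l (Complex.I • v.1) / 2
        - b * l (Complex.I • star v.2) / 2) * Complex.I_mul_I }

theorem complexifyForm_apply (l : C4 →ₗ[ℝ] ℝ) (x : C4) :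
    complexifyForm l (x, star x) = l x := by
  simp [complexifyForm]

/-- A real analytic function on `C4` is the restriction of a holomorphic function on `C4 × C4` to
the points `(x, conj x)`: expand each Taylor coefficient in real coordinates, and replace every
coordinate by the complex linear form that extends it. -/
theorem exists_complexification {F : Type*} [NormedAddCommGroup F] [NormedSpace ℂ F]
    [CompleteSpace F] {f : C4 → F} (hf : AnalyticAt ℝ f 0) :
    ∃ R : C4 × C4 → F, AnalyticAt ℂ R 0 ∧ ∀ᶠ x in 𝓝 (0 : C4), R (x, star x) = f x := by
  obtain ⟨p, hp⟩ := hf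
  let b := Module.finBasis ℝ C4
  let d := Module.finrank ℝ C4
  let c : Fin d → (C4 × C4) →L[ℂ] ℂ := fun i => complexifyForm (b.coord i)
  let P : FormalMultilinearSeries ℂ (C4 × C4) F := fun n => ∑ s : Fin n → Fin d,
    ((ContinuousMultilinearMap.mkPiAlgebra ℂ (Fin n) ℂ).compContinuousLinearMap
      fun k => c (s k)).smulRight (p n fun k => b (s k))
  have hP (n : ℕ) (x : C4) : P n (fun _ => (x, star x)) = p n fun _ => x := by
    have h1 : p n (fun _ => x)
        = ∑ s : Fin n → Fin d, p n fun k => b.repr x (s k) • b (s k) := by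
      conv_lhs => rw [← b.sum_repr x]
      exact (p n).toMultilinearMap.map_sum fun _ j => b.repr x j • b j
    rw [h1]
    simp only [P, sum_apply]
    refine Finset.sum_congr rfl fun s _ => ?_
    rw [ContinuousMultilinearMap.map_smul_univ]
    simp only [ContinuousMultilinearMap.smulRight_apply,
      ContinuousMultilinearMap.compContinuousLinearMap_apply,
      ContinuousMultilinearMap.mkPiAlgebra_apply, c, complexifyForm_apply, Module.Basis.coord_apply,
      ← Complex.ofReal_prod]
    rfl
  have hr : 0 < P.radius := by
    obtain ⟨Kc, hKc0, hKc⟩ : ∃ K : ℝ, 0 < K ∧ ∀ i, ‖c i‖ ≤ K :=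
      ⟨1 + ∑ i, ‖c i‖, by positivity, fun i => (Finset.single_le_sum (f := fun i => ‖c i‖)
        (fun _ _ => norm_nonneg _) (Finset.mem_univ i)).trans (by simp)⟩
    obtain ⟨Kb, hKb0, hKb⟩ : ∃ K : ℝ, 0 < K ∧ ∀ i, ‖b i‖ ≤ K :=
      ⟨1 + ∑ i, ‖b i‖, by positivity, fun i => (Finset.single_le_sum (f := fun i => ‖b i‖)
        (fun _ _ => norm_nonneg _) (Finset.mem_univ i)).trans (by simp)⟩
    have hd : 0 < d := Module.finrank_pos
    refine radius_pos_of_norm_le hp.radius_pos zero_le_one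
      (K := d * (Kc * Kb)) (by positivity) 0 fun n => ?_
    have h1 (s : Fin n → Fin d) :
        ‖((ContinuousMultilinearMap.mkPiAlgebra ℂ (Fin n) ℂ).compContinuousLinearMap
          fun k => c (s k)).smulRight (p n fun k => b (s k))‖ ≤ Kc ^ n * (‖p n‖ * Kb ^ n) := by
      rw [ContinuousMultilinearMap.norm_smulRight]
      gcongr
      · refine (ContinuousMultilinearMap.norm_compContinuousLinearMap_le _ _).trans ?_
        rw [ContinuousMultilinearMap.norm_mkPiAlgebra, one_mul]
        exact prod_le_pow_of_le (fun _ => norm_nonneg _) fun j => hKc _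
      · refine (ContinuousMultilinearMap.le_opNorm _ _).trans ?_
        gcongr
        exact prod_le_pow_of_le (fun _ => norm_nonneg _) fun j => hKb _
    refine (norm_sum_le_of_le _ fun s _ => h1 s).trans ?_
    rw [Finset.sum_const, Finset.card_univ, Fintype.card_fun, Fintype.card_fin, Fintype.card_fin,
      nsmul_eq_mul]
    apply le_of_eq
    have h2 : ‖p (n + 0)‖ = ‖p n‖ := rfl
    rw [h2]
    push_cast
    ring
  have hR := P.hasFPowerSeriesOnBall hr
  refine ⟨_, hR.analyticAt, ?_⟩
  have h0 : Tendsto (fun x : C4 => (x, star x)) (𝓝 0) (𝓝 0) := by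
    have : Continuous fun x : C4 => (x, star x) := by fun_prop
    simpa [Prod.mk_zero_zero] using this.tendsto 0
  filter_upwards [h0.eventually (eventually_hasSum_of_hasFPowerSeriesAt hR.hasFPowerSeriesAt),
    eventually_hasSum_of_hasFPowerSeriesAt hp] with x h1 h2
  simp only [hP] at h1
  exact h1.unique h2

/-- A holomorphic function that vanishes on the totally real subspace of the points `(x, conj x)`
vanishes identically. -/
theorem eventually_eq_zero_of_totallyReal {F : Type*} [NormedAddCommGroup F] [NormedSpace ℂ F]
    [CompleteSpace F] {R : C4 × C4 → F} (hR : AnalyticAt ℂ R 0)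
    (h0 : ∀ᶠ x in 𝓝 (0 : C4), R (x, star x) = 0) : ∀ᶠ v in 𝓝 (0 : C4 × C4), R v = 0 := by
  obtain ⟨δ, hδ, hδR⟩ := Metric.eventually_nhds_iff_ball.1 h0
  obtain ⟨ε, hε, hεR⟩ := Metric.eventually_nhds_iff_ball.1 hR.eventually_analyticAt
  let r := min δ ε
  have hr : 0 < r := lt_min hδ hε
  refine Metric.eventually_nhds_iff_ball.2 ⟨r, hr, fun v hv => ?_⟩
  -- The complex line `L` takes real parameters to the totally real subspace, and `i` to `v`.
  let a : C4 := (2⁻¹ : ℂ) • (v.1 + star v.2)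
  let b : C4 := (-Complex.I / 2) • (v.1 - star v.2)
  let L : ℂ → C4 × C4 := fun t => (a, star a) + t • (b, star b)
  have hb : star b = (Complex.I / 2) • (star v.1 - v.2) := by
    simp [b, star_smul]
  have hLI : L Complex.I = v := by
    have h1 : a + Complex.I • b = v.1 := by
      simp only [a, b, smul_smul]
      rw [show Complex.I * (-Complex.I / 2) = 2⁻¹ by
        linear_combination (-1 / 2 : ℂ) * Complex.I_mul_I]
      module
    have h2 : star a + Complex.I • star b = v.2 := by
      rw [hb]
      simp only [a, star_smul, star_add, star_star, smul_smul]
      rw [show Complex.I * (Complex.I / 2) = -2⁻¹ by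
        linear_combination (1 / 2 : ℂ) * Complex.I_mul_I]
      simp only [Complex.star_def, map_inv₀, map_ofNat]
      module
    exact Prod.ext h1 h2
  have hL0 : L 0 ∈ Metric.ball (0 : C4 × C4) r := by
    have h1 : ‖a‖ ≤ ‖v‖ := by
      simp only [a, norm_smul]
      have h2 : ‖v.1 + star v.2‖ ≤ ‖v‖ + ‖v‖ :=
        norm_add_le_of_le (norm_fst_le v) (by rw [norm_star]; exact norm_snd_le v)
      norm_num
      linarith
    rw [mem_ball_zero_iff] at hv ⊢
    have h3 : ‖((a, star a) : C4 × C4)‖ = ‖a‖ := by simp [Prod.norm_mk]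
    simpa [L, h3] using h1.trans_lt hv
  let S : Set ℂ := L ⁻¹' Metric.ball 0 r
  have hS : Convex ℝ S := by
    intro s hs t ht α β hα hβ hαβ
    have hαβ' : (α : ℂ) + β = 1 := by exact_mod_cast hαβ
    have h1 : L (α • s + β • t) = α • L s + β • L t := by
      simp only [L, ← Complex.coe_smul]
      have : ((a, star a) : C4 × C4) = ((α : ℂ) + β) • (a, star a) := by rw [hαβ', one_smul]
      conv_lhs => rw [this]
      module
    change L (α • s + β • t) ∈ Metric.ball 0 r
    rw [h1]
    exact convex_ball (0 : C4 × C4) r hs ht hα hβ hαβ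
  have han : AnalyticOnNhd ℂ (R ∘ L) S := by
    intro t ht
    have h1 : AnalyticAt ℂ R (L t) := hεR _ (Metric.ball_subset_ball (min_le_right _ _) ht)
    have h2 : AnalyticAt ℂ L t := by fun_prop
    exact h1.comp h2
  have hfr : ∃ᶠ t in 𝓝[≠] (0 : ℂ), (R ∘ L) t = 0 := by
    have h1 : Continuous fun s : ℝ => L s := by fun_prop
    have h2 : ∀ᶠ s : ℝ in 𝓝 0, L s ∈ Metric.ball (0 : C4 × C4) r :=
      h1.continuousAt.eventually (Metric.isOpen_ball.mem_nhds (by simpa using hL0))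
    have h3 : ∀ᶠ s : ℝ in 𝓝 0, (R ∘ L) s = 0 := by
      filter_upwards [h2] with s hs
      have h4 : L s = (a + (s : ℂ) • b, star (a + (s : ℂ) • b)) := by
        simp [L, star_smul]
      have h5 : a + (s : ℂ) • b ∈ Metric.ball (0 : C4) δ := by
        rw [mem_ball_zero_iff] at hs ⊢
        refine lt_of_le_of_lt ?_ (hs.trans_le (min_le_left _ _))
        rw [h4]
        exact norm_fst_le (a + (s : ℂ) • b, star (a + (s : ℂ) • b))
      simpa [h4] using hδR _ h5
    have h4 : Tendsto (fun s : ℝ => (s : ℂ)) (𝓝[≠] 0) (𝓝[≠] 0) := by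
      refine tendsto_nhdsWithin_iff.2 ⟨?_, ?_⟩
      · exact tendsto_nhdsWithin_of_tendsto_nhds
          (by simpa using Complex.continuous_ofReal.tendsto 0)
      · filter_upwards [self_mem_nhdsWithin] with s hs
        simpa using hs
    exact h4.frequently (h3.filter_mono nhdsWithin_le_nhds).frequently
  have := han.eqOn_zero_of_preconnected_of_frequently_eq_zero hS.isPreconnected hL0 hfr
    (show Complex.I ∈ S by simpa [S, hLI] using hv)
  simpa [hLI] using this

end Complexification

/-! ### Tangent spaces and brackets -/

/-- The tangent space of a level set: by the Lagrange multiplier rule, the differential of a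
function that vanishes on `M` is a combination of the differentials of the defining functions. -/
theorem tangentSpaceAt_eq_ker {d : ℕ} {M : Set C4} {q : C4} {ρ : C4 → Fin d → ℝ}
    (hρ : AnalyticAt ℝ ρ q) (hs : Function.Surjective (fderiv ℝ ρ q))
    (hM : ∀ᶠ x in 𝓝 q, (x ∈ M ↔ ρ x = 0)) (hq : q ∈ M) :
    tangentSpaceAt M q = LinearMap.ker (fderiv ℝ ρ q : C4 →ₗ[ℝ] Fin d → ℝ) := by
  have hρq : ρ q = 0 := hM.self_of_nhds.1 hq
  ext v
  constructor
  · intro hv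
    rw [LinearMap.mem_ker]
    ext j
    have h1 : AnalyticAt ℝ (fun x => ρ x j) q :=
      ((ContinuousLinearMap.proj (R := ℝ) (φ := fun _ : Fin d => ℝ) j).analyticAt _).comp hρ
    have h2 := hv _ h1 (by
      filter_upwards [nhdsWithin_le_nhds hM, self_mem_nhdsWithin] with x hx hxM
      rw [hx.1 hxM]; rfl)
    have h3 := hasFDerivAt_pi'.1 hρ.differentiableAt.hasFDerivAt j
    rw [h3.fderiv] at h2
    exact h2
  · intro hv f hf h0
    have hfq : f q = 0 := h0.self_of_nhdsWithin hq
    have hext : IsLocalExtrOn f {x | ρ x = ρ q} q := by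
      left
      have : ∀ᶠ x in 𝓝[{x | ρ x = ρ q}] q, f q ≤ f x := by
        have h1 := eventually_nhdsWithin_iff.1 h0
        filter_upwards [nhdsWithin_le_nhds h1, nhdsWithin_le_nhds hM, self_mem_nhdsWithin]
          with x h2 h3 h4
        rw [h2 (h3.2 ((show ρ x = ρ q from h4).trans hρq)), hfq]
      exact this
    obtain ⟨l, c, hlc, h⟩ := hext.exists_linear_map_of_hasStrictFDerivAt hρ.hasStrictFDerivAt
      hf.hasStrictFDerivAt
    have hc : c ≠ 0 := by
      rintro rfl
      refine hlc (Prod.ext (LinearMap.ext fun y => ?_) rfl)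
      obtain ⟨x, rfl⟩ := hs y
      simpa using h x
    have h1 := h v
    rw [show fderiv ℝ ρ q v = 0 from hv] at h1
    simpa [hc] using h1

theorem complexTangentAt_le (M : Set C4) (q : C4) : complexTangentAt M q ≤ tangentSpaceAt M q :=
  inf_le_left

theorem mem_complexTangentAt_iff {M : Set C4} {q v : C4} :
    v ∈ complexTangentAt M q ↔ v ∈ tangentSpaceAt M q ∧ Complex.I • v ∈ tangentSpaceAt M q := by
  have hJ (u : C4) : Complex.I • Complex.I • u = -u := by
    rw [smul_smul, Complex.I_mul_I, neg_one_smul]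
  refine and_congr_right fun _ => ⟨?_, fun h => ⟨-(Complex.I • v), neg_mem h, ?_⟩⟩
  · rintro ⟨u, hu, rfl⟩
    change Complex.I • Complex.I • u ∈ _
    rw [hJ]
    exact neg_mem hu
  · change Complex.I • -(Complex.I • v) = v
    rw [smul_neg, hJ, neg_neg]

/-- The derivative in a tangential direction depends only on the restriction to `M`. -/
theorem fderiv_apply_congr {F : Type*} [NormedAddCommGroup F] [NormedSpace ℝ F] {M : Set C4}
    {q v : C4} {X Y : C4 → F} (hX : AnalyticAt ℝ X q) (hY : AnalyticAt ℝ Y q)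
    (h : ∀ᶠ x in 𝓝[M] q, X x = Y x) (hv : v ∈ tangentSpaceAt M q) :
    fderiv ℝ X q v = fderiv ℝ Y q v := by
  rw [← sub_eq_zero]
  refine SeparatingDual.eq_zero_of_forall_dual_eq_zero (R := ℝ) fun l => ?_
  have h1 : AnalyticAt ℝ (fun x => l (X x - Y x)) q := (l.analyticAt _).comp (hX.sub hY)
  have h2 := hv _ h1 (by filter_upwards [h] with x hx; simp [hx])
  have h3 : fderiv ℝ (fun x => l (X x - Y x)) q v = l (fderiv ℝ X q v - fderiv ℝ Y q v) := by
    have := (l.hasFDerivAt.comp q (hX.differentiableAt.hasFDerivAt.sub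
      hY.differentiableAt.hasFDerivAt)).fderiv
    exact DFunLike.congr_fun this v
  rw [← h3, h2]

theorem analyticAt_fderiv_apply {F : Type*} [NormedAddCommGroup F] [NormedSpace ℝ F]
    [CompleteSpace F] {q : C4} {f : C4 → F} {X : C4 → C4} (hf : AnalyticAt ℝ f q)
    (hX : AnalyticAt ℝ X q) : AnalyticAt ℝ (fun x => fderiv ℝ f x (X x)) q :=
  (hf.fderiv.contDiffAt.clm_apply hX.contDiffAt).analyticAt

theorem analyticAt_lieBracket {q : C4} {X Y : C4 → C4} (hX : AnalyticAt ℝ X q)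
    (hY : AnalyticAt ℝ Y q) : AnalyticAt ℝ (VectorField.lieBracket ℝ X Y) q :=
  (analyticAt_fderiv_apply hY hX).sub (analyticAt_fderiv_apply hX hY)

/-- Brackets at `q` of fields tangent to `M` depend only on the restrictions of the fields to
`M`. -/
theorem lieBracket_congr_of_tangent {M : Set C4} {q : C4} {X X' Y Y' : C4 → C4} (hq : q ∈ M)
    (hX : AnalyticAt ℝ X q) (hX' : AnalyticAt ℝ X' q) (hY : AnalyticAt ℝ Y q)
    (hY' : AnalyticAt ℝ Y' q) (h : ∀ᶠ x in 𝓝[M] q, X x = X' x) (h' : ∀ᶠ x in 𝓝[M] q, Y x = Y' x)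
    (hXq : X q ∈ tangentSpaceAt M q) (hYq : Y q ∈ tangentSpaceAt M q) :
    VectorField.lieBracket ℝ X Y q = VectorField.lieBracket ℝ X' Y' q := by
  rw [VectorField.lieBracket, VectorField.lieBracket, ← h.self_of_nhdsWithin hq,
    ← h'.self_of_nhdsWithin hq, fderiv_apply_congr hX hX' h hYq, fderiv_apply_congr hY hY' h' hXq]

/-- The bracket of two vector fields tangent to `M` is tangent to `M`. -/
theorem lieBracket_mem_tangentSpaceAt {M : Set C4} {q : C4} {X Y : C4 → C4} (hq : q ∈ M)
    (hX : AnalyticAt ℝ X q) (hY : AnalyticAt ℝ Y q)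
    (hXM : ∀ᶠ x in 𝓝[M] q, X x ∈ tangentSpaceAt M x)
    (hYM : ∀ᶠ x in 𝓝[M] q, Y x ∈ tangentSpaceAt M x) :
    VectorField.lieBracket ℝ X Y q ∈ tangentSpaceAt M q := by
  intro f hf h0
  -- Differentiate `df (X) = 0` along `M`; the second derivatives of `f` cancel by symmetry.
  have key {X : C4 → C4} (hX : AnalyticAt ℝ X q)
      (hXM : ∀ᶠ x in 𝓝[M] q, X x ∈ tangentSpaceAt M x) {v : C4} (hv : v ∈ tangentSpaceAt M q) :
      fderiv ℝ (fderiv ℝ f) q v (X q) + fderiv ℝ f q (fderiv ℝ X q v) = 0 := by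
    have h1 : ∀ᶠ x in 𝓝[M] q, fderiv ℝ f x (X x) = 0 := by
      filter_upwards [nhdsWithin_le_nhds hf.eventually_analyticAt, hXM,
        eventually_eventually_nhdsWithin.2 h0] with x h2 h3 h4
      exact h3 f h2 h4
    have h2 := hv _ (analyticAt_fderiv_apply hf hX) h1
    have h3 := (hf.fderiv.differentiableAt.hasFDerivAt.clm_apply
      hX.differentiableAt.hasFDerivAt).fderiv
    rw [h3] at h2
    simp at h2
    linarith
  have hXq := hXM.self_of_nhdsWithin hq
  have hYq := hYM.self_of_nhdsWithin hq
  have h1 := key hX hXM hYq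
  have h2 := key hY hYM hXq
  have h3 : IsSymmSndFDerivAt ℝ f q := hf.contDiffAt.isSymmSndFDerivAt (n := ⊤) (by simp)
  rw [VectorField.lieBracket, map_sub]
  have h4 := h3 (X q) (Y q)
  linarith

/-! ### The bracket filtration of a complex line field -/

/-- The vector field `x ↦ (a, a Λ)`, the section with component `a` of the line field spanned over
`ℂ` by `(1, Λ)`. -/
def liftField (Λ : C4 → Fin 3 → ℂ) (a : C4 → ℂ) (x : C4) : C4 := (a x, a x • Λ x)

/-- The antilinear part of the derivative of `Λ` along the complex line field `a ↦ (a, a Λ)`. It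
spans, up to the factor `2i`, the Levi bracket modulo the line field. -/
def leviVector (Λ : C4 → Fin 3 → ℂ) (x : C4) : Fin 3 → ℂ :=
  (2 : ℂ)⁻¹ • (fderiv ℝ Λ x (1, Λ x) + Complex.I • fderiv ℝ Λ x (Complex.I, Complex.I • Λ x))

/-- The class, modulo the lower brackets, of the bracket of `(b, b Λ)` with `i` times the Levi
vector. -/
def thirdVector (Λ : C4 → Fin 3 → ℂ) (x : C4) (b : ℂ) : Fin 3 → ℂ :=
  Complex.I • fderiv ℝ (leviVector Λ) x (b, b • Λ x)
    - b • fderiv ℝ Λ x (0, Complex.I • leviVector Λ x)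

/-- A real linear map on the complex line of `(1, ξ)` is determined by its values at `(1, ξ)` and
`(i, i ξ)`. -/
theorem realLinear_line (a : ℂ) (ξ : Fin 3 → ℂ) {F : Type*}
    [NormedAddCommGroup F] [NormedSpace ℝ F] (ℓ : C4 →L[ℝ] F) :
    ℓ (a, a • ξ) = a.re • ℓ (1, ξ) + a.im • ℓ (Complex.I, Complex.I • ξ) := by
  rw [← map_smul, ← map_smul, ← map_add]
  congr 1
  refine Prod.ext ?_ ?_
  · apply Complex.ext <;> simp
  · ext j
    simp only [Prod.snd_add, Prod.smul_snd, Pi.add_apply, Pi.smul_apply, smul_eq_mul,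
      Complex.real_smul]
    nth_rewrite 1 [← Complex.re_add_im a]
    ring

/-- The part of a bracket of sections of the line field that involves the derivatives of `Λ`: the
complex linear parts cancel. -/
theorem fderiv_mixed (Λ : C4 → Fin 3 → ℂ) (x : C4) (a e : ℂ) :
    e • fderiv ℝ Λ x (a, a • Λ x) - a • fderiv ℝ Λ x (e, e • Λ x)
      = (2 * (e * star a).im) • (Complex.I • leviVector Λ x) := by
  rw [realLinear_line a, realLinear_line e, leviVector]
  ext j
  simp only [Pi.sub_apply, Pi.smul_apply, Pi.add_apply, smul_eq_mul, Complex.real_smul]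
  nth_rewrite 1 [← Complex.re_add_im e]
  nth_rewrite 3 [← Complex.re_add_im a]
  have : (e * star a).im = e.im * a.re - e.re * a.im := by simp; ring
  rw [this]
  push_cast
  linear_combination (e.re * a.im - e.im * a.re) *
    (fderiv ℝ Λ x (Complex.I, Complex.I • Λ x) j) * Complex.I_mul_I

/-- The bracket of a section of the line field with a section shifted by `(0, u)`. -/
theorem lieBracket_liftField {Λ : C4 → Fin 3 → ℂ} {x : C4} {a e : C4 → ℂ} {u : C4 → Fin 3 → ℂ}
    (hΛ : DifferentiableAt ℝ Λ x) (ha : DifferentiableAt ℝ a x) (he : DifferentiableAt ℝ e x)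
    (hu : DifferentiableAt ℝ u x) :
    ∃ g : ℂ, VectorField.lieBracket ℝ (liftField Λ a) (fun y => (e y, e y • Λ y + u y)) x
      = (g, g • Λ x + (2 * (e x * star (a x)).im) • (Complex.I • leviVector Λ x)
        + fderiv ℝ u x (liftField Λ a x) - a x • fderiv ℝ Λ x (0, u x)) := by
  refine ⟨fderiv ℝ e x (liftField Λ a x) - fderiv ℝ a x (e x, e x • Λ x + u x), ?_⟩
  have h1 : HasFDerivAt (liftField Λ a) _ x :=
    ha.hasFDerivAt.prodMk (ha.hasFDerivAt.smul hΛ.hasFDerivAt)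
  have h2 : HasFDerivAt (fun y => (e y, e y • Λ y + u y)) _ x :=
    he.hasFDerivAt.prodMk ((he.hasFDerivAt.smul hΛ.hasFDerivAt).add hu.hasFDerivAt)
  rw [VectorField.lieBracket, h1.fderiv, h2.fderiv, ← fderiv_mixed]
  have h3 {F : Type} [NormedAddCommGroup F] [NormedSpace ℝ F] (ℓ : C4 →L[ℝ] F) :
      ℓ (e x, e x • Λ x + u x) = ℓ (e x, e x • Λ x) + ℓ (0, u x) := by
    rw [← map_add]; simp
  ext1
  · rfl
  · simp only [liftField, ContinuousLinearMap.prod_apply, add_apply,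
      smul_apply, ContinuousLinearMap.smulRight_apply, Prod.snd_sub, h3 (fderiv ℝ Λ x)]
    module

/-- The real span of the complex line of the `(a, a ξ)` and of the vectors `(0, u i)`. -/
def lineSpan {n : ℕ} (ξ : Fin 3 → ℂ) (u : Fin n → Fin 3 → ℂ) : Submodule ℝ C4 :=
  LinearMap.range (
    { toFun := fun p => (p.1, p.1 • ξ + ∑ i, p.2 i • u i)
      map_add' := by
        intro p p'
        simp only [Prod.fst_add, Prod.snd_add, Pi.add_apply, add_smul, Finset.sum_add_distrib,
          Prod.mk_add_mk]
        congr 1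
        abel
      map_smul' := by
        intro c p
        simp only [Prod.smul_fst, Prod.smul_snd, Pi.smul_apply, smul_assoc, RingHom.id_apply,
          Prod.smul_mk, smul_add, Finset.smul_sum] } : ℂ × (Fin n → ℝ) →ₗ[ℝ] C4)

theorem mem_lineSpan {n : ℕ} {ξ : Fin 3 → ℂ} {u : Fin n → Fin 3 → ℂ} {v : C4} :
    v ∈ lineSpan ξ u ↔ ∃ c : Fin n → ℝ, v.2 = v.1 • ξ + ∑ i, c i • u i := by
  constructor
  · rintro ⟨p, rfl⟩
    exact ⟨p.2, rfl⟩
  · rintro ⟨c, h⟩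
    exact ⟨(v.1, c), Prod.ext rfl h.symm⟩

/-- The span has the largest possible dimension exactly when the vectors `u` are independent over
`ℝ`. -/
theorem finrank_lineSpan_iff {n : ℕ} {ξ : Fin 3 → ℂ} {u : Fin n → Fin 3 → ℂ} :
    Module.finrank ℝ (lineSpan ξ u) = 2 + n ↔ LinearIndependent ℝ u := by
  unfold lineSpan
  set φ : ℂ × (Fin n → ℝ) →ₗ[ℝ] C4 := _
  have h1 := LinearMap.finrank_range_add_finrank_ker φ
  rw [Module.finrank_prod, Complex.finrank_real_complex, Module.finrank_fin_fun] at h1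
  have h2 : Module.finrank ℝ (LinearMap.range φ) = 2 + n ↔ LinearMap.ker φ = ⊥ := by
    rw [← Submodule.finrank_eq_zero (R := ℝ)]
    omega
  rw [h2, LinearMap.ker_eq_bot', Fintype.linearIndependent_iff]
  constructor
  · intro h c hc i
    have h3 := h (0, c) (by
      change ((0 : ℂ), (0 : ℂ) • ξ + ∑ i, c i • u i) = 0
      rw [hc]; simp)
    exact congr_fun (congr_arg Prod.snd h3) i
  · rintro h ⟨a, c⟩ hac
    have ha : a = 0 := congr_arg Prod.fst hac
    have h4 : a • ξ + ∑ i, c i • u i = 0 := congr_arg Prod.snd hac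
    rw [ha, zero_smul, zero_add] at h4
    exact Prod.ext ha (funext (h c h4))

theorem finrank_lineSpan_le {n : ℕ} {ξ : Fin 3 → ℂ} {u : Fin n → Fin 3 → ℂ} :
    Module.finrank ℝ (lineSpan ξ u) ≤ 2 + n := by
  refine (LinearMap.finrank_range_le _).trans ?_
  rw [Module.finrank_prod, Complex.finrank_real_complex, Module.finrank_fin_fun]

section Sections

variable {M : Set C4} {q : C4} {Λ : C4 → Fin 3 → ℂ}

theorem analyticAt_liftField (hΛ : AnalyticAt ℝ Λ q) {a : C4 → ℂ} (ha : AnalyticAt ℝ a q) :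
    AnalyticAt ℝ (liftField Λ a) q :=
  ha.prod (ha.smul hΛ)

theorem analyticAt_leviVector (hΛ : AnalyticAt ℝ Λ q) : AnalyticAt ℝ (leviVector Λ) q := by
  have h1 := analyticAt_fderiv_apply hΛ (analyticAt_liftField hΛ (a := fun _ => 1) analyticAt_const)
  have h2 := analyticAt_fderiv_apply hΛ
    (analyticAt_liftField hΛ (a := fun _ => Complex.I) analyticAt_const)
  have h3 : leviVector Λ = fun x => (2 : ℂ)⁻¹ • (fderiv ℝ Λ x (liftField Λ (fun _ => 1) x)
      + Complex.I • fderiv ℝ Λ x (liftField Λ (fun _ => Complex.I) x)) := by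
    ext1 x; simp [leviVector, liftField]
  rw [h3]
  exact AnalyticAt.fun_const_smul (c := (2 : ℂ)⁻¹)
    (h1.add (AnalyticAt.fun_const_smul (c := Complex.I) h2))

/-- The fields `(a, a Λ)` are local sections when `T^c M` is spanned by the line field of `Λ`. -/
theorem isLocalSection_liftField (hΛ : AnalyticAt ℝ Λ q)
    (hM : ∀ᶠ x in 𝓝[M] q, ∀ v, v ∈ complexTangentAt M x ↔ v.2 = v.1 • Λ x) {a : C4 → ℂ}
    (ha : AnalyticAt ℝ a q) : IsLocalSection M q (liftField Λ a) := by
  refine ⟨analyticAt_liftField hΛ ha, ?_⟩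
  filter_upwards [hM] with x hx
  exact (hx _).2 rfl

theorem IsLocalSection.eventually_mem_tangentSpaceAt {X : C4 → C4} (hX : IsLocalSection M q X) :
    ∀ᶠ x in 𝓝[M] q, X x ∈ tangentSpaceAt M x :=
  hX.2.mono fun x hx => complexTangentAt_le M x hx

theorem IsLocalSection.eventually {X : C4 → C4} (hX : IsLocalSection M q X) :
    ∀ᶠ x in 𝓝[M] q, IsLocalSection M x X := by
  filter_upwards [nhdsWithin_le_nhds hX.1.eventually_analyticAt,
    eventually_eventually_nhdsWithin.2 hX.2] with x h1 h2
  exact ⟨h1, h2⟩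

theorem IsLocalSection.eq_liftField
    (hM : ∀ᶠ x in 𝓝[M] q, ∀ v, v ∈ complexTangentAt M x ↔ v.2 = v.1 • Λ x) {X : C4 → C4}
    (hX : IsLocalSection M q X) : ∀ᶠ x in 𝓝[M] q, X x = liftField Λ (fun x => (X x).1) x := by
  filter_upwards [hM, hX.2] with x h1 h2
  exact Prod.ext rfl ((h1 _).1 h2)

/-- On `M`, the bracket of two sections is a section plus a real multiple of `i` times the Levi
vector. -/
theorem exists_lieBracket_eq (hΛ : AnalyticAt ℝ Λ q)
    (hM : ∀ᶠ x in 𝓝[M] q, ∀ v, v ∈ complexTangentAt M x ↔ v.2 = v.1 • Λ x) {X Y : C4 → C4}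
    (hX : IsLocalSection M q X) (hY : IsLocalSection M q Y) :
    ∃ (e : C4 → ℂ) (s : C4 → ℝ), AnalyticAt ℝ e q ∧ AnalyticAt ℝ s q ∧
      (∀ x, s x = 2 * ((Y x).1 * star (X x).1).im) ∧
      ∀ᶠ x in 𝓝[M] q, VectorField.lieBracket ℝ X Y x
        = (e x, e x • Λ x + s x • (Complex.I • leviVector Λ x)) := by
  have han {X : C4 → C4} (hX : AnalyticAt ℝ X q) : AnalyticAt ℝ (fun x => (X x).1) q :=
    ((ContinuousLinearMap.fst ℝ ℂ (Fin 3 → ℂ)).analyticAt _).comp hX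
  have hXa := han hX.1
  have hYa := han hY.1
  have hs : AnalyticAt ℝ (fun x => 2 * ((Y x).1 * star (X x).1).im) q := by
    have h1 : AnalyticAt ℝ (fun x => star (X x).1) q :=
      (Complex.conjCLE.toContinuousLinearMap.analyticAt _).comp hXa
    exact analyticAt_const.mul ((Complex.imCLM.analyticAt _).comp (hYa.mul h1))
  refine ⟨fun x => (VectorField.lieBracket ℝ X Y x).1, _, han (analyticAt_lieBracket hX.1 hY.1), hs,
    fun _ => rfl, ?_⟩
  filter_upwards [self_mem_nhdsWithin, hX.eventually, hY.eventually,
    eventually_eventually_nhdsWithin.2 (hX.eq_liftField hM),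
    eventually_eventually_nhdsWithin.2 (hY.eq_liftField hM),
    nhdsWithin_le_nhds hΛ.eventually_analyticAt, nhdsWithin_le_nhds hXa.eventually_analyticAt,
    nhdsWithin_le_nhds hYa.eventually_analyticAt] with x hx h1 h2 h3 h4 h5 h6 h7
  have h8 := lieBracket_congr_of_tangent hx h1.1 (analyticAt_liftField h5 h6) h2.1
    (analyticAt_liftField h5 h7) h3 h4 (h1.eventually_mem_tangentSpaceAt.self_of_nhdsWithin hx)
    (h2.eventually_mem_tangentSpaceAt.self_of_nhdsWithin hx)
  obtain ⟨g, h9⟩ := lieBracket_liftField h5.differentiableAt h6.differentiableAt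
    h7.differentiableAt (u := fun _ => 0) (differentiableAt_const _)
  have h10 : (fun y => ((Y y).1, (Y y).1 • Λ y + 0)) = liftField Λ fun x => (Y x).1 := by
    ext1 y; simp [liftField]
  rw [h10, ← h8] at h9
  rw [h9, Prod.mk_zero_zero, map_zero]
  simp

theorem D1_eq_lineSpan (hq : q ∈ M)
    (hM : ∀ᶠ x in 𝓝[M] q, ∀ v, v ∈ complexTangentAt M x ↔ v.2 = v.1 • Λ x) :
    D1 M q = lineSpan (Λ q) ![] := by
  ext v
  rw [D1, hM.self_of_nhdsWithin hq, mem_lineSpan]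
  simp

/-- There is a bracket of two sections whose transversal part is exactly `i` times the Levi
vector. -/
theorem exists_lieBracket_eq_levi (hΛ : AnalyticAt ℝ Λ q)
    (hM : ∀ᶠ x in 𝓝[M] q, ∀ v, v ∈ complexTangentAt M x ↔ v.2 = v.1 • Λ x) :
    ∃ (X Y : C4 → C4), IsLocalSection M q X ∧ IsLocalSection M q Y ∧
      ∃ e : C4 → ℂ, AnalyticAt ℝ e q ∧ ∀ᶠ x in 𝓝[M] q,
        VectorField.lieBracket ℝ X Y x = (e x, e x • Λ x + Complex.I • leviVector Λ x) := by
  -- The factor `1 / 2` makes the coefficient `2 Im (i / 2)` equal to one.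
  have h1 := isLocalSection_liftField hΛ hM (a := fun _ => 1 / 2) analyticAt_const
  have h2 := isLocalSection_liftField hΛ hM (a := fun _ => Complex.I) analyticAt_const
  obtain ⟨e, s, he, -, hs, h⟩ := exists_lieBracket_eq hΛ hM h1 h2
  refine ⟨_, _, h1, h2, e, he, ?_⟩
  filter_upwards [h] with x hx
  rw [hx, hs]
  simp [liftField]

theorem D2_eq_lineSpan (hq : q ∈ M) (hΛ : AnalyticAt ℝ Λ q)
    (hM : ∀ᶠ x in 𝓝[M] q, ∀ v, v ∈ complexTangentAt M x ↔ v.2 = v.1 • Λ x) :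
    D2 M q = lineSpan (Λ q) ![Complex.I • leviVector Λ q] := by
  apply le_antisymm
  · refine sup_le ?_ (Submodule.span_le.2 ?_)
    · intro v hv
      rw [D1, hM.self_of_nhdsWithin hq] at hv
      exact mem_lineSpan.2 ⟨0, by simpa using hv⟩
    · rintro v ⟨X, Y, hX, hY, rfl⟩
      obtain ⟨e, s, -, -, -, h⟩ := exists_lieBracket_eq hΛ hM hX hY
      rw [h.self_of_nhdsWithin hq]
      exact mem_lineSpan.2 ⟨![s q], by simp⟩
  · intro v hv
    obtain ⟨c, hc⟩ := mem_lineSpan.1 hv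
    obtain ⟨X, Y, hX, hY, e, -, h⟩ := exists_lieBracket_eq_levi hΛ hM
    have h1 : VectorField.lieBracket ℝ X Y q ∈ D2 M q :=
      Submodule.mem_sup_right (Submodule.subset_span ⟨X, Y, hX, hY, rfl⟩)
    have h2 : v - c 0 • VectorField.lieBracket ℝ X Y q ∈ D2 M q := by
      refine Submodule.mem_sup_left ?_
      rw [D1, hM.self_of_nhdsWithin hq, h.self_of_nhdsWithin hq]
      simp only [Prod.snd_sub, hc, Prod.fst_sub, Prod.smul_snd, Prod.smul_fst, Finset.univ_unique,
        Finset.sum_singleton, Fin.default_eq_zero, Matrix.cons_val_fin_one]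
      simp only [← Complex.coe_smul, smul_eq_mul]
      module
    have := add_mem h2 (Submodule.smul_mem _ (c 0) h1)
    simpa using this

/-- The third-order vector is real linear in `b`. -/
theorem thirdVector_eq (x : C4) (b : ℂ) :
    thirdVector Λ x b = b.re • thirdVector Λ x 1 + b.im • thirdVector Λ x Complex.I := by
  have h := realLinear_line b (Λ x) (fderiv ℝ (leviVector Λ) x)
  simp only [thirdVector, h, one_smul]
  nth_rewrite 3 [← Complex.re_add_im b]
  simp only [← Complex.coe_smul]
  module

/-- The bracket of a section with a tangent field `V` whose component transversal to the line field
is `s` times `i` times the Levi vector. -/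
theorem lieBracket_section_transversal {X V : C4 → C4} (hq : q ∈ M) (hΛ : AnalyticAt ℝ Λ q)
    (hM : ∀ᶠ x in 𝓝[M] q, ∀ v, v ∈ complexTangentAt M x ↔ v.2 = v.1 • Λ x)
    (hX : IsLocalSection M q X) (hV : AnalyticAt ℝ V q)
    (hVM : ∀ᶠ x in 𝓝[M] q, V x ∈ tangentSpaceAt M x) {e : C4 → ℂ} {s : C4 → ℝ}
    (he : AnalyticAt ℝ e q) (hs : AnalyticAt ℝ s q)
    (hVe : ∀ᶠ x in 𝓝[M] q, V x = (e x, e x • Λ x + s x • (Complex.I • leviVector Λ x))) :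
    ∃ g : ℂ, VectorField.lieBracket ℝ X V q = (g, g • Λ q
      + (2 * (e q * star (X q).1).im + fderiv ℝ s q (X q)) • (Complex.I • leviVector Λ q)
      + s q • thirdVector Λ q (X q).1) := by
  have hXa : AnalyticAt ℝ (fun x => (X x).1) q :=
    ((ContinuousLinearMap.fst ℝ ℂ (Fin 3 → ℂ)).analyticAt _).comp hX.1
  have hQ := (analyticAt_leviVector hΛ).const_smul (c := Complex.I)
  have hu : AnalyticAt ℝ (fun x => s x • (Complex.I • leviVector Λ x)) q := hs.smul hQ
  have h1 : AnalyticAt ℝ (fun x => (e x, e x • Λ x + s x • (Complex.I • leviVector Λ x))) q :=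
    he.prod ((he.smul hΛ).add hu)
  have h2 := lieBracket_congr_of_tangent hq hX.1 (analyticAt_liftField hΛ hXa) hV h1
    (hX.eq_liftField hM) hVe (hX.eventually_mem_tangentSpaceAt.self_of_nhdsWithin hq)
    (hVM.self_of_nhdsWithin hq)
  obtain ⟨g, h3⟩ := lieBracket_liftField hΛ.differentiableAt hXa.differentiableAt
    he.differentiableAt hu.differentiableAt
  refine ⟨g, ?_⟩
  rw [h2, h3]
  refine Prod.ext rfl ?_
  have h4 : HasFDerivAt (fun x => s x • (Complex.I • leviVector Λ x)) _ q :=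
    hs.differentiableAt.hasFDerivAt.smul
      ((analyticAt_leviVector hΛ).differentiableAt.hasFDerivAt.const_smul Complex.I)
  have h5 : X q = liftField Λ (fun x => (X x).1) q := (hX.eq_liftField hM).self_of_nhdsWithin hq
  have h6 : fderiv ℝ Λ q (0, s q • (Complex.I • leviVector Λ q))
      = s q • fderiv ℝ Λ q (0, Complex.I • leviVector Λ q) := by
    rw [← map_smul]; simp
  have h7 : thirdVector Λ q (X q).1 = Complex.I • fderiv ℝ (leviVector Λ) q (X q)
      - (X q).1 • fderiv ℝ Λ q (0, Complex.I • leviVector Λ q) := by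
    conv_rhs => rw [h5]
    rfl
  rw [h4.fderiv, h6, h7, ← h5]
  simp only [add_apply, smul_apply, ContinuousLinearMap.smulRight_apply]
  simp only [← Complex.coe_smul]
  push_cast
  module

/-- When `T^c M` is spanned by the line field of `Λ`, the fibre of `D³M` is obtained from the line
by adding the Levi vector times `i` and the values of the real linear map `thirdVector`. -/
theorem D3_eq_lineSpan (hq : q ∈ M) (hΛ : AnalyticAt ℝ Λ q)
    (hM : ∀ᶠ x in 𝓝[M] q, ∀ v, v ∈ complexTangentAt M x ↔ v.2 = v.1 • Λ x) :
    D3 M q = lineSpan (Λ q) ![Complex.I • leviVector Λ q, thirdVector Λ q 1,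
      thirdVector Λ q Complex.I] := by
  have hbr {X Y : C4 → C4} (hX : IsLocalSection M q X) (hY : IsLocalSection M q Y) :
      ∀ᶠ x in 𝓝[M] q, VectorField.lieBracket ℝ X Y x ∈ tangentSpaceAt M x := by
    filter_upwards [hX.eventually, hY.eventually, self_mem_nhdsWithin] with x h1 h2 hx
    exact lieBracket_mem_tangentSpaceAt hx h1.1 h2.1 h1.eventually_mem_tangentSpaceAt
      h2.eventually_mem_tangentSpaceAt
  apply le_antisymm
  · refine sup_le ?_ (Submodule.span_le.2 ?_)
    · intro v hv
      rw [D2_eq_lineSpan hq hΛ hM] at hv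
      obtain ⟨c, hc⟩ := mem_lineSpan.1 hv
      exact mem_lineSpan.2 ⟨![c 0, 0, 0], by simpa [Fin.sum_univ_three] using hc⟩
    · rintro v ⟨X, Y, Z, hX, hY, hZ, rfl⟩
      obtain ⟨e, s, he, hs, -, h⟩ := exists_lieBracket_eq hΛ hM hY hZ
      obtain ⟨g, hg⟩ := lieBracket_section_transversal hq hΛ hM hX
        (analyticAt_lieBracket hY.1 hZ.1) (hbr hY hZ) he hs h
      rw [hg]
      refine mem_lineSpan.2 ⟨![2 * (e q * star (X q).1).im + fderiv ℝ s q (X q),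
        s q * (X q).1.re, s q * (X q).1.im], ?_⟩
      rw [thirdVector_eq q (X q).1]
      simp only [Fin.sum_univ_three, Matrix.cons_val_zero, Matrix.cons_val_one, Matrix.cons_val]
      module
  · intro v hv
    obtain ⟨c, hc⟩ := mem_lineSpan.1 hv
    obtain ⟨Y, Z, hY, hZ, e, he, h⟩ := exists_lieBracket_eq_levi hΛ hM
    have h1 := isLocalSection_liftField hΛ hM (a := fun _ => (c 1 + c 2 * Complex.I))
      analyticAt_const
    obtain ⟨g, hg⟩ := lieBracket_section_transversal hq hΛ hM h1
      (analyticAt_lieBracket hY.1 hZ.1) (hbr hY hZ) he (s := fun _ => 1) analyticAt_const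
      (by simpa using h)
    set X := liftField Λ fun _ => (c 1 + c 2 * Complex.I)
    set m := VectorField.lieBracket ℝ X (VectorField.lieBracket ℝ Y Z) q with hm
    have h2 : m ∈ D3 M q :=
      Submodule.mem_sup_right (Submodule.subset_span ⟨X, Y, Z, h1, hY, hZ, rfl⟩)
    have h3 : v - m ∈ D3 M q := by
      refine Submodule.mem_sup_left ?_
      rw [D2_eq_lineSpan hq hΛ hM]
      refine mem_lineSpan.2 ⟨![c 0 - (2 * (e q * star (X q).1).im
        + fderiv ℝ (fun _ => (1 : ℝ)) q (X q))], ?_⟩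
      have h4 : (X q).1 = c 1 + c 2 * Complex.I := rfl
      rw [hg, thirdVector_eq q (X q).1, h4]
      simp only [Prod.snd_sub, hc, Prod.fst_sub, Fin.sum_univ_three, Matrix.cons_val_zero,
        Matrix.cons_val_one, Matrix.cons_val, Finset.univ_unique, Finset.sum_singleton,
        Fin.default_eq_zero, Matrix.cons_val_fin_one]
      have h5 : ((c 1 : ℂ) + c 2 * Complex.I).re = c 1 := by simp
      have h6 : ((c 1 : ℂ) + c 2 * Complex.I).im = c 2 := by simp
      rw [h5, h6]
      module
    simpa using add_mem h3 h2

end Sections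

/-! ### Invariance of the bracket filtration under biholomorphisms -/

section Pushforward

variable {M M' : Set C4} {h g : C4 → C4} {p : C4}

/-- The push-forward of the vector field `X` under the local diffeomorphism `h` with inverse `g`. -/
def pushField (h g X : C4 → C4) (y : C4) : C4 := fderiv ℝ h (g y) (X (g y))

theorem map_mem_tangentSpaceAt (hh : AnalyticAt ℝ h p) (hM : ∀ᶠ x in 𝓝 p, (x ∈ M ↔ h x ∈ M'))
    {v : C4} (hv : v ∈ tangentSpaceAt M p) : fderiv ℝ h p v ∈ tangentSpaceAt M' (h p) := by
  intro f hf h0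
  have h1 : AnalyticAt ℝ (f ∘ h) p := hf.comp hh
  have h2 := hv _ h1 (by
    have h3 := hh.continuousAt.eventually (eventually_nhdsWithin_iff.1 h0)
    refine eventually_nhdsWithin_iff.2 ?_
    filter_upwards [h3, hM] with x h4 h5 h6
    exact h4 (h5.1 h6))
  rw [fderiv_comp _ hf.differentiableAt hh.differentiableAt] at h2
  exact h2

theorem map_mem_complexTangentAt (hh : AnalyticAt ℂ h p)
    (hM : ∀ᶠ x in 𝓝 p, (x ∈ M ↔ h x ∈ M')) {v : C4} (hv : v ∈ complexTangentAt M p) :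
    fderiv ℝ h p v ∈ complexTangentAt M' (h p) := by
  rw [mem_complexTangentAt_iff] at hv ⊢
  have h1 : Complex.I • fderiv ℝ h p v = fderiv ℝ h p (Complex.I • v) := by
    rw [hh.differentiableAt.fderiv_restrictScalars ℝ]
    exact (map_smul (fderiv ℂ h p) Complex.I v).symm
  rw [h1]
  exact ⟨map_mem_tangentSpaceAt hh.restrictScalars hM hv.1,
    map_mem_tangentSpaceAt hh.restrictScalars hM hv.2⟩

theorem analyticAt_pushField {X : C4 → C4} (hh : AnalyticAt ℝ h p) (hg : AnalyticAt ℝ g (h p))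
    (hgp : g (h p) = p) (hX : AnalyticAt ℝ X p) : AnalyticAt ℝ (pushField h g X) (h p) := by
  have h1 : AnalyticAt ℝ (fun x => fderiv ℝ h x (X x)) (g (h p)) := by
    rw [hgp]; exact analyticAt_fderiv_apply hh hX
  exact h1.comp hg

theorem isLocalSection_pushField {X : C4 → C4} (hh : AnalyticAt ℂ h p)
    (hg : AnalyticAt ℂ g (h p)) (hgp : g (h p) = p) (hhg : ∀ᶠ y in 𝓝 (h p), h (g y) = y)
    (hM : ∀ᶠ x in 𝓝 p, (x ∈ M ↔ h x ∈ M')) (hX : IsLocalSection M p X) :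
    IsLocalSection M' (h p) (pushField h g X) := by
  refine ⟨analyticAt_pushField hh.restrictScalars hg.restrictScalars hgp hX.1, ?_⟩
  have hgt : Tendsto g (𝓝 (h p)) (𝓝 p) := by
    have := hg.continuousAt.tendsto
    rwa [hgp] at this
  refine eventually_nhdsWithin_iff.2 ?_
  filter_upwards [hgt.eventually hh.eventually_analyticAt, hgt.eventually hM.eventually_nhds, hhg,
    hgt.eventually (eventually_nhdsWithin_iff.1 hX.2)] with y h1 h2 h3 h4 h5
  have h6 := map_mem_complexTangentAt h1 h2 (h4 (h2.self_of_nhds.2 (by rwa [h3])))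
  rwa [h3] at h6

theorem eventually_isInvertible_fderiv (hh : AnalyticAt ℝ h p) (hg : AnalyticAt ℝ g (h p))
    (hgh : ∀ᶠ x in 𝓝 p, g (h x) = x) (hhg : ∀ᶠ y in 𝓝 (h p), h (g y) = y) :
    ∀ᶠ x in 𝓝 p, (fderiv ℝ h x).IsInvertible := by
  filter_upwards [hh.eventually_analyticAt, hh.continuousAt.eventually hg.eventually_analyticAt,
    hgh.eventually_nhds, hh.continuousAt.eventually hhg.eventually_nhds] with x h1 h2 h3 h4
  have h5 := h3.self_of_nhds
  have e1 : (fderiv ℝ g (h x)).comp (fderiv ℝ h x) = ContinuousLinearMap.id ℝ C4 := by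
    rw [← fderiv_comp _ h2.differentiableAt h1.differentiableAt]
    have : g ∘ h =ᶠ[𝓝 x] id := h3
    rw [this.fderiv_eq, fderiv_id]
  have e2 : (fderiv ℝ h x).comp (fderiv ℝ g (h x)) = ContinuousLinearMap.id ℝ C4 := by
    have h6 : AnalyticAt ℝ h (g (h x)) := by rwa [h5]
    have := fderiv_comp (h x) h6.differentiableAt h2.differentiableAt
    rw [h5] at this
    rw [← this]
    have : h ∘ g =ᶠ[𝓝 (h x)] id := h4
    rw [this.fderiv_eq, fderiv_id]
  exact ContinuousLinearMap.IsInvertible.of_inverse e2 e1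

theorem lieBracket_pushField {X Y : C4 → C4} (hh : AnalyticAt ℝ h p) (hg : AnalyticAt ℝ g (h p))
    (hgh : ∀ᶠ x in 𝓝 p, g (h x) = x) (hhg : ∀ᶠ y in 𝓝 (h p), h (g y) = y)
    (hX : AnalyticAt ℝ X p) (hY : AnalyticAt ℝ Y p) :
    VectorField.lieBracket ℝ (pushField h g X) (pushField h g Y) (h p)
      = fderiv ℝ h p (VectorField.lieBracket ℝ X Y p) := by
  have hinv := eventually_isInvertible_fderiv hh hg hgh hhg
  have hpull (X : C4 → C4) : VectorField.pullback ℝ h (pushField h g X) =ᶠ[𝓝 p] X := by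
    filter_upwards [hinv, hgh] with x h1 h2
    rw [VectorField.pullback, pushField, h2]
    exact h1.inverse_apply_eq.2 rfl
  have h1 := VectorField.pullback_lieBracket (𝕜 := ℝ) (n := ⊤) (by simp) hh.contDiffAt
    (analyticAt_pushField hh hg hgh.self_of_nhds hX).differentiableAt
    (analyticAt_pushField hh hg hgh.self_of_nhds hY).differentiableAt
  rw [(hpull X).lieBracket_vectorField_eq (hpull Y)] at h1
  rw [VectorField.pullback, hinv.self_of_nhds.inverse_apply_eq] at h1
  exact h1

/-- The dimension of `D³` does not decrease under a local biholomorphism. -/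
theorem finrank_D3_le (hh : AnalyticAt ℂ h p) (hg : AnalyticAt ℂ g (h p))
    (hgh : ∀ᶠ x in 𝓝 p, g (h x) = x) (hhg : ∀ᶠ y in 𝓝 (h p), h (g y) = y)
    (hM : ∀ᶠ x in 𝓝 p, (x ∈ M ↔ h x ∈ M')) :
    Module.finrank ℝ (D3 M p) ≤ Module.finrank ℝ (D3 M' (h p)) := by
  have hhr : AnalyticAt ℝ h p := hh.restrictScalars
  have hgr : AnalyticAt ℝ g (h p) := hg.restrictScalars
  have hgp := hgh.self_of_nhds
  have hsec {X : C4 → C4} (hX : IsLocalSection M p X) :=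
    isLocalSection_pushField hh hg hgp hhg hM hX
  have hle : (D3 M p).map (fderiv ℝ h p : C4 →ₗ[ℝ] C4) ≤ D3 M' (h p) := by
    rw [Submodule.map_le_iff_le_comap]
    refine sup_le (sup_le ?_ (Submodule.span_le.2 ?_)) (Submodule.span_le.2 ?_)
    · intro v hv
      exact Submodule.mem_sup_left (Submodule.mem_sup_left (map_mem_complexTangentAt hh hM hv))
    · rintro v ⟨X, Y, hX, hY, rfl⟩
      refine Submodule.mem_sup_left (Submodule.mem_sup_right (Submodule.subset_span
        ⟨_, _, hsec hX, hsec hY, ?_⟩))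
      exact (lieBracket_pushField hhr hgr hgh hhg hX.1 hY.1).symm
    · rintro v ⟨X, Y, Z, hX, hY, hZ, rfl⟩
      refine Submodule.mem_sup_right (Submodule.subset_span
        ⟨_, _, _, hsec hX, hsec hY, hsec hZ, ?_⟩)
      have h1 : VectorField.lieBracket ℝ (pushField h g Y) (pushField h g Z)
          =ᶠ[𝓝 (h p)] pushField h g (VectorField.lieBracket ℝ Y Z) := by
        have hgt : Tendsto g (𝓝 (h p)) (𝓝 p) := by
          have := hg.continuousAt.tendsto
          rwa [hgp] at this
        filter_upwards [hgt.eventually hhr.eventually_analyticAt, hgr.eventually_analyticAt,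
          hgt.eventually hgh.eventually_nhds, hhg.eventually_nhds,
          hgt.eventually hY.1.eventually_analyticAt,
          hgt.eventually hZ.1.eventually_analyticAt] with y e1 e2 e3 e4 e5 e6
        have e7 := e4.self_of_nhds
        rw [← e7] at e2 e4
        have := lieBracket_pushField e1 e2 e3 e4 e5 e6
        rwa [e7] at this
      rw [Filter.EventuallyEq.lieBracket_vectorField_eq EventuallyEq.rfl h1,
        lieBracket_pushField hhr hgr hgh hhg hX.1 (analyticAt_lieBracket hY.1 hZ.1)]
      rfl
  obtain ⟨e, he⟩ := (eventually_isInvertible_fderiv hhr hgr hgh hhg).self_of_nhds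
  rw [← he] at hle
  calc Module.finrank ℝ (D3 M p)
      = Module.finrank ℝ ((D3 M p).map (e.toLinearEquiv : C4 →ₗ[ℝ] C4)) :=
        (e.toLinearEquiv.finrank_map_eq _).symm
    _ ≤ _ := Submodule.finrank_mono hle

end Pushforward

/-! ### Complex defining functions of generic submanifolds -/

/-- The real linear map `(z, w) ↦ (z, conj z, conj w)`. -/
def conjPt : C4 →L[ℝ] C5 :=
  (ContinuousLinearMap.fst ℝ ℂ (Fin 3 → ℂ)).prod
    (((starL' ℝ : ℂ ≃L[ℝ] ℂ) : ℂ →L[ℝ] ℂ).comp (ContinuousLinearMap.fst ℝ ℂ (Fin 3 → ℂ)) |>.prod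
    (((starL' ℝ : (Fin 3 → ℂ) ≃L[ℝ] (Fin 3 → ℂ)) : (Fin 3 → ℂ) →L[ℝ] (Fin 3 → ℂ)).comp
      (ContinuousLinearMap.snd ℝ ℂ (Fin 3 → ℂ))))

@[simp]
theorem conjPt_apply (x : C4) : conjPt x = (x.1, star x.1, star x.2) := rfl

theorem tendsto_conjPt : Tendsto conjPt (𝓝 0) (𝓝 0) := by
  simpa only [map_zero] using conjPt.continuous.tendsto 0

/-- `w = Θ (z, ζ, τ)` is the complexified equation of a real analytic submanifold whose tangent
space at the origin is `Im w = 0`. The field `reality` says that the series `Θ̄` with conjugated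
coefficients satisfies `Θ̄ (ζ, z, Θ (z, ζ, τ)) = τ`. -/
structure IsRealDefining (Θ : C5 → Fin 3 → ℂ) : Prop where
  analyticAt : AnalyticAt ℂ Θ 0
  map_zero : Θ 0 = 0
  fderiv_apply : ∀ v, fderiv ℂ Θ 0 v = v.2.2
  reality : ∀ᶠ p in 𝓝 (0 : C5), star (Θ (star p.2.1, star p.1, star (Θ p))) = p.2.2

/-- The set of the points `(z, w)` with `w = Θ (z, conj z, conj w)`. -/
def realLocus (Θ : C5 → Fin 3 → ℂ) : Set C4 := {x | x.2 = Θ (conjPt x)}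

/-- The difference of the two sides of the equation `w = Θ (z, conj z, conj w)`. -/
def defect (Θ : C5 → Fin 3 → ℂ) (x : C4) : Fin 3 → ℂ := x.2 - Θ (conjPt x)

/-- The imaginary part of the defect. -/
def imDefect (Θ : C5 → Fin 3 → ℂ) (x : C4) : Fin 3 → ℝ := fun j => (defect Θ x j).im

/-- The slope of the complex tangent line of the real locus. -/
def slope (Θ : C5 → Fin 3 → ℂ) (x : C4) : Fin 3 → ℂ := fderiv ℂ Θ (conjPt x) (1, 0, 0)

/-- The real linear map taking the imaginary parts of the coordinates. -/
def imPi : (Fin 3 → ℂ) →L[ℝ] (Fin 3 → ℝ) :=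
  ContinuousLinearMap.pi fun j => Complex.imCLM.comp (ContinuousLinearMap.proj j)

@[simp]
theorem imPi_apply (y : Fin 3 → ℂ) (j : Fin 3) : imPi y j = (y j).im := rfl

/-- The real linear map `(y, t) ↦ Re y + i t`. -/
def reAddIm : (Fin 3 → ℂ) × (Fin 3 → ℝ) →L[ℝ] (Fin 3 → ℂ) :=
  ContinuousLinearMap.pi fun j =>
    (Complex.ofRealCLM.comp (Complex.reCLM.comp ((ContinuousLinearMap.proj j).comp
      (ContinuousLinearMap.fst ℝ (Fin 3 → ℂ) (Fin 3 → ℝ))))) +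
    (Complex.ofRealCLM.comp ((ContinuousLinearMap.proj j).comp
      (ContinuousLinearMap.snd ℝ (Fin 3 → ℂ) (Fin 3 → ℝ)))).smulRight Complex.I

theorem reAddIm_apply (y : Fin 3 → ℂ) (t : Fin 3 → ℝ) (j : Fin 3) :
    reAddIm (y, t) j = (y j).re + (t j : ℂ) * Complex.I := by
  simp [reAddIm]

theorem imPi_reAddIm (y : Fin 3 → ℂ) (t : Fin 3 → ℝ) : imPi (reAddIm (y, t)) = t := by
  ext j
  rw [imPi_apply, reAddIm_apply]
  simp

/-- The local coordinates `(z, Re w + i imDefect)`, in which the real locus is flat. -/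
def flatten (Θ : C5 → Fin 3 → ℂ) (x : C4) : C4 := (x.1, reAddIm (x.2, imDefect Θ x))

namespace IsRealDefining

variable {Θ : C5 → Fin 3 → ℂ} (h : IsRealDefining Θ)
include h

theorem eventually_analyticAt : ∀ᶠ x in 𝓝 (0 : C4), AnalyticAt ℂ Θ (conjPt x) :=
  tendsto_conjPt.eventually h.analyticAt.eventually_analyticAt

theorem analyticAt_comp_conjPt : AnalyticAt ℝ (fun x => Θ (conjPt x)) 0 := by
  have h1 : AnalyticAt ℂ Θ (conjPt 0) := by rw [_root_.map_zero]; exact h.analyticAt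
  exact h1.restrictScalars.comp (conjPt.analyticAt 0)

theorem analyticAt_defect : AnalyticAt ℝ (defect Θ) 0 :=
  ((ContinuousLinearMap.snd ℝ ℂ (Fin 3 → ℂ)).analyticAt 0).sub h.analyticAt_comp_conjPt

theorem analyticAt_imDefect : AnalyticAt ℝ (imDefect Θ) 0 :=
  (imPi.analyticAt _).comp h.analyticAt_defect

/-- Because of the reality condition, the six real equations `w = Θ (z, conj z, conj w)` follow from
the vanishing of the imaginary parts. Indeed, if the defect `d` is real, then the derivative of `Θ`
at the origin being `τ`, a Lipschitz estimate gives `‖2 d‖ ≤ ‖d‖ / 2`. -/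
theorem eventually_eq_zero_of_imDefect :
    ∀ᶠ x in 𝓝 (0 : C4), (x ∈ realLocus Θ ↔ imDefect Θ x = 0) := by
  have hst := h.analyticAt.hasStrictFDerivAt.isLittleO.def (c := 2⁻¹) (by norm_num)
  have h1 : Tendsto (fun x : C4 => (conjPt x, ((x.1, star x.1, star (Θ (conjPt x))) : C5)))
      (𝓝 0) (𝓝 (0, 0)) := by
    refine tendsto_conjPt.prodMk_nhds ?_
    have h2 : ContinuousAt (fun x : C4 => ((x.1, star x.1, star (Θ (conjPt x))) : C5)) 0 := by
      exact continuousAt_fst.prodMk (continuousAt_fst.star.prodMk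
        h.analyticAt_comp_conjPt.continuousAt.star)
    have h3 := h2.tendsto
    simp only [_root_.map_zero, h.map_zero, Prod.fst_zero, star_zero] at h3
    exact h3
  filter_upwards [h1.eventually hst, tendsto_conjPt.eventually h.reality] with x h2 h3
  constructor
  · intro hx
    ext j
    have : defect Θ x = 0 := sub_eq_zero.2 hx
    simp [imDefect, this]
  · intro hx
    have hr : star (defect Θ x) = defect Θ x := by
      ext j
      exact Complex.conj_eq_iff_im.2 (congr_fun hx j)
    have h4 : Θ (x.1, star x.1, star (Θ (conjPt x))) = x.2 := by
      simpa using congr_arg star h3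
    have h5 : conjPt x - (x.1, star x.1, star (Θ (conjPt x))) = (0, 0, defect Θ x) := by
      rw [← hr]; simp [defect]
    rw [h5, h4, h.fderiv_apply] at h2
    have h6 : Θ (conjPt x) - x.2 - defect Θ x = (-2 : ℝ) • defect Θ x := by
      rw [defect]; module
    have h7 : ‖((0, 0, defect Θ x) : C5)‖ = ‖defect Θ x‖ := by simp [Prod.norm_mk]
    simp only at h2
    rw [h6, h7, norm_smul] at h2
    have h8 : ‖defect Θ x‖ = 0 := by
      have := norm_nonneg (defect Θ x)
      norm_num at h2
      linarith
    exact sub_eq_zero.1 (norm_eq_zero.1 h8)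

theorem analyticAt_flatten : AnalyticAt ℝ (flatten Θ) 0 := by
  exact analyticAt_fst.prod
    ((reAddIm.analyticAt _).comp (analyticAt_snd.prod h.analyticAt_imDefect))

theorem fderiv_defect_zero (v : C4) : fderiv ℝ (defect Θ) 0 v = v.2 - star v.2 := by
  have h1 : HasFDerivAt Θ (fderiv ℂ Θ 0) (conjPt 0) := by
    rw [_root_.map_zero]; exact h.analyticAt.differentiableAt.hasFDerivAt
  have h2 := (h1.restrictScalars ℝ).comp (0 : C4) conjPt.hasFDerivAt
  have h3 : HasFDerivAt (defect Θ) _ 0 :=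
    (ContinuousLinearMap.snd ℝ ℂ (Fin 3 → ℂ)).hasFDerivAt.sub h2
  rw [h3.fderiv]
  simp [h.fderiv_apply]

theorem fderiv_imDefect_zero (v : C4) (j : Fin 3) :
    fderiv ℝ (imDefect Θ) 0 v j = 2 * (v.2 j).im := by
  have h1 : HasFDerivAt (imDefect Θ) _ 0 :=
    imPi.hasFDerivAt.comp (0 : C4) h.analyticAt_defect.differentiableAt.hasFDerivAt
  rw [h1.fderiv]
  simp [h.fderiv_defect_zero]
  ring

theorem isInvertible_fderiv_flatten : (fderiv ℝ (flatten Θ) 0).IsInvertible := by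
  have h1 : HasFDerivAt (flatten Θ) _ 0 :=
    (ContinuousLinearMap.fst ℝ ℂ (Fin 3 → ℂ)).hasFDerivAt.prodMk
      (reAddIm.hasFDerivAt.comp (0 : C4)
        ((ContinuousLinearMap.snd ℝ ℂ (Fin 3 → ℂ)).hasFDerivAt.prodMk
          h.analyticAt_imDefect.differentiableAt.hasFDerivAt))
  have hinj : Function.Injective (fderiv ℝ (flatten Θ) 0) := by
    rw [injective_iff_map_eq_zero]
    intro v hv
    rw [h1.fderiv] at hv
    have hv1 : v.1 = 0 := congr_arg Prod.fst hv
    have hv2 : reAddIm (v.2, fderiv ℝ (imDefect Θ) 0 v) = 0 := congr_arg Prod.snd hv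
    refine Prod.ext hv1 (funext fun j => ?_)
    have h2 := congr_fun hv2 j
    rw [reAddIm_apply, h.fderiv_imDefect_zero] at h2
    have h3 := congr_arg Complex.re h2
    have h4 := congr_arg Complex.im h2
    simp at h3 h4
    exact Complex.ext h3 h4
  exact ⟨(LinearEquiv.ofInjectiveEndo (fderiv ℝ (flatten Θ) 0 : C4 →ₗ[ℝ] C4)
    hinj).toContinuousLinearEquiv, ContinuousLinearMap.ext fun _ => rfl⟩

/-- Near the origin the imaginary parts of the defect form a submersion. -/
theorem eventually_surjective :
    ∀ᶠ q in 𝓝 (0 : C4), Function.Surjective (fderiv ℝ (imDefect Θ) q) := by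
  obtain ⟨e, he⟩ := h.isInvertible_fderiv_flatten
  have h1 : ∀ᶠ q in 𝓝 (0 : C4), (fderiv ℝ (flatten Θ) q).IsInvertible :=
    h.analyticAt_flatten.fderiv.continuousAt.eventually (by rw [← he]; exact e.nhds)
  filter_upwards [h1, h.analyticAt_flatten.eventually_analyticAt,
    h.analyticAt_imDefect.eventually_analyticAt] with q h2 h3 h4 t
  obtain ⟨v, hv⟩ := h2.surjective (0, reAddIm (0, t))
  refine ⟨v, ?_⟩
  have h5 : HasFDerivAt (fun x => imPi (flatten Θ x).2) _ q :=
    (imPi.comp (ContinuousLinearMap.snd ℝ ℂ (Fin 3 → ℂ))).hasFDerivAt.comp q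
      h3.differentiableAt.hasFDerivAt
  have h6 : imDefect Θ = fun x => imPi (flatten Θ x).2 := by
    ext1 x; rw [flatten, imPi_reAddIm]
  rw [h6, h5.fderiv]
  change imPi (fderiv ℝ (flatten Θ) q v).2 = t
  rw [hv, imPi_reAddIm]

/-- Near the origin the real locus is a generic submanifold of codimension three whose complex
tangent line at `q` is spanned by `(1, slope Θ q)`. -/
theorem eventually_complexTangentAt :
    ∀ᶠ q in 𝓝 (0 : C4), ∀ M : Set C4, (∀ᶠ x in 𝓝 q, (x ∈ M ↔ x ∈ realLocus Θ)) → q ∈ M →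
      (∀ v, v ∈ complexTangentAt M q ↔ v.2 = v.1 • slope Θ q) ∧
      tangentSpaceAt M q ⊔ (tangentSpaceAt M q).map J = ⊤ := by
  filter_upwards [h.eventually_eq_zero_of_imDefect.eventually_nhds,
    h.eventually_surjective, h.analyticAt_imDefect.eventually_analyticAt,
    h.analyticAt_defect.eventually_analyticAt, h.eventually_analyticAt]
    with q h2 h3 h4 h5 h6 M h1 hq
  have hT := tangentSpaceAt_eq_ker h4 h3
    (by filter_upwards [h1, h2] with x e1 e2 using e1.trans e2) hq
  set T := tangentSpaceAt M q with hTdef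
  have hC4 : Module.finrank ℝ C4 = 8 := by
    rw [Module.finrank_prod, Module.finrank_pi_fintype]; simp
  have hT5 : Module.finrank ℝ T = 5 := by
    have e1 := LinearMap.finrank_range_add_finrank_ker
      (fderiv ℝ (imDefect Θ) q : C4 →ₗ[ℝ] Fin 3 → ℝ)
    rw [LinearMap.range_eq_top.2 h3, finrank_top, Module.finrank_fin_fun, hC4, ← hT] at e1
    omega
  have hJ : Function.Injective J := by
    intro v v' hv
    exact smul_right_injective C4 Complex.I_ne_zero hv
  have hJT : Module.finrank ℝ (T.map J) = 5 := by
    rw [← (Submodule.equivMapOfInjective J hJ T).finrank_eq, hT5]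
  have hsum := Submodule.finrank_sup_add_finrank_inf_eq T (T.map J)
  rw [hT5, hJT] at hsum
  -- On `T^c M` the equation `dw = dΘ` holds for `v` and `i v`; adding removes the antilinear part.
  have hle : T ⊓ T.map J ≤ lineSpan (slope Θ q) ![] := by
    intro v hv
    obtain ⟨hv1, hv2⟩ := mem_complexTangentAt_iff.1 (show v ∈ complexTangentAt M q from hv)
    have hd : HasFDerivAt (defect Θ) _ q :=
      (ContinuousLinearMap.snd ℝ ℂ (Fin 3 → ℂ)).hasFDerivAt.sub
        ((h6.differentiableAt.hasFDerivAt.restrictScalars ℝ).comp q conjPt.hasFDerivAt)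
    have hzero {u : C4} (hu : u ∈ tangentSpaceAt M q) : u.2 = fderiv ℂ Θ (conjPt q) (conjPt u) := by
      have e1 := fderiv_apply_congr h5 (Y := fun _ => 0) analyticAt_const (by
        filter_upwards [nhdsWithin_le_nhds h1, self_mem_nhdsWithin] with x e1 e2
        exact sub_eq_zero.2 (e1.1 e2)) hu
      rw [hd.fderiv, fderiv_fun_const] at e1
      exact sub_eq_zero.1 e1
    have e1 := hzero hv1
    have e2 := hzero hv2
    set D := fderiv ℂ Θ (conjPt q)
    have e3 : D (conjPt v) = v.1 • slope Θ q + D (0, star v.1, star v.2) := by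
      change _ = v.1 • D (1, 0, 0) + _
      rw [← map_smul, ← map_add]; simp
    have e4 : D (conjPt (Complex.I • v))
        = Complex.I • (v.1 • slope Θ q) - Complex.I • D (0, star v.1, star v.2) := by
      change _ = Complex.I • (v.1 • D (1, 0, 0)) - _
      rw [← map_smul, ← map_smul, ← map_smul, ← map_sub]
      congr 1
      simp [star_smul]
    rw [e3] at e1
    rw [e4] at e2
    refine mem_lineSpan.2 ⟨0, ?_⟩
    have e5 : v.2 = v.1 • slope Θ q - D (0, star v.1, star v.2) := by
      rw [← smul_sub] at e2
      exact smul_right_injective _ Complex.I_ne_zero e2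
    have e6 : (2 : ℂ) • v.2 = (2 : ℂ) • (v.1 • slope Θ q) := by
      calc (2 : ℂ) • v.2 = v.2 + v.2 := two_smul _ _
        _ = (v.1 • slope Θ q + D (0, star v.1, star v.2))
            + (v.1 • slope Θ q - D (0, star v.1, star v.2)) := congr_arg₂ _ e1 e5
        _ = _ := by module
    simpa using smul_right_injective _ two_ne_zero e6
  have hline : Module.finrank ℝ (lineSpan (slope Θ q) ![]) = 2 + 0 :=
    finrank_lineSpan_iff.2 linearIndependent_empty_type
  have h8 := Submodule.finrank_le (T ⊔ T.map J)
  have h9 := Submodule.finrank_mono hle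
  have heq : T ⊓ T.map J = lineSpan (slope Θ q) ![] :=
    Submodule.eq_of_le_of_finrank_le hle (by omega)
  constructor
  · intro v
    rw [complexTangentAt, ← hTdef, heq, mem_lineSpan]
    simp
  · apply Submodule.eq_top_of_finrank_eq
    omega

end IsRealDefining

/-! ### The third-order invariants of a defining function in normal form -/

/-- The coordinate `z` on `C5`. -/
def zForm : C5 →L[ℂ] ℂ := ContinuousLinearMap.fst ℂ ℂ (ℂ × (Fin 3 → ℂ))

/-- The coordinate `ζ` on `C5`. -/
def zetaForm : C5 →L[ℂ] ℂ :=
  (ContinuousLinearMap.fst ℂ ℂ (Fin 3 → ℂ)).comp (ContinuousLinearMap.snd ℂ ℂ (ℂ × (Fin 3 → ℂ)))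

/-- The coordinates `τ` on `C5`. -/
def tauForm : C5 →L[ℂ] (Fin 3 → ℂ) :=
  (ContinuousLinearMap.snd ℂ ℂ (Fin 3 → ℂ)).comp (ContinuousLinearMap.snd ℂ ℂ (ℂ × (Fin 3 → ℂ)))

@[simp] theorem zForm_apply (p : C5) : zForm p = p.1 := rfl
@[simp] theorem zetaForm_apply (p : C5) : zetaForm p = p.2.1 := rfl
@[simp] theorem tauForm_apply (p : C5) : tauForm p = p.2.2 := rfl

section NormalForm

variable {Λ K : C4 → Fin 3 → ℂ}

/-- The derivative of a product of the conjugate of `z` with a vector valued function. -/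
theorem hasFDerivAt_star_smul {x : C4} (hK : DifferentiableAt ℝ K x) :
    HasFDerivAt (fun x : C4 => star x.1 • K x)
      (star x.1 • fderiv ℝ K x +
        (((starL' ℝ : ℂ ≃L[ℝ] ℂ) : ℂ →L[ℝ] ℂ).comp
          (ContinuousLinearMap.fst ℝ ℂ (Fin 3 → ℂ))).smulRight (K x)) x :=
  (((starL' ℝ : ℂ ≃L[ℝ] ℂ) : ℂ →L[ℝ] ℂ).comp
    (ContinuousLinearMap.fst ℝ ℂ (Fin 3 → ℂ))).hasFDerivAt.smul hK.hasFDerivAt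

theorem fderiv_star_smul_apply {x : C4} (hK : DifferentiableAt ℝ K x) (v : C4) :
    fderiv ℝ (fun x : C4 => star x.1 • K x) x v = star x.1 • fderiv ℝ K x v + star v.1 • K x := by
  rw [(hasFDerivAt_star_smul hK).fderiv]
  rfl

/-- The antilinear part of the derivative of `K` along the line field of `Λ`. -/
def antilinearPart (Λ K : C4 → Fin 3 → ℂ) (x : C4) : Fin 3 → ℂ :=
  (2 : ℂ)⁻¹ • (fderiv ℝ K x (1, Λ x) + Complex.I • fderiv ℝ K x (Complex.I, Complex.I • Λ x))

/-- For `Λ = conj z * K` the Levi vector is `K` up to a multiple of `conj z`. -/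
theorem leviVector_eventually_eq (hK : AnalyticAt ℝ K 0)
    (h : ∀ᶠ x in 𝓝 (0 : C4), Λ x = star x.1 • K x) :
    ∀ᶠ x in 𝓝 (0 : C4), leviVector Λ x = K x + star x.1 • antilinearPart Λ K x := by
  filter_upwards [h.eventually_nhds, hK.eventually_analyticAt] with x h1 h2
  have h3 : Λ =ᶠ[𝓝 x] fun x => star x.1 • K x := h1
  rw [leviVector, h3.fderiv_eq, fderiv_star_smul_apply h2.differentiableAt,
    fderiv_star_smul_apply h2.differentiableAt, antilinearPart]
  simp only [star_one, one_smul, Complex.star_def, Complex.conj_I, smul_add, smul_smul,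
    mul_neg, Complex.I_mul_I]
  module

theorem analyticAt_antilinearPart (hΛ : AnalyticAt ℝ Λ 0) (hK : AnalyticAt ℝ K 0) :
    AnalyticAt ℝ (antilinearPart Λ K) 0 := by
  have h1 := analyticAt_fderiv_apply hK (analyticAt_liftField hΛ (a := fun _ => 1) analyticAt_const)
  have h2 := analyticAt_fderiv_apply hK
    (analyticAt_liftField hΛ (a := fun _ => Complex.I) analyticAt_const)
  have h3 : antilinearPart Λ K = fun x => (2 : ℂ)⁻¹ • (fderiv ℝ K x (liftField Λ (fun _ => 1) x)
      + Complex.I • fderiv ℝ K x (liftField Λ (fun _ => Complex.I) x)) := by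
    ext1 x; simp [antilinearPart, liftField]
  rw [h3]
  exact AnalyticAt.fun_const_smul (c := (2 : ℂ)⁻¹)
    (h1.add (AnalyticAt.fun_const_smul (c := Complex.I) h2))

theorem leviVector_zero_of_star_smul (hK : AnalyticAt ℝ K 0)
    (h : ∀ᶠ x in 𝓝 (0 : C4), Λ x = star x.1 • K x) : leviVector Λ 0 = K 0 := by
  rw [(leviVector_eventually_eq hK h).self_of_nhds]; simp

theorem thirdVector_zero_of_star_smul (hK : AnalyticAt ℝ K 0) (hΛ : AnalyticAt ℝ Λ 0)
    (h : ∀ᶠ x in 𝓝 (0 : C4), Λ x = star x.1 • K x) (b : ℂ) :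
    thirdVector Λ 0 b = Complex.I • (fderiv ℝ K 0 (b, 0) + star b • (2 : ℂ)⁻¹ •
      (fderiv ℝ K 0 (1, 0) + Complex.I • fderiv ℝ K 0 (Complex.I, 0))) := by
  have hS := analyticAt_antilinearPart hΛ hK
  have h0 : Λ 0 = 0 := by rw [h.self_of_nhds]; simp
  have h1 : leviVector Λ =ᶠ[𝓝 0] fun x => K x + star x.1 • antilinearPart Λ K x :=
    leviVector_eventually_eq hK h
  have h2 : HasFDerivAt (fun x => K x + star x.1 • antilinearPart Λ K x) _ 0 :=
    hK.differentiableAt.hasFDerivAt.add (hasFDerivAt_star_smul hS.differentiableAt)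
  have h3 : fderiv ℝ (leviVector Λ) 0 (b, 0)
      = fderiv ℝ K 0 (b, 0) + star b • antilinearPart Λ K 0 := by
    rw [h1.fderiv_eq, h2.fderiv]
    simp
  have h4 : Λ =ᶠ[𝓝 0] fun x => star x.1 • K x := h
  rw [thirdVector, h0, smul_zero, h3, h4.fderiv_eq, fderiv_star_smul_apply hK.differentiableAt,
    antilinearPart, h0]
  simp

variable {Θ G : C5 → Fin 3 → ℂ}

/-- The factor `K` with `slope Θ = conj z * K`, when `Θ = τ + z ζ G`. -/
def slopeFactor (G : C5 → Fin 3 → ℂ) (x : C4) : Fin 3 → ℂ :=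
  G (conjPt x) + x.1 • fderiv ℂ G (conjPt x) (1, 0, 0)

theorem hasFDerivAt_of_normal {p : C5} (hG : DifferentiableAt ℂ G p)
    (hΘ : Θ =ᶠ[𝓝 p] fun p => p.2.2 + (p.1 * p.2.1) • G p) (v : C5) :
    fderiv ℂ Θ p v = v.2.2 + ((p.1 * p.2.1) • fderiv ℂ G p v
      + (p.1 * v.2.1 + p.2.1 * v.1) • G p) := by
  have h1 : HasFDerivAt (fun p : C5 => p.2.2 + (p.1 * p.2.1) • G p) _ p :=
    tauForm.hasFDerivAt.add ((zForm.hasFDerivAt.mul zetaForm.hasFDerivAt).smul hG.hasFDerivAt)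
  rw [hΘ.fderiv_eq, h1.fderiv]
  rfl

theorem isRealDefining_of_normal (hG : AnalyticAt ℂ G 0)
    (hΘ : ∀ᶠ p in 𝓝 (0 : C5), Θ p = p.2.2 + (p.1 * p.2.1) • G p)
    (hr : ∀ᶠ p in 𝓝 (0 : C5), star (Θ (star p.2.1, star p.1, star (Θ p))) = p.2.2) :
    IsRealDefining Θ where
  analyticAt := by
    have h1 : AnalyticAt ℂ (fun p : C5 => p.2.2 + (p.1 * p.2.1) • G p) 0 :=
      (tauForm.analyticAt 0).add (((zForm.analyticAt 0).mul (zetaForm.analyticAt 0)).smul hG)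
    exact h1.congr (hΘ.mono fun _ h => h.symm)
  map_zero := by rw [hΘ.self_of_nhds]; simp
  fderiv_apply v := by rw [hasFDerivAt_of_normal hG.differentiableAt hΘ]; simp
  reality := hr

theorem analyticAt_slope (hΘ : AnalyticAt ℂ Θ 0) : AnalyticAt ℝ (slope Θ) 0 := by
  have h1 : AnalyticAt ℂ (fun y => fderiv ℂ Θ y (1, 0, 0)) (conjPt 0) := by
    rw [map_zero]
    exact (hΘ.fderiv.contDiffAt.clm_apply contDiffAt_const).analyticAt
  exact h1.restrictScalars.comp (conjPt.analyticAt 0)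

theorem analyticAt_slopeFactor (hG : AnalyticAt ℂ G 0) : AnalyticAt ℝ (slopeFactor G) 0 := by
  have h0 : AnalyticAt ℂ G (conjPt 0) := by rwa [map_zero]
  exact (h0.restrictScalars.comp (conjPt.analyticAt 0)).add
    (analyticAt_fst.smul (analyticAt_slope hG))

theorem slope_eventually_eq (hG : AnalyticAt ℂ G 0)
    (hΘ : ∀ᶠ p in 𝓝 (0 : C5), Θ p = p.2.2 + (p.1 * p.2.1) • G p) :
    ∀ᶠ x in 𝓝 (0 : C4), slope Θ x = star x.1 • slopeFactor G x := by
  filter_upwards [tendsto_conjPt.eventually hΘ.eventually_nhds,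
    tendsto_conjPt.eventually hG.eventually_analyticAt] with x h1 h2
  rw [slope, hasFDerivAt_of_normal h2.differentiableAt h1, slopeFactor]
  simp only [conjPt_apply]
  module

theorem fderiv_slopeFactor_zero (hG : AnalyticAt ℂ G 0) (v : C4) :
    fderiv ℝ (slopeFactor G) 0 v = fderiv ℂ G 0 (conjPt v) + v.1 • fderiv ℂ G 0 (1, 0, 0) := by
  have h0 : HasFDerivAt G (fderiv ℂ G 0) (conjPt 0) := by
    rw [map_zero]; exact hG.differentiableAt.hasFDerivAt
  have h1 : HasFDerivAt (slopeFactor G) _ 0 :=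
    ((h0.restrictScalars ℝ).comp (0 : C4) conjPt.hasFDerivAt).add
      ((ContinuousLinearMap.fst ℝ ℂ (Fin 3 → ℂ)).hasFDerivAt.smul
        (analyticAt_slope hG).differentiableAt.hasFDerivAt)
  rw [h1.fderiv]
  simp [Prod.mk_zero_zero]

theorem leviVector_slope_zero (hG : AnalyticAt ℂ G 0)
    (hΘ : ∀ᶠ p in 𝓝 (0 : C5), Θ p = p.2.2 + (p.1 * p.2.1) • G p) :
    leviVector (slope Θ) 0 = G 0 := by
  rw [leviVector_zero_of_star_smul (analyticAt_slopeFactor hG) (slope_eventually_eq hG hΘ),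
    slopeFactor]
  simp [Prod.mk_zero_zero]

/-- The third-order vectors at the origin in terms of the `z` and `ζ` derivatives of `G`. -/
theorem thirdVector_slope_zero (hG : AnalyticAt ℂ G 0) (hΘa : AnalyticAt ℂ Θ 0)
    (hΘ : ∀ᶠ p in 𝓝 (0 : C5), Θ p = p.2.2 + (p.1 * p.2.1) • G p) (b : ℂ) :
    thirdVector (slope Θ) 0 b
      = Complex.I • ((2 * b) • fderiv ℂ G 0 (1, 0, 0) + (2 * star b) • fderiv ℂ G 0 (0, 1, 0)) := by
  have h1 (b : ℂ) : fderiv ℂ G 0 (conjPt (b, 0))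
      = b • fderiv ℂ G 0 (1, 0, 0) + star b • fderiv ℂ G 0 (0, 1, 0) := by
    rw [← map_smul, ← map_smul, ← map_add]; simp
  rw [thirdVector_zero_of_star_smul (analyticAt_slopeFactor hG) (analyticAt_slope hΘa)
    (slope_eventually_eq hG hΘ)]
  simp only [fderiv_slopeFactor_zero hG, h1]
  congr 1
  simp only [star_one, Complex.star_def, Complex.conj_I]
  have hI := Complex.I_mul_I
  generalize fderiv ℂ G 0 (1, 0, 0) = A
  generalize fderiv ℂ G 0 (0, 1, 0) = B
  ext j
  simp only [Pi.add_apply, Pi.smul_apply, smul_eq_mul]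
  linear_combination (starRingEnd ℂ b) * (A j - B j / 2) * hI

/-- If `i` times the Levi vector and the two third-order vectors are independent at the origin, then
they are so nearby, and the real locus is maximally minimal near the origin. -/
theorem eventually_maximallyMinimal (hΘ : IsRealDefining Θ)
    (hind : LinearIndependent ℝ ![Complex.I • leviVector (slope Θ) 0, thirdVector (slope Θ) 0 1,
      thirdVector (slope Θ) 0 Complex.I]) :
    ∀ᶠ q in 𝓝 (0 : C4), ∀ M : Set C4, (∀ᶠ x in 𝓝 q, (x ∈ M ↔ x ∈ realLocus Θ)) → q ∈ M →
      Module.finrank ℝ (D1 M q) = 2 ∧ Module.finrank ℝ (D2 M q) = 3 ∧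
      Module.finrank ℝ (D3 M q) = 5 := by
  have hΛ := analyticAt_slope hΘ.analyticAt
  have hQ := analyticAt_leviVector hΛ
  have hN (b : ℂ) : AnalyticAt ℝ (fun x => thirdVector (slope Θ) x b) 0 := by
    have h1 := analyticAt_fderiv_apply hQ
      (analyticAt_liftField hΛ (a := fun _ => b) analyticAt_const)
    have h2 := analyticAt_fderiv_apply hΛ (X := fun x => (0, Complex.I • leviVector (slope Θ) x))
      (analyticAt_const.prod (AnalyticAt.fun_const_smul (c := Complex.I) hQ))
    exact (AnalyticAt.fun_const_smul (c := Complex.I) h1).sub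
      (AnalyticAt.fun_const_smul (c := b) h2)
  have hcont : ContinuousAt (fun x => ![Complex.I • leviVector (slope Θ) x,
      thirdVector (slope Θ) x 1, thirdVector (slope Θ) x Complex.I]) 0 := by
    refine continuousAt_pi.2 fun i => ?_
    fin_cases i
    · exact (AnalyticAt.fun_const_smul (c := Complex.I) hQ).continuousAt
    · exact (hN 1).continuousAt
    · exact (hN Complex.I).continuousAt
  filter_upwards [hcont.eventually hind.eventually, hΛ.eventually_analyticAt,
    hΘ.eventually_complexTangentAt.eventually_nhds] with q h1 h2 h3 M hM hq
  have h4 : ∀ᶠ x in 𝓝[M] q, ∀ v, v ∈ complexTangentAt M x ↔ v.2 = v.1 • slope Θ x := by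
    refine eventually_nhdsWithin_iff.2 ?_
    filter_upwards [h3, hM.eventually_nhds] with x h5 h6 hx using (h5 M h6 hx).1
  refine ⟨?_, ?_, ?_⟩
  · rw [D1_eq_lineSpan hq h4]
    exact finrank_lineSpan_iff.2 linearIndependent_empty_type
  · rw [D2_eq_lineSpan hq h2 h4]
    refine finrank_lineSpan_iff.2 ?_
    have h5 := h1.comp ![0] (fun i j _ => Subsingleton.elim i j)
    have h6 : (![Complex.I • leviVector (slope Θ) q, thirdVector (slope Θ) q 1,
        thirdVector (slope Θ) q Complex.I] ∘ ![0]) = ![Complex.I • leviVector (slope Θ) q] := by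
      ext1 i; fin_cases i; rfl
    rwa [h6] at h5
  · rw [D3_eq_lineSpan hq h2 h4]
    exact finrank_lineSpan_iff.2 h1

/-- If `D³` has rank at least five at the origin then the three vectors are independent. -/
theorem linearIndependent_of_finrank_D3 (hΘ : IsRealDefining Θ) {M : Set C4}
    (hM : ∀ᶠ x in 𝓝 (0 : C4), (x ∈ M ↔ x ∈ realLocus Θ)) (h0 : (0 : C4) ∈ M)
    (hD : 5 ≤ Module.finrank ℝ (D3 M 0)) :
    LinearIndependent ℝ ![Complex.I • leviVector (slope Θ) 0, thirdVector (slope Θ) 0 1,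
      thirdVector (slope Θ) 0 Complex.I] := by
  have h4 : ∀ᶠ x in 𝓝[M] (0 : C4), ∀ v, v ∈ complexTangentAt M x ↔ v.2 = v.1 • slope Θ x := by
    refine eventually_nhdsWithin_iff.2 ?_
    filter_upwards [hΘ.eventually_complexTangentAt, hM.eventually_nhds] with x h5 h6 hx
      using (h5 M h6 hx).1
  rw [D3_eq_lineSpan h0 (analyticAt_slope hΘ.analyticAt) h4] at hD
  exact finrank_lineSpan_iff.1 (le_antisymm finrank_lineSpan_le hD)

end NormalForm

/-! ### Admissible remainders -/

/-- An equation may be divided by a nonzero linear form. -/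
theorem eventually_eq_zero_of_smul {F : Type*} [NormedAddCommGroup F] [NormedSpace ℂ F]
    {ℓ : C5 →L[ℂ] ℂ} {e : C5} (he : ℓ e = 1) {K : C5 → F}
    (hK : ∀ᶠ p in 𝓝 (0 : C5), ContinuousAt K p) (h : ∀ᶠ p in 𝓝 (0 : C5), ℓ p • K p = 0) :
    ∀ᶠ p in 𝓝 (0 : C5), K p = 0 := by
  filter_upwards [hK, h.eventually_nhds] with p h1 h2
  by_cases hp : ℓ p = 0
  · have h3 : Tendsto (fun t : ℂ => p + t • e) (𝓝[≠] 0) (𝓝 p) := by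
      have : Continuous fun t : ℂ => p + t • e := by fun_prop
      have := this.tendsto 0
      simp only [zero_smul, add_zero] at this
      exact this.mono_left nhdsWithin_le_nhds
    have h4 : Tendsto (fun t : ℂ => K (p + t • e)) (𝓝[≠] 0) (𝓝 (K p)) := h1.tendsto.comp h3
    have h5 : Tendsto (fun t : ℂ => K (p + t • e)) (𝓝[≠] 0) (𝓝 0) := by
      refine tendsto_const_nhds.congr' ?_
      filter_upwards [h3.eventually h2, self_mem_nhdsWithin] with t h6 h7
      rw [map_add, map_smul, hp, he, zero_add, smul_eq_mul, mul_one] at h6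
      exact ((smul_eq_zero.1 h6).resolve_left h7).symm
    exact tendsto_nhds_unique h4 h5
  · exact (smul_eq_zero.1 h2.self_of_nhds).resolve_left hp

/-- A function which satisfies the normality conditions is divisible by `z ζ`. -/
theorem exists_factor_of_normal {F : Type*} [NormedAddCommGroup F] [NormedSpace ℂ F]
    [CompleteSpace F] {f : C5 → F} (hf : AnalyticAt ℂ f 0)
    (h : ∀ᶠ p in 𝓝 (0 : C5), f (0, p.2.1, p.2.2) = 0 ∧ f (p.1, 0, p.2.2) = 0) :
    ∃ G : C5 → F, AnalyticAt ℂ G 0 ∧ ∀ᶠ p in 𝓝 (0 : C5), f p = (p.1 * p.2.1) • G p := by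
  obtain ⟨g, hg, hfg⟩ := exists_analyticAt_smul_eq hf (1, 0, 0) zForm (by
    filter_upwards [h] with p hp
    have : p - zForm p • ((1, 0, 0) : C5) = (0, p.2.1, p.2.2) := by
      refine Prod.ext ?_ (Prod.ext ?_ ?_) <;> simp
    rw [this]; exact hp.1)
  let π : C5 → C5 := fun p => (p.1, 0, p.2.2)
  have hπc : Continuous π := by fun_prop
  have hπ0 : Tendsto π (𝓝 0) (𝓝 0) := by
    simpa [π, Prod.mk_zero_zero] using hπc.tendsto 0
  have hgπ : ∀ᶠ p in 𝓝 (0 : C5), g (π p) = 0 := by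
    refine eventually_eq_zero_of_smul (ℓ := zForm) (e := (1, 0, 0)) rfl ?_ ?_
    · filter_upwards [hπ0.eventually hg.eventually_continuousAt] with p hp
      exact hp.comp hπc.continuousAt
    · filter_upwards [h, hπ0.eventually hfg] with p h1 h2
      exact h2.symm.trans h1.2
  obtain ⟨G, hG, hgG⟩ := exists_analyticAt_smul_eq hg (0, 1, 0) zetaForm (by
    filter_upwards [hgπ] with p hp
    have : p - zetaForm p • ((0, 1, 0) : C5) = π p := by
      refine Prod.ext ?_ (Prod.ext ?_ ?_) <;> simp [π]
    rw [this]; exact hp)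
  refine ⟨G, hG, ?_⟩
  filter_upwards [hfg, hgG] with p h1 h2
  rw [h1, h2, smul_smul]; rfl

/-- The quotient of the leading terms by `z ζ`. -/
def leadingFactor (p : C5) : Fin 3 → ℂ :=
  ![2 * Complex.I, 2 * Complex.I * (p.1 + p.2.1), 2 * (p.1 - p.2.1)]

theorem leading_eq (j : Fin 3) (p : C5) : leading j p = p.1 * p.2.1 * leadingFactor p j := by
  fin_cases j <;> simp [leading, leadingFactor] <;> ring

theorem leadingFactor_eq : leadingFactor = fun p => ![2 * Complex.I, 0, 0]
    + (zForm.smulRight ![0, 2 * Complex.I, 2] + zetaForm.smulRight ![0, 2 * Complex.I, -2]) p := by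
  ext p j
  fin_cases j <;> simp [leadingFactor] <;> ring

theorem analyticAt_leadingFactor (p : C5) : AnalyticAt ℂ leadingFactor p := by
  rw [leadingFactor_eq]
  exact analyticAt_const.add (ContinuousLinearMap.analyticAt _ p)

theorem fderiv_leadingFactor (p : C5) : fderiv ℂ leadingFactor p
    = zForm.smulRight ![0, 2 * Complex.I, 2] + zetaForm.smulRight ![0, 2 * Complex.I, -2] := by
  rw [leadingFactor_eq]
  exact ((hasFDerivAt_const _ _).add (ContinuousLinearMap.hasFDerivAt _)).fderiv.trans (zero_add _)

/-- A function of one variable that is `O(s²)` off the origin vanishes there with its derivative. -/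
theorem eq_zero_of_isBigO_sq {k : ℂ → ℂ} {k' : ℂ} (hk : HasDerivAt k k' 0)
    (h : k =O[𝓝[≠] 0] fun s => ‖s‖ ^ 2) : k 0 = 0 ∧ k' = 0 := by
  have h0 : k 0 = 0 := by
    have h1 : Tendsto k (𝓝[≠] 0) (𝓝 (k 0)) := hk.continuousAt.tendsto.mono_left nhdsWithin_le_nhds
    have h2 : Tendsto k (𝓝[≠] 0) (𝓝 0) := by
      refine h.trans_tendsto ?_
      have : Continuous fun s : ℂ => ‖s‖ ^ 2 := by fun_prop
      simpa using (this.tendsto 0).mono_left nhdsWithin_le_nhds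
    exact tendsto_nhds_unique h1 h2
  refine ⟨h0, ?_⟩
  have h1 : k =O[𝓝 0] fun s => ‖s - 0‖ ^ 2 := by
    obtain ⟨c, hc⟩ := h.bound
    refine Asymptotics.IsBigO.of_bound c ?_
    filter_upwards [eventually_nhdsWithin_iff.1 hc] with s hs
    by_cases hs0 : s = 0
    · subst hs0; simp [h0]
    · simpa using hs hs0
  have h2 := (h1.hasFDerivAt (by norm_num)).hasDerivAt
  have := hk.unique h2
  simpa using this

/-- The order condition forces the quotient of a remainder by `z ζ` to vanish to second order
along `τ = 0`. -/
theorem factor_eq_zero_of_hasRemainderOrder {f G : C5 → ℂ} (hf : HasRemainderOrder f)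
    (hG : AnalyticAt ℂ G 0) (hfG : ∀ᶠ p in 𝓝 (0 : C5), f p = p.1 * p.2.1 * G p) :
    G 0 = 0 ∧ fderiv ℂ G 0 (1, 0, 0) = 0 ∧ fderiv ℂ G 0 (0, 1, 0) = 0 := by
  obtain ⟨A, B, -, -, hAO, hBO, hAB⟩ := hf
  -- Along the lines `s ↦ (s a, s b, 0)` the term with `B` vanishes, and dividing `A = O(s⁴)` by
  -- `s² a b` shows that `G` is `O(s²)`.
  have key (a b : ℂ) (ha : a ≠ 0) (hb : b ≠ 0) : G 0 = 0 ∧ fderiv ℂ G 0 (a, b, 0) = 0 := by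
    let u : C5 := (a, b, 0)
    have hu : Tendsto (fun s : ℂ => s • u) (𝓝 0) (𝓝 0) := by
      have : Continuous fun s : ℂ => s • u := by fun_prop
      simpa using this.tendsto 0
    have hk : HasDerivAt (fun s : ℂ => G (s • u)) (fderiv ℂ G 0 u) 0 := by
      have h1 : HasFDerivAt G (fderiv ℂ G 0) ((0 : ℂ) • u) := by
        rw [zero_smul]; exact hG.differentiableAt.hasFDerivAt
      have h2 : HasDerivAt (fun s : ℂ => s • u) u 0 := by
        simpa using (hasDerivAt_id (0 : ℂ)).smul_const u
      exact h1.comp_hasDerivAt (0 : ℂ) h2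
    obtain ⟨c, hc⟩ := hAO.bound
    obtain ⟨c', hc'⟩ := hBO.bound
    have h3 := eq_zero_of_isBigO_sq hk (by
      refine Asymptotics.IsBigO.of_bound (c * ‖(a, b)‖ ^ 4 / (‖a‖ * ‖b‖)) ?_
      filter_upwards [nhdsWithin_le_nhds (hu.eventually hc), nhdsWithin_le_nhds (hu.eventually hc'),
        nhdsWithin_le_nhds (hu.eventually hAB), nhdsWithin_le_nhds (hu.eventually hfG),
        self_mem_nhdsWithin] with s h1 h2 h3 h4 hs
      have hs0 : 0 < ‖s‖ := norm_pos_iff.2 hs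
      have ha0 : 0 < ‖a‖ := norm_pos_iff.2 ha
      have hb0 : 0 < ‖b‖ := norm_pos_iff.2 hb
      have e1 : B (s • u) = 0 := by
        have : ‖(s • u).2.2‖ = 0 := by simp [u]
        rw [this] at h2
        simpa using h2
      have e2 : A (s • u) = s ^ 2 * (a * b) * G (s • u) := by
        rw [h4, e1] at h3
        simp only [u, Prod.smul_fst, Prod.smul_snd, smul_eq_mul, mul_zero, add_zero] at h3 ⊢
        rw [← h3]; ring
      have e3 : ‖((s • u).1, (s • u).2.1)‖ = ‖s‖ * ‖(a, b)‖ := by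
        rw [← norm_smul]; rfl
      rw [e2, e3] at h1
      simp only [norm_mul, norm_pow, Real.norm_eq_abs, abs_norm] at h1 ⊢
      rw [div_mul_eq_mul_div, le_div_iff₀ (by positivity)]
      have h5 : ‖s‖ ^ 2 * (‖G (s • u)‖ * (‖a‖ * ‖b‖)) ≤ ‖s‖ ^ 2 * (c * ‖(a, b)‖ ^ 4 * ‖s‖ ^ 2) := by
        calc _ = ‖s‖ ^ 2 * (‖a‖ * ‖b‖) * ‖G (s • u)‖ := by ring
          _ ≤ _ := h1
          _ = _ := by ring
      exact le_of_mul_le_mul_left h5 (by positivity))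
    simpa using h3
  have h1 := key 1 1 one_ne_zero one_ne_zero
  have h2 := key 1 (-1) one_ne_zero (neg_ne_zero.2 one_ne_zero)
  have e1 : ((1, 1, 0) : C5) = (1, 0, 0) + (0, 1, 0) := by simp
  have e2 : ((1, -1, 0) : C5) = (1, 0, 0) - (0, 1, 0) := by simp
  rw [e1, map_add] at h1
  rw [e2, map_sub] at h2
  refine ⟨h1.1, ?_, ?_⟩
  · linear_combination (h1.2 + h2.2) / 2
  · linear_combination (h1.2 - h2.2) / 2

/-- The vector valued function with components `theta P j`. -/
def thetaVec (P : Fin 3 → C5 → ℂ) (p : C5) : Fin 3 → ℂ := fun j => theta P j p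

theorem satisfiesEquations_iff {P : Fin 3 → C5 → ℂ} {x : C4} :
    SatisfiesEquations P x ↔ x ∈ realLocus (thetaVec P) := by
  change (∀ j, _) ↔ x.2 = thetaVec P (conjPt x)
  rw [funext_iff]
  refine forall_congr' fun j => ?_
  simp only [thetaVec, theta, conjPt_apply, Pi.star_apply]
  constructor
  · intro h; linear_combination h
  · intro h; linear_combination h

/-- For an admissible triple, `Θ = τ + z ζ G` where `G` and its derivatives in `z` and `ζ` have at
the origin the values of the model. -/
theorem AdmissibleRemainders.exists_factor {P : Fin 3 → C5 → ℂ} (hP : AdmissibleRemainders P) :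
    ∃ G : C5 → Fin 3 → ℂ, AnalyticAt ℂ G 0 ∧
      (∀ᶠ p in 𝓝 (0 : C5), thetaVec P p = p.2.2 + (p.1 * p.2.1) • G p) ∧
      G 0 = ![2 * Complex.I, 0, 0] ∧ fderiv ℂ G 0 (1, 0, 0) = ![0, 2 * Complex.I, 2] ∧
      fderiv ℂ G 0 (0, 1, 0) = ![0, 2 * Complex.I, -2] := by
  choose g hg hPg using fun j => exists_factor_of_normal (hP.1 j).1 (hP.1 j).2.2
  have hz (j : Fin 3) := factor_eq_zero_of_hasRemainderOrder (hP.1 j).2.1 (hg j) (hPg j)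
  have hgv : AnalyticAt ℂ (fun p j => g j p) 0 := AnalyticAt.pi hg
  have hd (v : C5) (j : Fin 3) : fderiv ℂ (fun p j => g j p) 0 v j = fderiv ℂ (g j) 0 v := by
    rw [fderiv_pi fun j => (hg j).differentiableAt]; rfl
  have hfd : fderiv ℂ (fun p => leadingFactor p + fun j => g j p) 0
      = fderiv ℂ leadingFactor 0 + fderiv ℂ (fun p j => g j p) 0 :=
    fderiv_fun_add (analyticAt_leadingFactor 0).differentiableAt hgv.differentiableAt
  refine ⟨fun p => leadingFactor p + fun j => g j p, (analyticAt_leadingFactor 0).add hgv,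
    ?_, ?_, ?_, ?_⟩
  · filter_upwards [eventually_all.2 hPg] with p hp
    ext j
    simp only [thetaVec, theta, leading_eq, hp j, Pi.add_apply, Pi.smul_apply, smul_eq_mul]
    ring
  · ext j
    fin_cases j <;> simp [leadingFactor, (hz _).1]
  · rw [hfd, fderiv_leadingFactor]
    ext j
    rw [add_apply, Pi.add_apply, hd, (hz j).2.1]
    fin_cases j <;> simp
  · rw [hfd, fderiv_leadingFactor]
    ext j
    rw [add_apply, Pi.add_apply, hd, (hz j).2.2]
    fin_cases j <;> simp

theorem AdmissibleRemainders.isRealDefining {P : Fin 3 → C5 → ℂ} (hP : AdmissibleRemainders P) :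
    IsRealDefining (thetaVec P) := by
  obtain ⟨G, hG, hΘ, -⟩ := hP.exists_factor
  refine isRealDefining_of_normal hG hΘ ?_
  filter_upwards [hP.2] with p hp
  ext j
  exact (hp j).symm

theorem AdmissibleRemainders.linearIndependent {P : Fin 3 → C5 → ℂ}
    (hP : AdmissibleRemainders P) : LinearIndependent ℝ
      ![Complex.I • leviVector (slope (thetaVec P)) 0, thirdVector (slope (thetaVec P)) 0 1,
        thirdVector (slope (thetaVec P)) 0 Complex.I] := by
  obtain ⟨G, hG, hΘ, h0, h1, h2⟩ := hP.exists_factor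
  have ha := hP.isRealDefining.analyticAt
  rw [leviVector_slope_zero hG hΘ, thirdVector_slope_zero hG ha hΘ,
    thirdVector_slope_zero hG ha hΘ, h0, h1, h2, Fintype.linearIndependent_iff]
  intro c hc
  rw [Fin.sum_univ_three] at hc
  have e0 := congr_arg Complex.re (congr_fun hc 0)
  have e1 := congr_arg Complex.re (congr_fun hc 1)
  have e2 := congr_arg Complex.re (congr_fun hc 2)
  simp at e0 e1 e2
  intro j
  fin_cases j
  · simpa using e0
  · simp; linarith
  · simp; linarith

/-- An admissible triple defines near the origin a connected generic submanifold that is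
maximally minimal. -/
theorem AdmissibleRemainders.exists_nhd {P : Fin 3 → C5 → ℂ} (hP : AdmissibleRemainders P) :
    ∃ U : Set C4, IsOpen U ∧ (0 : C4) ∈ U ∧
      (0 : C4) ∈ {x ∈ U | SatisfiesEquations P x} ∧
      IsConnected {x ∈ U | SatisfiesEquations P x} ∧
      IsRealAnalyticSubmanifold 3 {x ∈ U | SatisfiesEquations P x} ∧
      IsCRGeneric {x ∈ U | SatisfiesEquations P x} ∧
      IsMaximallyMinimal {x ∈ U | SatisfiesEquations P x} := by
  set Θ := thetaVec P with hΘdef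
  have h : IsRealDefining Θ := hP.isRealDefining
  obtain ⟨e, he⟩ := h.isInvertible_fderiv_flatten
  have hst : HasStrictFDerivAt (flatten Θ) (e : C4 →L[ℝ] C4) 0 := by
    rw [he]; exact h.analyticAt_flatten.hasStrictFDerivAt
  let φ := hst.toOpenPartialHomeomorph (flatten Θ)
  have hφ : (φ : C4 → C4) = flatten Θ := hst.toOpenPartialHomeomorph_coe
  have h0s : (0 : C4) ∈ φ.source := hst.mem_toOpenPartialHomeomorph_source
  have hd0 : imDefect Θ 0 = 0 := by
    ext j
    simp [imDefect, defect, h.map_zero, Prod.mk_zero_zero]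
  have hφ0 : φ 0 = 0 := by
    rw [hφ, flatten, hd0]
    simp [Prod.mk_zero_zero]
  have hgood := (h.eventually_eq_zero_of_imDefect.eventually_nhds.and
    (h.eventually_surjective.and h.analyticAt_imDefect.eventually_analyticAt)).and
    (h.eventually_complexTangentAt.and (eventually_maximallyMinimal h hP.linearIndependent))
  have hsymm : Tendsto φ.symm (𝓝 0) (𝓝 0) := by
    have := φ.continuousAt_symm (φ.map_source h0s)
    rw [ContinuousAt, φ.left_inv h0s, hφ0] at this
    exact this
  have ht0 : ∀ᶠ y in 𝓝 (0 : C4), y ∈ φ.target :=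
    φ.open_target.mem_nhds (by rw [← hφ0]; exact φ.map_source h0s)
  obtain ⟨ε, hε, hball⟩ := Metric.eventually_nhds_iff_ball.1 (ht0.and (hsymm.eventually hgood))
  let U : Set C4 := φ.source ∩ φ ⁻¹' Metric.ball 0 ε
  have hU : IsOpen U := φ.isOpen_inter_preimage Metric.isOpen_ball
  have h0U : (0 : C4) ∈ U := ⟨h0s, by
    rw [Set.mem_preimage, hφ0]; exact Metric.mem_ball_self hε⟩
  have hUgood {q : C4} (hq : q ∈ U) := by
    have := (hball _ hq.2).2
    rw [φ.left_inv hq.1] at this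
    exact this
  set M : Set C4 := {x ∈ U | SatisfiesEquations P x} with hM
  have hMmem {x : C4} (hx : x ∈ U) : x ∈ M ↔ x ∈ realLocus Θ := by
    rw [← satisfiesEquations_iff]; exact and_iff_right hx
  have hMnhds {q : C4} (hq : q ∈ U) : ∀ᶠ x in 𝓝 q, (x ∈ M ↔ x ∈ realLocus Θ) := by
    filter_upwards [hU.mem_nhds hq] with x hx using hMmem hx
  have h0M : (0 : C4) ∈ M :=
    (hMmem h0U).2 (h.eventually_eq_zero_of_imDefect.self_of_nhds.2 hd0)
  refine ⟨U, hU, h0U, h0M, ?_, ?_, ?_, ?_⟩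
  · -- In the flattening coordinates `M` is the intersection of a ball with a linear subspace.
    have himg : M = φ.symm '' (Metric.ball 0 ε ∩ {y | imPi y.2 = 0}) := by
      ext x
      constructor
      · intro hx
        have hxU : x ∈ U := hx.1
        refine ⟨φ x, ⟨hxU.2, ?_⟩, φ.left_inv hxU.1⟩
        have h1 := (hUgood hxU).1.1.self_of_nhds.1 ((hMmem hxU).1 hx)
        change imPi (φ x).2 = 0
        rw [hφ, flatten, imPi_reAddIm, h1]
      · rintro ⟨y, ⟨hy1, hy2⟩, rfl⟩
        have hyt := (hball y hy1).1
        have hxU : φ.symm y ∈ U := ⟨φ.map_target hyt, by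
          rw [Set.mem_preimage, φ.right_inv hyt]; exact hy1⟩
        refine (hMmem hxU).2 ((hUgood hxU).1.1.self_of_nhds.2 ?_)
        have h1 : φ (φ.symm y) = y := φ.right_inv hyt
        rw [hφ, flatten] at h1
        have h2 : imPi y.2 = 0 := hy2
        rw [← h1, imPi_reAddIm] at h2
        exact h2
    change IsConnected M
    rw [himg]
    have hconv : Convex ℝ (Metric.ball (0 : C4) ε ∩ {y | imPi y.2 = 0}) := by
      refine (convex_ball _ _).inter ?_
      exact (LinearMap.ker ((imPi.comp (ContinuousLinearMap.snd ℝ ℂ (Fin 3 → ℂ)) :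
        C4 →L[ℝ] Fin 3 → ℝ) : C4 →ₗ[ℝ] Fin 3 → ℝ)).convex
    refine ⟨⟨_, ⟨0, ⟨Metric.mem_ball_self hε, ?_⟩, rfl⟩⟩, hconv.isPreconnected.image _ ?_⟩
    · exact map_zero imPi
    · exact φ.continuousOn_symm.mono fun y hy => (hball y hy.1).1
  · intro q hq
    refine ⟨imDefect Θ, (hUgood hq.1).1.2.2, (hUgood hq.1).1.2.1, ?_⟩
    filter_upwards [hMnhds hq.1, (hUgood hq.1).1.1] with x h1 h2 using h1.trans h2
  · intro q hq
    exact ((hUgood hq.1).2.1 M (hMnhds hq.1) hq).2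
  · intro q hq
    exact (hUgood hq.1).2.2 M (hMnhds hq.1) hq

/-! ### The complexified equation of a generic submanifold -/

/-- Linear coordinates in which the tangent space of a generic submanifold is `Im w = 0`. -/
theorem exists_linear_coordinates (L : C4 →L[ℝ] (Fin 3 → ℝ)) (hL : Function.Surjective L)
    (hgen : LinearMap.ker (L : C4 →ₗ[ℝ] Fin 3 → ℝ)
      ⊔ (LinearMap.ker (L : C4 →ₗ[ℝ] Fin 3 → ℝ)).map J = ⊤) :
    ∃ g : C4 ≃L[ℂ] C4, ∀ v j, ((g v).2 j).im = L v j := by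
  have hII (v : C4) : Complex.I • Complex.I • v = -v := by
    rw [smul_smul, Complex.I_mul_I, neg_one_smul]
  have hLc (c : ℂ) (v : C4) : L (c • v) = c.re • L v + c.im • L (Complex.I • v) := by
    rw [← map_smul, ← map_smul, ← map_add]
    congr 1
    nth_rewrite 1 [← Complex.re_add_im c]
    simp only [← Complex.coe_smul]
    module
  -- The complex linear map with imaginary part `L`; genericity makes it surjective.
  let W : C4 →ₗ[ℂ] (Fin 3 → ℂ) :=
    { toFun := fun v j => Complex.I * L v j + L (Complex.I • v) j
      map_add' := by
        intro v v'
        ext j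
        simp only [smul_add, map_add, Pi.add_apply]
        push_cast
        ring
      map_smul' := by
        intro c v
        ext j
        rw [smul_comm Complex.I c v, hLc c v, hLc c (Complex.I • v), hII]
        simp only [map_neg, Pi.add_apply, Pi.smul_apply, Pi.neg_apply, smul_eq_mul,
          RingHom.id_apply]
        push_cast
        linear_combination (-(c.im : ℂ) * L v j) * Complex.I_mul_I
          + (Complex.I * L v j + L (Complex.I • v) j) * Complex.re_add_im c }
  have hWim (v : C4) (j : Fin 3) : (W v j).im = L v j := by simp [W]
  have hu (t : Fin 3 → ℝ) : ∃ u, L u = t ∧ L (Complex.I • u) = 0 := by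
    obtain ⟨v, rfl⟩ := hL t
    obtain ⟨y, hy, z, hz, hyz⟩ := Submodule.mem_sup.1 (hgen ▸ Submodule.mem_top (x := v))
    obtain ⟨z', hz', rfl⟩ := hz
    have hy' : L y = 0 := hy
    have hz'' : L z' = 0 := hz'
    refine ⟨Complex.I • z', ?_, ?_⟩
    · rw [← hyz, map_add, hy', zero_add]; rfl
    · rw [hII, map_neg, hz'', neg_zero]
  have hWs : Function.Surjective W := by
    intro y
    obtain ⟨u, hu1, hu2⟩ := hu fun j => (y j).im
    obtain ⟨u', hu1', hu2'⟩ := hu fun j => (y j).re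
    refine ⟨u - Complex.I • u', funext fun j => ?_⟩
    have e1 : L (u - Complex.I • u') = fun j => (y j).im := by rw [map_sub, hu1, hu2', sub_zero]
    have e2 : L (Complex.I • (u - Complex.I • u')) = fun j => (y j).re := by
      rw [smul_sub, hII, sub_neg_eq_add, map_add, hu2, hu1', zero_add]
    change Complex.I * L (u - Complex.I • u') j + L (Complex.I • (u - Complex.I • u')) j = _
    rw [e1, e2, mul_comm, add_comm]
    exact Complex.re_add_im _
  have hker : Module.finrank ℂ (LinearMap.ker W) = Module.finrank ℂ ℂ := by
    have h1 := LinearMap.finrank_range_add_finrank_ker W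
    rw [LinearMap.range_eq_top.2 hWs, finrank_top, Module.finrank_prod,
      Module.finrank_fin_fun] at h1
    simp at h1 ⊢
    omega
  let e := LinearEquiv.ofFinrankEq _ _ hker
  obtain ⟨π, hπ⟩ := (LinearMap.ker W).subtype.exists_leftInverse_of_injective
    (LinearMap.ker_eq_bot.2 (Submodule.subtype_injective _))
  let f : C4 →ₗ[ℂ] C4 := (e.toLinearMap.comp π).prod W
  have hf : Function.Injective f := by
    rw [injective_iff_map_eq_zero]
    intro v hv
    have h1 : W v = 0 := congr_arg Prod.snd hv
    have h2 : e (π v) = 0 := congr_arg Prod.fst hv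
    have h3 : π v = ⟨v, h1⟩ := LinearMap.congr_fun hπ ⟨v, h1⟩
    rw [h3, LinearEquiv.map_eq_zero_iff] at h2
    exact congr_arg Subtype.val h2
  exact ⟨(LinearEquiv.ofInjectiveEndo f hf).toContinuousLinearEquiv, fun v j => hWim v j⟩

/-- The holomorphic inverse function theorem at the origin. -/
theorem exists_openPartialHomeomorph {E : Type*} [NormedAddCommGroup E] [NormedSpace ℂ E]
    [FiniteDimensional ℂ E] {f : E → E} (hf : AnalyticAt ℂ f 0)
    (hinj : Function.Injective (fderiv ℂ f 0)) :
    ∃ φ : OpenPartialHomeomorph E E, (0 : E) ∈ φ.source ∧ (∀ x, φ x = f x) ∧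
      AnalyticOnNhd ℂ φ φ.source ∧ AnalyticOnNhd ℂ φ.symm φ.target := by
  have : CompleteSpace E := FiniteDimensional.complete ℂ E
  let e : E ≃L[ℂ] E :=
    (LinearEquiv.ofInjectiveEndo (fderiv ℂ f 0 : E →ₗ[ℂ] E) hinj).toContinuousLinearEquiv
  have he : (e : E →L[ℂ] E) = fderiv ℂ f 0 := ContinuousLinearMap.ext fun _ => rfl
  have hst : HasStrictFDerivAt f (e : E →L[ℂ] E) 0 := by rw [he]; exact hf.hasStrictFDerivAt
  let φ := hst.toOpenPartialHomeomorph f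
  have hφ : (φ : E → E) = f := hst.toOpenPartialHomeomorph_coe
  have h0 : (0 : E) ∈ φ.source := hst.mem_toOpenPartialHomeomorph_source
  have hfφ : AnalyticAt ℂ φ 0 := by rw [hφ]; exact hf
  have hs : AnalyticAt ℂ φ.symm (φ 0) := φ.analyticAt_symm' h0 hfφ (by rw [hφ, he])
  have hω : (⊤ : WithTop ℕ∞) ≠ ((⊤ : ℕ∞) : WithTop ℕ∞) := by simp
  refine ⟨φ.restrContDiff ℂ ⊤ hω, ⟨h0, hfφ.contDiffAt, hs.contDiffAt⟩, fun x => congr_fun hφ x,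
    fun x hx => hx.2.1.analyticAt, fun x hx => hx.2.1.analyticAt⟩

/-- The real linear embedding `x ↦ (x, conj x)`. -/
def diagConj : C4 →L[ℝ] C4 × C4 :=
  (ContinuousLinearMap.id ℝ C4).prod ((starL' ℝ : C4 ≃L[ℝ] C4) : C4 →L[ℝ] C4)

/-- The complexification of a real valued function is symmetric under exchange and conjugation. -/
theorem complexification_symm {R : C4 × C4 → Fin 3 → ℂ} (hR : AnalyticAt ℂ R 0)
    (hreal : ∀ᶠ x in 𝓝 (0 : C4), star (R (x, star x)) = R (x, star x)) :
    ∀ᶠ v in 𝓝 (0 : C4 × C4), R (star v.2, star v.1) = star (R v) := by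
  let sw : C4 × C4 →L[ℂ] C4 × C4 :=
    (ContinuousLinearMap.snd ℂ C4 C4).prod (ContinuousLinearMap.fst ℂ C4 C4)
  have h1 : AnalyticAt ℂ (fun v => R (sw v)) 0 := by
    have : AnalyticAt ℂ R (sw 0) := by rwa [map_zero]
    exact this.comp (sw.analyticAt 0)
  have h2 : AnalyticAt ℂ (fun v => R v - star (R (sw (star v)))) 0 :=
    hR.sub (analyticAt_star_comp_star h1)
  have h3 := eventually_eq_zero_of_totallyReal h2 (by
    filter_upwards [hreal] with x hx
    have : sw (star ((x, star x) : C4 × C4)) = (x, star x) := by simp [sw]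
    rw [this, hx, sub_self])
  filter_upwards [h3] with v hv
  have e1 : star (R v) = star (star (R (sw (star v)))) := congr_arg star (sub_eq_zero.1 hv)
  rw [star_star] at e1
  exact e1.symm

/-- The derivatives at the origin of the complexification of a function with differential
`Im w`. -/
theorem fderiv_complexification {R : C4 × C4 → Fin 3 → ℂ} (hR : AnalyticAt ℂ R 0)
    {r : C4 → Fin 3 → ℝ} (hr : AnalyticAt ℝ r 0) (hdr : ∀ v j, fderiv ℝ r 0 v j = (v.2 j).im)
    (hRr : ∀ᶠ x in 𝓝 (0 : C4), R (x, star x) = fun j => (r x j : ℂ)) (x y : C4) :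
    fderiv ℂ R 0 (x, y) = (Complex.I / 2) • (y.2 - x.2) := by
  set D := fderiv ℂ R 0 with hD
  let o : (Fin 3 → ℝ) →L[ℝ] (Fin 3 → ℂ) :=
    ContinuousLinearMap.pi fun j => Complex.ofRealCLM.comp (ContinuousLinearMap.proj j)
  have h1 (v : C4) : D (v, star v) = fun j => ((v.2 j).im : ℂ) := by
    have e1 : HasFDerivAt R D (diagConj 0) := by
      rw [map_zero]; exact hR.differentiableAt.hasFDerivAt
    have e2 := (e1.restrictScalars ℝ).comp (0 : C4) diagConj.hasFDerivAt
    have e3 : HasFDerivAt (fun x => o (r x)) _ 0 :=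
      o.hasFDerivAt.comp (0 : C4) hr.differentiableAt.hasFDerivAt
    have e4 : R ∘ diagConj =ᶠ[𝓝 0] fun x => o (r x) := hRr
    have e5 := DFunLike.congr_fun (e2.unique (e3.congr_of_eventuallyEq e4)) v
    refine e5.trans (funext fun j => ?_)
    change ((fderiv ℝ r 0 v j : ℝ) : ℂ) = _
    rw [hdr]
  have h2 (v : C4) : D (v, star v) = D (v, 0) + D (0, star v) := by
    rw [← map_add]; simp
  have h3 (v : C4) : D (Complex.I • v, star (Complex.I • v))
      = Complex.I • (D (v, 0) - D (0, star v)) := by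
    rw [← map_sub, ← map_smul]; simp [star_smul]
  have h4 (v : C4) (j : Fin 3) : D (v, 0) j + D (0, star v) j = (v.2 j).im := by
    rw [← congr_fun (h1 v) j, h2]; rfl
  have h5 (v : C4) (j : Fin 3) : Complex.I * (D (v, 0) j - D (0, star v) j) = (v.2 j).re := by
    have := congr_fun (h1 (Complex.I • v)) j
    rw [h3] at this
    simpa using this
  have hx (v : C4) (j : Fin 3) : D (v, 0) j = -(Complex.I / 2) * v.2 j := by
    linear_combination h4 v j / 2 - Complex.I / 2 * h5 v j
      + (D (v, 0) j - D (0, star v) j) / 2 * Complex.I_mul_I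
      - Complex.I / 2 * Complex.re_add_im (v.2 j) + (v.2 j).im / 2 * Complex.I_mul_I
  have hy (v : C4) (j : Fin 3) : D (0, star v) j = (Complex.I / 2) * star (v.2 j) := by
    have h6 : star (v.2 j) = (v.2 j).re - (v.2 j).im * Complex.I := by
      apply Complex.ext <;> simp
    rw [h6]
    linear_combination h4 v j / 2 + Complex.I / 2 * h5 v j
      - (D (v, 0) j - D (0, star v) j) / 2 * Complex.I_mul_I
      + (v.2 j).im / 2 * Complex.I_mul_I
  have h7 : D (x, y) = D (x, 0) + D (0, star (star y)) := by
    rw [← map_add]; simp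
  ext j
  rw [h7, Pi.add_apply, hx, hy]
  simp
  ring

/-- A generic submanifold with tangent space `Im w = 0` at the origin has a complexified equation
`w = Θ (z, ζ, τ)`: complexify its real equations and solve them for `w`. The reality condition
expresses that the complexified equations are invariant under exchange and conjugation. -/
theorem exists_isRealDefining {r : C4 → Fin 3 → ℝ} (hr : AnalyticAt ℝ r 0) (hr0 : r 0 = 0)
    (hdr : ∀ v j, fderiv ℝ r 0 v j = (v.2 j).im) :
    ∃ Θ : C5 → Fin 3 → ℂ, IsRealDefining Θ ∧
      ∀ᶠ x in 𝓝 (0 : C4), (r x = 0 ↔ x ∈ realLocus Θ) := by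
  let o : (Fin 3 → ℝ) →L[ℝ] (Fin 3 → ℂ) :=
    ContinuousLinearMap.pi fun j => Complex.ofRealCLM.comp (ContinuousLinearMap.proj j)
  have ho (t : Fin 3 → ℝ) : o t = 0 ↔ t = 0 := by
    constructor
    · intro h
      ext j
      exact Complex.ofReal_eq_zero.1 (congr_fun h j)
    · rintro rfl; exact map_zero o
  obtain ⟨R, hR, hRr⟩ := exists_complexification ((o.analyticAt _).comp hr)
  have hRr' : ∀ᶠ x in 𝓝 (0 : C4), R (x, star x) = fun j => (r x j : ℂ) := hRr
  have hR0 : R 0 = 0 := by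
    have := hRr.self_of_nhds
    rw [star_zero, Prod.mk_zero_zero] at this
    rw [this, Function.comp_apply, hr0, map_zero]
  have hD := fderiv_complexification hR hr hdr hRr'
  have hsymm := complexification_symm hR (by
    filter_upwards [hRr'] with x hx
    rw [hx]
    ext j
    simp)
  -- The inverse function theorem is applied to `((z, ζ, τ), w) ↦ ((z, ζ, τ), R ((z, w), (ζ, τ)))`.
  let σ : C5 × (Fin 3 → ℂ) →L[ℂ] C4 × C4 :=
    ((zForm.comp (ContinuousLinearMap.fst ℂ C5 (Fin 3 → ℂ))).prod
      (ContinuousLinearMap.snd ℂ C5 (Fin 3 → ℂ))).prod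
    ((ContinuousLinearMap.snd ℂ ℂ C4).comp (ContinuousLinearMap.fst ℂ C5 (Fin 3 → ℂ)))
  let f : C5 × (Fin 3 → ℂ) → C5 × (Fin 3 → ℂ) := fun q => (q.1, R (σ q))
  have hRσ : AnalyticAt ℂ R (σ 0) := by rwa [map_zero]
  have hf : AnalyticAt ℂ f 0 := analyticAt_fst.prod (hRσ.comp (σ.analyticAt 0))
  have hfd : HasFDerivAt f _ 0 := (ContinuousLinearMap.fst ℂ C5 (Fin 3 → ℂ)).hasFDerivAt.prodMk
    (hRσ.differentiableAt.hasFDerivAt.comp (0 : C5 × (Fin 3 → ℂ)) σ.hasFDerivAt)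
  rw [map_zero] at hfd
  have hinj : Function.Injective (fderiv ℂ f 0) := by
    rw [injective_iff_map_eq_zero]
    intro q hq
    rw [hfd.fderiv] at hq
    have h1 : q.1 = 0 := congr_arg Prod.fst hq
    have h2 : fderiv ℂ R 0 ((q.1.1, q.2), q.1.2) = 0 := congr_arg Prod.snd hq
    rw [hD, h1] at h2
    refine Prod.ext h1 ?_
    have h3 : Complex.I / 2 ≠ 0 := by simp
    simpa using (smul_eq_zero.1 h2).resolve_left h3
  obtain ⟨φ, h0, hφ, hφa, hφs⟩ := exists_openPartialHomeomorph hf hinj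
  have hf0 : φ 0 = 0 := by
    rw [hφ]
    change ((0 : C5), R (σ 0)) = 0
    rw [map_zero, hR0]; rfl
  have h0t : (0 : C5 × (Fin 3 → ℂ)) ∈ φ.target := by rw [← hf0]; exact φ.map_source h0
  have hs0 : φ.symm 0 = 0 := by
    have := φ.left_inv h0
    rwa [hf0] at this
  let ι : C5 →L[ℂ] C5 × (Fin 3 → ℂ) := ContinuousLinearMap.inl ℂ C5 (Fin 3 → ℂ)
  let Θ : C5 → Fin 3 → ℂ := fun p => (φ.symm (ι p)).2
  have hΘa : AnalyticAt ℂ Θ 0 := by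
    have h1 : AnalyticAt ℂ φ.symm (ι 0) := by rw [map_zero]; exact hφs _ h0t
    exact analyticAt_snd.comp (h1.comp (ι.analyticAt 0))
  have hΘ0 : Θ 0 = 0 := by
    change (φ.symm (ι 0)).2 = 0
    rw [map_zero, hs0]; rfl
  have hι0 : Tendsto (fun q : C5 × (Fin 3 → ℂ) => ι q.1) (𝓝 0) (𝓝 0) := by
    have : Continuous fun q : C5 × (Fin 3 → ℂ) => ι q.1 := by fun_prop
    simpa using this.tendsto 0
  -- The solution set of `R = 0` is the graph of `Θ`.
  have key : ∀ᶠ q in 𝓝 (0 : C5 × (Fin 3 → ℂ)), (R ((q.1.1, q.2), q.1.2) = 0 ↔ q.2 = Θ q.1) := by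
    filter_upwards [φ.open_source.mem_nhds h0,
      hι0.eventually (φ.open_target.mem_nhds h0t)] with q h1 h2
    have h3 : φ (φ.symm (ι q.1)) = ι q.1 := φ.right_inv h2
    rw [hφ] at h3
    have h4 : (φ.symm (ι q.1)).1 = q.1 := by
      have := congr_arg Prod.fst h3
      exact this
    have h5 : R (σ (φ.symm (ι q.1))) = 0 := by
      have := congr_arg Prod.snd h3
      exact this
    constructor
    · intro h
      have h6 : φ q = ι q.1 := by
        rw [hφ]
        exact Prod.ext rfl h
      change q.2 = (φ.symm (ι q.1)).2
      rw [← h6, φ.left_inv h1]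
    · intro h
      have h6 : φ.symm (ι q.1) = q := Prod.ext h4 h.symm
      rw [h6] at h5
      exact h5
  have hgraph : Tendsto (fun p : C5 => (p, Θ p)) (𝓝 0) (𝓝 0) := by
    have := continuousAt_id.prodMk hΘa.continuousAt
    simpa [ContinuousAt, hΘ0, Prod.mk_zero_zero] using this
  have hzero : ∀ᶠ p in 𝓝 (0 : C5), R ((p.1, Θ p), p.2) = 0 := by
    filter_upwards [hgraph.eventually key] with p hp using hp.2 rfl
  refine ⟨Θ, ⟨hΘa, hΘ0, fun v => ?_, ?_⟩, ?_⟩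
  · have h1 : HasFDerivAt R (fderiv ℂ R 0) (σ ((0 : C5), Θ 0)) := by
      rw [hΘ0, Prod.mk_zero_zero, map_zero]; exact hR.differentiableAt.hasFDerivAt
    have h2 : HasFDerivAt (fun p => R (σ (p, Θ p))) _ (0 : C5) :=
      h1.comp (0 : C5) (σ.hasFDerivAt.comp (0 : C5)
        ((hasFDerivAt_id (0 : C5)).prodMk hΘa.differentiableAt.hasFDerivAt))
    have h3 : (fun p => R (σ (p, Θ p))) =ᶠ[𝓝 0] fun _ => 0 := hzero
    have h4 := DFunLike.congr_fun
      (h2.unique ((hasFDerivAt_const (0 : Fin 3 → ℂ) (0 : C5)).congr_of_eventuallyEq h3)) v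
    have h5 : fderiv ℂ R 0 ((v.1, fderiv ℂ Θ 0 v), v.2) = 0 := h4
    rw [hD] at h5
    have h6 : Complex.I / 2 ≠ 0 := by simp
    exact (sub_eq_zero.1 ((smul_eq_zero.1 h5).resolve_left h6)).symm
  · have hlim : Tendsto (fun p : C5 => (((star p.2.1, star p.1, star (Θ p)), star p.2.2) :
        C5 × (Fin 3 → ℂ))) (𝓝 0) (𝓝 0) := by
      have h1 : ContinuousAt (fun p : C5 => (((star p.2.1, star p.1, star (Θ p)), star p.2.2) :
        C5 × (Fin 3 → ℂ))) 0 := by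
        have h2 := hΘa.continuousAt.star
        have h3 : Continuous fun p : C5 => star p.2.1 := by fun_prop
        have h4 : Continuous fun p : C5 => star p.1 := by fun_prop
        have h5 : Continuous fun p : C5 => star p.2.2 := by fun_prop
        exact (h3.continuousAt.prodMk (h4.continuousAt.prodMk h2)).prodMk h5.continuousAt
      simpa [ContinuousAt, hΘ0, Prod.mk_zero_zero] using h1
    have hlim' : Tendsto (fun p : C5 => (((p.1, Θ p), p.2) : C4 × C4)) (𝓝 0) (𝓝 0) := by
      have h1 := (σ.continuous.tendsto 0).comp hgraph
      rw [map_zero] at h1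
      exact h1
    filter_upwards [hlim.eventually key, hlim'.eventually hsymm, hzero] with p h1 h2 h3
    rw [h3, star_zero] at h2
    have h4 := h1.1 h2
    rw [← h4, star_star]
  · have hlim : Tendsto (fun x : C4 => ((conjPt x, x.2) : C5 × (Fin 3 → ℂ))) (𝓝 0) (𝓝 0) := by
      have : Continuous fun x : C4 => ((conjPt x, x.2) : C5 × (Fin 3 → ℂ)) := by fun_prop
      simpa [Prod.mk_zero_zero] using this.tendsto 0
    filter_upwards [hlim.eventually key, hRr] with x h1 h2
    have h3 : R (x, star x) = 0 ↔ x.2 = Θ (conjPt x) := h1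
    rw [← ho, realLocus, Set.mem_ofPred_eq, ← h3, h2]
    rfl

/-! ### Normal coordinates -/

/-- The defining function with conjugated Taylor coefficients. -/
def conjFun (Θ : C5 → Fin 3 → ℂ) (p : C5) : Fin 3 → ℂ := star (Θ (star p))

theorem star_C5 (p : C5) : star p = (star p.1, star p.2.1, star p.2.2) := rfl

/-- The new transversal coordinate `(t + Θ (0, 0, t)) / 2`, where `t = Θ̄ (0, z, w)`. By the reality
condition, `t` is the parameter of the Segre variety `w = Θ (z, 0, t)` through `(z, w)`, so that the
coordinate is constant along these varieties. The averaging of `t` and `Θ (0, 0, t)` makes it real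
at the points of the real locus with `z = 0`. -/
def normalCoord (Θ : C5 → Fin 3 → ℂ) (x : C4) : Fin 3 → ℂ :=
  (2 : ℂ)⁻¹ • (conjFun Θ (0, x) + Θ (0, 0, conjFun Θ (0, x)))

namespace IsRealDefining

variable {Θ : C5 → Fin 3 → ℂ} (h : IsRealDefining Θ)
include h

theorem analyticAt_conjFun : AnalyticAt ℂ (conjFun Θ) 0 := analyticAt_star_comp_star h.analyticAt

theorem conjFun_zero : conjFun Θ 0 = 0 := by simp [conjFun, h.map_zero]

theorem fderiv_conjFun (v : C5) : fderiv ℂ (conjFun Θ) 0 v = v.2.2 := by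
  have h1 : HasFDerivAt Θ (fderiv ℂ Θ 0) (star (0 : C5)) := by
    rw [star_zero]; exact h.analyticAt.differentiableAt.hasFDerivAt
  have h2 := h1.star_star
  rw [star_star] at h2
  have h3 : HasFDerivAt (conjFun Θ) _ 0 := h2
  rw [h3.fderiv]
  simp [h.fderiv_apply]

theorem conjFun_theta : ∀ᶠ p in 𝓝 (0 : C5), conjFun Θ (p.2.1, p.1, Θ p) = p.2.2 := h.reality

theorem theta_conjFun : ∀ᶠ p in 𝓝 (0 : C5), Θ (p.2.1, p.1, conjFun Θ p) = p.2.2 := by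
  have h1 : Tendsto (star : C5 → C5) (𝓝 0) (𝓝 0) := by
    simpa using (continuous_star (R := C5)).tendsto 0
  filter_upwards [h1.eventually h.conjFun_theta] with p hp
  have h2 := congr_arg star hp
  simp only [conjFun, star_star, star_C5] at h2
  exact h2

theorem analyticAt_normalCoord : AnalyticAt ℂ (normalCoord Θ) 0 := by
  let ι : C4 →L[ℂ] C5 := ContinuousLinearMap.inr ℂ ℂ C4
  have h1 : AnalyticAt ℂ (fun x : C4 => conjFun Θ (0, x)) 0 := by
    have : AnalyticAt ℂ (conjFun Θ) (ι 0) := by rw [_root_.map_zero]; exact h.analyticAt_conjFun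
    exact this.comp (ι.analyticAt 0)
  have h2 : AnalyticAt ℂ (fun x : C4 => Θ (0, 0, conjFun Θ (0, x))) 0 := by
    have e1 : AnalyticAt ℂ Θ ((0, 0, conjFun Θ (0, (0 : C4))) : C5) := by
      rw [show ((0 : ℂ), (0 : C4)) = (0 : C5) from rfl, h.conjFun_zero]; exact h.analyticAt
    exact e1.comp (f := fun x : C4 => ((0, 0, conjFun Θ (0, x)) : C5))
      (analyticAt_const.prod (analyticAt_const.prod h1))
  exact AnalyticAt.fun_const_smul (c := (2 : ℂ)⁻¹) (h1.add h2)

theorem normalCoord_zero : normalCoord Θ 0 = 0 := by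
  rw [normalCoord, show ((0 : ℂ), (0 : C4)) = (0 : C5) from rfl, h.conjFun_zero,
    show ((0 : ℂ), (0 : ℂ), (0 : Fin 3 → ℂ)) = (0 : C5) from rfl, h.map_zero]
  simp

theorem fderiv_normalCoord (v : C4) : fderiv ℂ (normalCoord Θ) 0 v = v.2 := by
  let ι : C4 →L[ℂ] C5 := ContinuousLinearMap.inr ℂ ℂ C4
  let κ : (Fin 3 → ℂ) →L[ℂ] C5 :=
    (ContinuousLinearMap.inr ℂ ℂ C4).comp (ContinuousLinearMap.inr ℂ ℂ (Fin 3 → ℂ))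
  have e1 : HasFDerivAt (conjFun Θ) (fderiv ℂ (conjFun Θ) 0) (ι 0) := by
    rw [_root_.map_zero]; exact h.analyticAt_conjFun.differentiableAt.hasFDerivAt
  have h1 : HasFDerivAt (𝕜 := ℂ) (fun x : C4 => conjFun Θ (ι x)) _ 0 :=
    e1.comp (0 : C4) ι.hasFDerivAt
  have e2 : HasFDerivAt Θ (fderiv ℂ Θ 0) (κ (conjFun Θ (ι 0))) := by
    rw [_root_.map_zero, h.conjFun_zero, _root_.map_zero]
    exact h.analyticAt.differentiableAt.hasFDerivAt
  have h2 : HasFDerivAt (𝕜 := ℂ) (fun x : C4 => Θ (κ (conjFun Θ (ι x)))) _ 0 :=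
    e2.comp (0 : C4) (κ.hasFDerivAt.comp (0 : C4) h1)
  have h3 : HasFDerivAt (𝕜 := ℂ) (normalCoord Θ) _ 0 := (h1.add h2).const_smul (2 : ℂ)⁻¹
  have h4 := DFunLike.congr_fun h3.fderiv v
  rw [h4]
  change (2 : ℂ)⁻¹ • (fderiv ℂ (conjFun Θ) 0 (ι v)
    + fderiv ℂ Θ 0 (κ (fderiv ℂ (conjFun Θ) 0 (ι v)))) = v.2
  rw [h.fderiv_apply, h.fderiv_conjFun]
  change (2 : ℂ)⁻¹ • (v.2 + v.2) = v.2
  module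

/-- On `z = 0` the new coordinate is the average of `w` and its reflection. -/
theorem normalCoord_fiber : ∀ᶠ w in 𝓝 (0 : Fin 3 → ℂ),
    normalCoord Θ (0, w) = (2 : ℂ)⁻¹ • (conjFun Θ (0, 0, w) + w) := by
  have h1 : Tendsto (fun w : Fin 3 → ℂ => ((0, 0, w) : C5)) (𝓝 0) (𝓝 0) := by
    have : Continuous fun w : Fin 3 → ℂ => ((0, 0, w) : C5) := by fun_prop
    simpa [Prod.mk_zero_zero] using this.tendsto 0
  filter_upwards [h1.eventually h.theta_conjFun] with w hw
  have hw' : Θ (0, 0, conjFun Θ (0, 0, w)) = w := hw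
  rw [normalCoord, hw']

/-- The new coordinate is constant along the Segre variety of `(0, τ)`. -/
theorem normalCoord_segre : ∀ᶠ p in 𝓝 (0 : C5),
    normalCoord Θ (p.1, Θ (p.1, 0, p.2.2)) = (2 : ℂ)⁻¹ • (p.2.2 + Θ (0, 0, p.2.2)) := by
  have h1 : Tendsto (fun p : C5 => ((p.1, 0, p.2.2) : C5)) (𝓝 0) (𝓝 0) := by
    have : Continuous fun p : C5 => ((p.1, 0, p.2.2) : C5) := by fun_prop
    simpa [Prod.mk_zero_zero] using this.tendsto 0
  filter_upwards [h1.eventually h.conjFun_theta] with p hp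
  have hp' : conjFun Θ (0, p.1, Θ (p.1, 0, p.2.2)) = p.2.2 := hp
  rw [normalCoord, hp']

/-- Existence of normal coordinates: the defining function can be brought by a local
biholomorphism into a form where `Θ (0, ζ, τ) = τ = Θ (z, 0, τ)`. -/
theorem exists_normal : ∃ (φ : OpenPartialHomeomorph C4 C4) (Θ' : C5 → Fin 3 → ℂ),
    (0 : C4) ∈ φ.source ∧ φ 0 = 0 ∧ AnalyticOnNhd ℂ φ φ.source ∧
    AnalyticOnNhd ℂ φ.symm φ.target ∧ AnalyticAt ℂ Θ' 0 ∧
    (∀ᶠ p in 𝓝 (0 : C5), star (Θ' (star p.2.1, star p.1, star (Θ' p))) = p.2.2) ∧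
    (∀ᶠ p in 𝓝 (0 : C5), Θ' (0, p.2.1, p.2.2) = p.2.2 ∧ Θ' (p.1, 0, p.2.2) = p.2.2) ∧
    ∀ᶠ x in 𝓝 (0 : C4), (x ∈ realLocus Θ ↔ φ x ∈ realLocus Θ') := by
  let H := normalCoord Θ
  have hHa : AnalyticAt ℂ H 0 := h.analyticAt_normalCoord
  have hf : AnalyticAt ℂ (fun x : C4 => (x.1, H x)) 0 := analyticAt_fst.prod hHa
  have hfd : HasFDerivAt (fun x : C4 => (x.1, H x)) _ 0 :=
    (ContinuousLinearMap.fst ℂ ℂ (Fin 3 → ℂ)).hasFDerivAt.prodMk hHa.differentiableAt.hasFDerivAt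
  have hinj : Function.Injective (fderiv ℂ (fun x : C4 => (x.1, H x)) 0) := by
    have : ∀ v, fderiv ℂ (fun x : C4 => (x.1, H x)) 0 v = v := by
      intro v
      rw [hfd.fderiv]
      exact Prod.ext rfl (h.fderiv_normalCoord v)
    intro v v' hv
    rwa [this, this] at hv
  obtain ⟨φ, h0, hφ, hφa, hφs⟩ := exists_openPartialHomeomorph hf hinj
  have hφ0 : φ 0 = 0 := by
    rw [hφ]; exact Prod.ext rfl h.normalCoord_zero
  have h0t : (0 : C4) ∈ φ.target := by rw [← hφ0]; exact φ.map_source h0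
  have hs0 : φ.symm 0 = 0 := by
    have := φ.left_inv h0
    rwa [hφ0] at this
  -- `T (ζ, ·)` inverts the conjugate of the coordinate change.
  let T : C4 → Fin 3 → ℂ := fun y => (star (φ.symm (star y))).2
  have hTa : AnalyticAt ℂ T 0 := analyticAt_snd.comp (analyticAt_star_comp_star (hφs 0 h0t))
  have hT0 : T 0 = 0 := by simp [T, hs0]
  have hstar : Tendsto (star : C4 → C4) (𝓝 0) (𝓝 0) := by
    simpa using (continuous_star (R := C4)).tendsto 0
  have hT1 : ∀ᶠ y in 𝓝 (0 : C4), T (y.1, star (H (star y))) = y.2 := by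
    filter_upwards [hstar.eventually (φ.open_source.mem_nhds h0)] with y hy
    have h1 : star ((y.1, star (H (star y))) : C4) = φ (star y) := by
      rw [hφ]; exact Prod.ext rfl (star_star _)
    change (star (φ.symm (star ((y.1, star (H (star y))) : C4)))).2 = y.2
    rw [h1, φ.left_inv hy, star_star]
  have hT2 : ∀ᶠ y in 𝓝 (0 : C4), star (H (star y.1, star (T y))) = y.2 := by
    filter_upwards [hstar.eventually (φ.open_target.mem_nhds h0t)] with y hy
    have h1 : φ (φ.symm (star y)) = star y := φ.right_inv hy
    rw [hφ] at h1
    have h2 : (φ.symm (star y)).1 = star y.1 := congr_arg Prod.fst h1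
    have h3 : H (φ.symm (star y)) = star y.2 := congr_arg Prod.snd h1
    have h4 : ((star y.1, star (T y)) : C4) = φ.symm (star y) := by
      refine Prod.ext h2.symm ?_
      simp [T]
    rw [h4, h3, star_star]
  let S : C5 → C5 := fun p => (p.1, p.2.1, T p.2)
  have hTp : AnalyticAt ℂ (fun p : C5 => T p.2) 0 := by
    have : AnalyticAt ℂ T ((ContinuousLinearMap.snd ℂ ℂ C4) 0) := by rwa [_root_.map_zero]
    exact this.comp ((ContinuousLinearMap.snd ℂ ℂ C4).analyticAt 0)
  have hSa : AnalyticAt ℂ S 0 :=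
    (zForm.analyticAt 0).prod ((zetaForm.analyticAt 0).prod hTp)
  have hS0 : S 0 = 0 := Prod.ext rfl (Prod.ext rfl hT0)
  have hSt : Tendsto S (𝓝 0) (𝓝 0) := by
    have := hSa.continuousAt.tendsto
    rwa [hS0] at this
  have hΘS : AnalyticAt ℂ (fun p => Θ (S p)) 0 := by
    have : AnalyticAt ℂ Θ (S 0) := by rw [hS0]; exact h.analyticAt
    exact this.comp hSa
  have hΘS0 : Θ (S 0) = 0 := by rw [hS0, h.map_zero]
  let Θ' : C5 → Fin 3 → ℂ := fun p => H (p.1, Θ (S p))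
  have hΘ'a : AnalyticAt ℂ Θ' 0 := by
    have : AnalyticAt ℂ H ((0 : C5).1, Θ (S 0)) := by
      rw [hΘS0]; exact hHa
    exact this.comp (f := fun p : C5 => ((p.1, Θ (S p)) : C4)) ((zForm.analyticAt 0).prod hΘS)
  have hzw : Tendsto (fun p : C5 => ((p.1, Θ (S p)) : C4)) (𝓝 0) (𝓝 0) := by
    have := (zForm.analyticAt 0).continuousAt.prodMk hΘS.continuousAt
    simpa [ContinuousAt, hΘS0, Prod.mk_zero_zero] using this
  have hsnd : Tendsto (fun p : C5 => p.2) (𝓝 0) (𝓝 0) := continuous_snd.tendsto 0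
  refine ⟨φ, Θ', h0, hφ0, hφa, hφs, hΘ'a, ?_, ?_, ?_⟩
  · filter_upwards [(hstar.comp hzw).eventually hT1, hSt.eventually h.reality,
      hsnd.eventually hT2] with p h1 h2 h3
    have e1 : T (star p.1, star (Θ' p)) = star (Θ (S p)) := by
      have : ((p.1, Θ (S p)) : C4) = star (star (p.1, Θ (S p))) := (star_star _).symm
      change T (star p.1, star (H (p.1, Θ (S p)))) = _
      rw [this]
      exact h1
    have e2 : S (star p.2.1, star p.1, star (Θ' p)) = (star p.2.1, star p.1, star (Θ (S p))) :=
      Prod.ext rfl (Prod.ext rfl e1)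
    have e3 : Θ (star p.2.1, star p.1, star (Θ (S p))) = star (T p.2) := by
      have := congr_arg star h2
      rwa [star_star] at this
    change star (H (star p.2.1, Θ (S (star p.2.1, star p.1, star (Θ' p))))) = _
    rw [e2, e3]
    exact h3
  · have hz0 : Tendsto (fun p : C5 => ((0, p.2) : C5)) (𝓝 0) (𝓝 0) := by
      have : Continuous fun p : C5 => ((0, p.2) : C5) := by fun_prop
      simpa [Prod.mk_zero_zero] using this.tendsto 0
    have hζ0 : Tendsto (fun p : C5 => ((p.1, 0, p.2.2) : C5)) (𝓝 0) (𝓝 0) := by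
      have : Continuous fun p : C5 => ((p.1, 0, p.2.2) : C5) := by fun_prop
      simpa [Prod.mk_zero_zero] using this.tendsto 0
    have hw0 : Tendsto (fun p : C5 => Θ (S (0, p.2))) (𝓝 0) (𝓝 0) := by
      have := hΘS.continuousAt.tendsto
      rw [hΘS0] at this
      exact this.comp hz0
    have hTs : Tendsto (fun p : C5 => star (T (0, p.2.2))) (𝓝 0) (𝓝 0) := by
      have e1 : Tendsto (fun p : C5 => ((0, p.2.2) : C4)) (𝓝 0) (𝓝 0) := by
        have : Continuous fun p : C5 => ((0, p.2.2) : C4) := by fun_prop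
        simpa [Prod.mk_zero_zero] using this.tendsto 0
      have e2 := hTa.continuousAt.tendsto
      rw [hT0] at e2
      have e3 : Tendsto (star : (Fin 3 → ℂ) → (Fin 3 → ℂ)) (𝓝 0) (𝓝 0) := by
        simpa using (continuous_star (R := Fin 3 → ℂ)).tendsto 0
      exact e3.comp (e2.comp e1)
    filter_upwards [hw0.eventually h.normalCoord_fiber, hsnd.eventually hT2,
      (hsnd.comp hζ0).eventually hT2, (hSt.comp hζ0).eventually h.normalCoord_segre,
      hTs.eventually h.normalCoord_fiber] with p h1 h2 h3 h4 h5
    constructor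
    · change H (0, Θ (S (0, p.2))) = p.2.2
      have e1 : normalCoord Θ (star p.2.1, star (T p.2))
          = (2 : ℂ)⁻¹ • (star (Θ (0, p.2.1, T p.2)) + Θ (0, 0, star (Θ (0, p.2.1, T p.2)))) := by
        simp [normalCoord, conjFun, star_C5]
      have e2 : star (normalCoord Θ (star p.2.1, star (T p.2))) = p.2.2 := h2
      rw [e1] at e2
      refine Eq.trans ?_ e2
      refine h1.trans ?_
      rw [star_smul, star_add, star_star, add_comm]
      simp [conjFun, star_C5, S]
    · change H (p.1, Θ (p.1, 0, T (0, p.2.2))) = p.2.2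
      have e1 : normalCoord Θ (0, star (T (0, p.2.2)))
          = (2 : ℂ)⁻¹ • (star (Θ (0, 0, T (0, p.2.2))) + star (T (0, p.2.2))) := by
        rw [h5]
        simp [conjFun, star_C5]
      have e2 : star (normalCoord Θ (star 0, star (T (0, p.2.2)))) = p.2.2 := h3
      rw [star_zero, e1] at e2
      refine Eq.trans ?_ e2
      refine h4.trans ?_
      rw [star_smul, star_add, star_star, star_star, add_comm]
      simp [S]
  · have hx' : Tendsto (fun x : C4 => ((x.1, Θ (conjPt x)) : C4)) (𝓝 0) (𝓝 0) := by
      have e1 := h.analyticAt_comp_conjPt.continuousAt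
      have e2 := (continuousAt_fst (p := (0 : C4))).prodMk e1
      have e3 : Θ (conjPt 0) = 0 := by rw [_root_.map_zero, h.map_zero]
      have e4 : (((0 : C4).1, Θ (conjPt 0)) : C4) = 0 := Prod.ext rfl e3
      have e5 : Tendsto (fun x : C4 => ((x.1, Θ (conjPt x)) : C4)) (𝓝 0)
        (𝓝 ((0 : C4).1, Θ (conjPt 0))) := e2
      rwa [e4] at e5
    filter_upwards [φ.open_source.mem_nhds h0, hx'.eventually (φ.open_source.mem_nhds h0),
      hstar.eventually hT1] with x h1 h2 h3
    have e1 : T (star x.1, star (H x)) = star x.2 := by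
      rw [star_star] at h3; exact h3
    have e2 : Θ' (conjPt (φ x)) = H (x.1, Θ (conjPt x)) := by
      rw [hφ]
      change H (x.1, Θ (x.1, star x.1, T (star x.1, star (H x)))) = _
      rw [e1]; rfl
    change x.2 = Θ (conjPt x) ↔ (φ x).2 = Θ' (conjPt (φ x))
    rw [e2]
    constructor
    · intro hx
      rw [← hx, hφ]
    · intro hx
      have e3 : φ x = φ (x.1, Θ (conjPt x)) := by
        have h6 := hφ (x.1, Θ (conjPt x))
        exact Prod.ext (by rw [hφ x, h6]) (by rw [h6]; exact hx)
      exact congr_arg Prod.snd (φ.injOn h1 h2 e3)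

end IsRealDefining

/-! ### Normalization of the third-order terms -/

/-- The reality condition makes `G 0` imaginary and relates the two first derivatives of `G`. -/
theorem reality_of_normal {Θ G : C5 → Fin 3 → ℂ} (hG : AnalyticAt ℂ G 0)
    (hΘ : ∀ᶠ p in 𝓝 (0 : C5), Θ p = p.2.2 + (p.1 * p.2.1) • G p) (h : IsRealDefining Θ) :
    star (G 0) = -G 0 ∧ fderiv ℂ G 0 (0, 1, 0) = -star (fderiv ℂ G 0 (1, 0, 0)) := by
  let m : C5 → C5 := fun p => (p.2.1, p.1, Θ p)
  have hma : AnalyticAt ℂ m 0 :=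
    (zetaForm.analyticAt 0).prod ((zForm.analyticAt 0).prod h.analyticAt)
  have hm0 : m 0 = 0 := Prod.ext rfl (Prod.ext rfl h.map_zero)
  have hGb : AnalyticAt ℂ (fun p => star (G (star p))) (m 0) := by
    rw [hm0]; exact analyticAt_star_comp_star hG
  let K : C5 → Fin 3 → ℂ := fun p => G p + star (G (star (m p)))
  have hK : AnalyticAt ℂ K 0 := hG.add (hGb.comp hma)
  have hmt : Tendsto (fun p => star (m p)) (𝓝 0) (𝓝 0) := by
    have h1 : Tendsto (fun p => star (m p)) (𝓝 0) (𝓝 (star (m 0))) := hma.continuousAt.star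
    rwa [hm0, star_zero] at h1
  have h1 : ∀ᶠ p in 𝓝 (0 : C5), zForm p • (zetaForm p • K p) = 0 := by
    filter_upwards [h.reality, hΘ, hmt.eventually hΘ] with p e1 e2 e3
    have e4 : Θ (star (m p)) = star p.2.2 := by
      have := congr_arg star e1
      rwa [star_star] at this
    rw [e4] at e3
    have e5 := congr_arg star e3
    rw [star_star, star_add, star_smul] at e5
    have e6 : p.2.2 = Θ p + (p.1 * p.2.1) • star (G (star (m p))) := by
      have e7 : star ((star (m p)).1 * (star (m p)).2.1) = p.1 * p.2.1 := by
        simp [m, star_C5, mul_comm]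
      rw [e7] at e5
      simpa [m, star_C5] using e5
    rw [e2, add_assoc] at e6
    have e8 := left_eq_add.1 e6
    rw [smul_smul]
    change (p.1 * p.2.1) • (G p + star (G (star (m p)))) = 0
    rw [smul_add, e8]
  have h2 : ∀ᶠ p in 𝓝 (0 : C5), K p = 0 := by
    refine eventually_eq_zero_of_smul (ℓ := zetaForm) (e := (0, 1, 0)) rfl
      hK.eventually_continuousAt ?_
    refine eventually_eq_zero_of_smul (ℓ := zForm) (e := (1, 0, 0)) rfl ?_ h1
    filter_upwards [hK.eventually_continuousAt] with p hp
    exact zetaForm.continuous.continuousAt.smul hp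
  constructor
  · have h3 : G 0 + star (G (star (m 0))) = 0 := h2.self_of_nhds
    rw [hm0, star_zero] at h3
    exact eq_neg_of_add_eq_zero_right h3
  · have e1 : HasFDerivAt G (fderiv ℂ G 0) (star (m 0)) := by
      rw [hm0, star_zero]; exact hG.differentiableAt.hasFDerivAt
    have e2 := e1.star_star
    rw [star_star] at e2
    have e3 : HasFDerivAt m _ 0 := zetaForm.hasFDerivAt.prodMk
      (zForm.hasFDerivAt.prodMk h.analyticAt.differentiableAt.hasFDerivAt)
    have e4 : HasFDerivAt (𝕜 := ℂ) K _ 0 :=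
      hG.differentiableAt.hasFDerivAt.add (e2.comp (0 : C5) e3)
    have e5 : K =ᶠ[𝓝 0] fun _ => 0 := h2
    have e6 := DFunLike.congr_fun
      (e4.unique ((hasFDerivAt_const (0 : Fin 3 → ℂ) (0 : C5)).congr_of_eventuallyEq e5)) (0, 1, 0)
    have e7 : fderiv ℂ G 0 (0, 1, 0)
        + star (fderiv ℂ G 0 (star ((1, 0, fderiv ℂ Θ 0 (0, 1, 0)) : C5))) = 0 := e6
    rw [h.fderiv_apply] at e7
    have e8 : star ((1, 0, (((0, 1, 0) : C5)).2.2) : C5) = (1, 0, 0) := by simp [star_C5]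
    rw [e8] at e7
    exact eq_neg_of_add_eq_zero_left e7

/-- Real vectors that are independent over `ℝ` are independent over `ℂ`. -/
theorem linearIndependent_complex_of_real {x : Fin 3 → Fin 3 → ℂ} (hx : ∀ i, star (x i) = x i)
    (hxi : LinearIndependent ℝ x) : LinearIndependent ℂ x := by
  rw [Fintype.linearIndependent_iff] at hxi ⊢
  intro c hc
  have h1 : ∑ i, star (c i) • x i = 0 := by
    have := congr_arg star hc
    simpa [star_sum, star_smul, hx] using this
  have hre : ∑ i, (c i).re • x i = 0 := by
    have h2 : (2 : ℂ) • ∑ i, (c i).re • x i = ∑ i, c i • x i + ∑ i, star (c i) • x i := by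
      rw [← Finset.sum_add_distrib, Finset.smul_sum]
      refine Finset.sum_congr rfl fun i _ => ?_
      rw [← add_smul, ← Complex.coe_smul, smul_smul]
      congr 1
      apply Complex.ext <;> simp
      ring
    rw [hc, h1, add_zero] at h2
    exact (smul_eq_zero.1 h2).resolve_left two_ne_zero
  have him : ∑ i, (c i).im • x i = 0 := by
    have h2 : (2 * Complex.I) • ∑ i, (c i).im • x i = ∑ i, c i • x i - ∑ i, star (c i) • x i := by
      rw [← Finset.sum_sub_distrib, Finset.smul_sum]
      refine Finset.sum_congr rfl fun i _ => ?_
      rw [← sub_smul, ← Complex.coe_smul, smul_smul]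
      congr 1
      apply Complex.ext <;> simp
      ring
    rw [hc, h1, sub_zero] at h2
    exact (smul_eq_zero.1 h2).resolve_left (by simp)
  exact fun i => Complex.ext (hxi _ hre i) (hxi _ him i)

/-- Two real bases of `ℂ³` are exchanged by a complex linear map which commutes with
conjugation. -/
theorem exists_equiv_of_real {x t : Fin 3 → Fin 3 → ℂ} (hx : ∀ i, star (x i) = x i)
    (ht : ∀ i, star (t i) = t i) (hxi : LinearIndependent ℝ x) (hti : LinearIndependent ℝ t) :
    ∃ L : (Fin 3 → ℂ) ≃L[ℂ] (Fin 3 → ℂ), (∀ v, L (star v) = star (L v)) ∧ ∀ i, L (x i) = t i := by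
  have hcard : Fintype.card (Fin 3) = Module.finrank ℂ (Fin 3 → ℂ) := by simp
  let bx := basisOfLinearIndependentOfCardEqFinrank (linearIndependent_complex_of_real hx hxi) hcard
  let bt := basisOfLinearIndependentOfCardEqFinrank (linearIndependent_complex_of_real ht hti) hcard
  have hbx (i : Fin 3) : bx i = x i := by simp [bx]
  have hbt (i : Fin 3) : bt i = t i := by simp [bt]
  let L := bx.equiv bt (Equiv.refl _)
  have hL (i : Fin 3) : L (x i) = t i := by
    rw [← hbx, ← hbt]; simp [L]
  refine ⟨L.toContinuousLinearEquiv, fun v => ?_, hL⟩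
  change L (star v) = star (L v)
  have hv : v = ∑ i, bx.repr v i • x i := by
    conv_lhs => rw [← bx.sum_repr v]
    simp [hbx]
  rw [hv]
  simp only [star_sum, star_smul, map_sum, map_smul, hx, hL, ht]

/-- The order condition holds for `z ζ g` if `g` vanishes at the origin with its derivatives in `z`
and `ζ`: the restriction of `g` to `τ = 0` contributes to the first term, the difference of `g` and
this restriction to the second. -/
theorem hasRemainderOrder_of_factor {f g : C5 → ℂ} (hg : AnalyticAt ℂ g 0) (h0 : g 0 = 0)
    (hz : fderiv ℂ g 0 (1, 0, 0) = 0) (hζ : fderiv ℂ g 0 (0, 1, 0) = 0)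
    (hfg : ∀ᶠ p in 𝓝 (0 : C5), f p = p.1 * p.2.1 * g p) : HasRemainderOrder f := by
  let π : C5 →L[ℂ] C5 := zForm.prod (zetaForm.prod 0)
  have hπ (p : C5) : π p = (p.1, p.2.1, 0) := rfl
  have hπ0 : Tendsto π (𝓝 0) (𝓝 0) := by simpa only [map_zero] using π.continuous.tendsto 0
  have hgπ : AnalyticAt ℂ (fun p => g (π p)) 0 := by
    have : AnalyticAt ℂ g (π 0) := by rwa [map_zero]
    exact this.comp (π.analyticAt 0)
  have hnorm (p : C5) : ‖π p‖ = ‖(p.1, p.2.1)‖ := by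
    simp [hπ, Prod.norm_mk]
  refine ⟨fun p => p.1 * p.2.1 * g (π p), fun p => g p - g (π p),
    ((zForm.analyticAt 0).mul (zetaForm.analyticAt 0)).mul hgπ, hg.sub hgπ, ?_, ?_, ?_⟩
  · obtain ⟨q, hq⟩ := hg
    have h1 := (hq.isBigO_sub_partialSum_pow 2).comp_tendsto hπ0
    obtain ⟨c, hc⟩ := h1.bound
    refine Asymptotics.IsBigO.of_bound c ?_
    filter_upwards [hc] with p hp
    have h2 : q.partialSum 2 (π p) = 0 := by
      have e1 : q 1 (fun _ => π p) = fderiv ℂ g 0 (π p) := by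
        rw [hq.fderiv_eq]; simp
        congr 1
        ext1 i
        fin_cases i
        rfl
      have e2 : π p = p.1 • ((1, 0, 0) : C5) + p.2.1 • ((0, 1, 0) : C5) := by
        rw [hπ]; simp
      have e3 : q 0 (fun _ => π p) = 0 := by
        rw [← h0]; exact hq.coeff_zero _
      rw [FormalMultilinearSeries.partialSum, Finset.sum_range_succ, Finset.sum_range_one, e3, e1,
        e2, map_add, map_smul, map_smul, hz, hζ]
      simp
    simp only [Function.comp_apply, zero_add, h2, sub_zero, hnorm] at hp
    simp only [norm_mul, norm_pow, norm_norm] at hp ⊢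
    have h3 : ‖p.1‖ ≤ ‖(p.1, p.2.1)‖ := norm_fst_le (p.1, p.2.1)
    have h4 : ‖p.2.1‖ ≤ ‖(p.1, p.2.1)‖ := norm_snd_le (p.1, p.2.1)
    calc ‖p.1‖ * ‖p.2.1‖ * ‖g (π p)‖
        ≤ ‖(p.1, p.2.1)‖ * ‖(p.1, p.2.1)‖ * (c * ‖(p.1, p.2.1)‖ ^ 2) := by gcongr
      _ = _ := by ring
  · obtain ⟨C, s, hs, hC⟩ := (hg.contDiffAt (n := 1)).exists_lipschitzOnWith
    refine Asymptotics.IsBigO.of_bound C ?_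
    filter_upwards [hs, hπ0 hs] with p h1 h2
    have h3 := hC.norm_sub_le h1 h2
    have h4 : p - π p = (0, 0, p.2.2) :=
      Prod.ext (sub_self _) (Prod.ext (sub_self _) (sub_zero _))
    have h5 : ‖((0, 0, p.2.2) : C5)‖ = ‖p.2.2‖ := by simp [Prod.norm_mk]
    rw [h4, h5] at h3
    simpa using h3
  · filter_upwards [hfg] with p hp
    rw [hp]; ring

/-- A real linear change of the coordinates `w` turns a defining function in normal form, whose
third-order vectors are independent, into one given by an admissible triple. -/
theorem exists_admissible {Θ G : C5 → Fin 3 → ℂ} (hG : AnalyticAt ℂ G 0)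
    (hΘ : ∀ᶠ p in 𝓝 (0 : C5), Θ p = p.2.2 + (p.1 * p.2.1) • G p) (h : IsRealDefining Θ)
    (hind : LinearIndependent ℝ ![Complex.I • leviVector (slope Θ) 0, thirdVector (slope Θ) 0 1,
      thirdVector (slope Θ) 0 Complex.I]) :
    ∃ (L : (Fin 3 → ℂ) ≃L[ℂ] (Fin 3 → ℂ)) (P : Fin 3 → C5 → ℂ), AdmissibleRemainders P ∧
      ∀ x : C4, x ∈ realLocus Θ ↔ (x.1, L x.2) ∈ realLocus (thetaVec P) := by
  obtain ⟨hr0, hr1⟩ := reality_of_normal hG hΘ h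
  rw [leviVector_slope_zero hG hΘ, thirdVector_slope_zero hG h.analyticAt hΘ,
    thirdVector_slope_zero hG h.analyticAt hΘ] at hind
  have hII := Complex.I_mul_I
  set A := fderiv ℂ G 0 (1, 0, 0) with hA
  set B := fderiv ℂ G 0 (0, 1, 0) with hB
  have hstarA : star A = -B := by rw [hr1, neg_neg]
  have hstarB : star B = -A := by rw [hr1, star_neg, star_star]
  -- The targets are the values of the three vectors for the model with factor `leadingFactor`.
  obtain ⟨L, hLs, hL⟩ := exists_equiv_of_real (t := ![![-2, 0, 0], ![0, -8, 0], ![0, 0, -8]])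
    (by
      intro i
      fin_cases i
      · simp [star_smul, hr0]
      · simp [star_smul, hstarA, hstarB]
        module
      · simp [star_smul, hstarA, hstarB]
        module)
    (by
      intro i
      ext j
      fin_cases i <;> fin_cases j <;> simp)
    hind
    (by
      rw [Fintype.linearIndependent_iff]
      intro c hc
      rw [Fin.sum_univ_three] at hc
      have e0 := congr_arg Complex.re (congr_fun hc 0)
      have e1 := congr_arg Complex.re (congr_fun hc 1)
      have e2 := congr_arg Complex.re (congr_fun hc 2)
      simp at e0 e1 e2
      intro j
      fin_cases j <;> simpa)
  have hL0 := hL 0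
  have hL1 := hL 1
  have hL2 := hL 2
  simp only [Matrix.cons_val_zero, Matrix.cons_val_one, Matrix.cons_val, star_one, map_smul,
    map_add, Complex.star_def, Complex.conj_I] at hL0 hL1 hL2
  have hLG : L (G 0) = ![2 * Complex.I, 0, 0] := by
    ext j
    have := congr_fun hL0 j
    fin_cases j <;> simp at this ⊢
    · linear_combination -Complex.I * this + (L (G 0) 0) * hII
    · exact this
    · exact this
  let t₁ : Fin 3 → ℂ := ![0, -8, 0]
  let t₂ : Fin 3 → ℂ := ![0, 0, -8]
  have hL1' (j : Fin 3) : Complex.I * (2 * 1 * L A j + 2 * 1 * L B j) = t₁ j := congr_fun hL1 j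
  have hL2' (j : Fin 3) : Complex.I * (2 * Complex.I * L A j + 2 * -Complex.I * L B j) = t₂ j :=
    congr_fun hL2 j
  have hLA : L A = ![0, 2 * Complex.I, 2] := by
    ext j
    have e : L A j = -Complex.I / 4 * t₁ j - t₂ j / 4 := by
      linear_combination -Complex.I / 4 * hL1' j - hL2' j / 4 + (L A j) * hII
    rw [e]
    fin_cases j <;> simp [t₁, t₂] <;> ring
  have hLB : L B = ![0, 2 * Complex.I, -2] := by
    ext j
    have e : L B j = -Complex.I / 4 * t₁ j + t₂ j / 4 := by
      linear_combination -Complex.I / 4 * hL1' j + hL2' j / 4 + (L B j) * hII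
    rw [e]
    fin_cases j <;> simp [t₁, t₂] <;> ring
  have hLs' (v : Fin 3 → ℂ) : L.symm (star v) = star (L.symm v) := by
    rw [L.symm_apply_eq, hLs, L.apply_symm_apply]
  let μ : C5 →L[ℂ] C5 :=
    zForm.prod (zetaForm.prod ((L.symm : (Fin 3 → ℂ) →L[ℂ] (Fin 3 → ℂ)).comp tauForm))
  have hμ (p : C5) : μ p = (p.1, p.2.1, L.symm p.2.2) := rfl
  have hμ0 : Tendsto μ (𝓝 0) (𝓝 0) := by simpa only [map_zero] using μ.continuous.tendsto 0
  let Θ' : C5 → Fin 3 → ℂ := fun p => L (Θ (μ p))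
  let P : Fin 3 → C5 → ℂ := fun j p => Θ' p j - p.2.2 j - leading j p
  have hP : thetaVec P = Θ' := by
    ext p j
    simp only [thetaVec, theta, P]
    ring
  let G' : C5 → Fin 3 → ℂ := fun p => L (G (μ p))
  have hGμ : AnalyticAt ℂ G (μ 0) := by rwa [map_zero]
  have hG'a : AnalyticAt ℂ G' 0 :=
    ((L : (Fin 3 → ℂ) →L[ℂ] (Fin 3 → ℂ)).analyticAt _).comp (hGμ.comp (μ.analyticAt 0))
  have hG'0 : G' 0 = ![2 * Complex.I, 0, 0] := by
    change L (G (μ 0)) = _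
    rw [map_zero, hLG]
  have hG'd (v : C5) : fderiv ℂ G' 0 v = L (fderiv ℂ G 0 (μ v)) := by
    have e1 : HasFDerivAt G' _ 0 := (L : (Fin 3 → ℂ) →L[ℂ] (Fin 3 → ℂ)).hasFDerivAt.comp (0 : C5)
      (hGμ.differentiableAt.hasFDerivAt.comp (0 : C5) μ.hasFDerivAt)
    rw [e1.fderiv, map_zero]
    rfl
  have hΘ' : ∀ᶠ p in 𝓝 (0 : C5), Θ' p = p.2.2 + (p.1 * p.2.1) • G' p := by
    filter_upwards [hμ0.eventually hΘ] with p hp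
    change L (Θ (μ p)) = _
    rw [hp, map_add, map_smul, hμ, L.apply_symm_apply]
    rfl
  have hΘμ : AnalyticAt ℂ Θ (μ 0) := by rw [map_zero]; exact h.analyticAt
  have hΘ'a : AnalyticAt ℂ Θ' 0 :=
    ((L : (Fin 3 → ℂ) →L[ℂ] (Fin 3 → ℂ)).analyticAt _).comp (hΘμ.comp (μ.analyticAt 0))
  have hproj {f : C5 → Fin 3 → ℂ} {p : C5} (hf : AnalyticAt ℂ f p) (j : Fin 3) :
      AnalyticAt ℂ (fun p => f p j) p :=
    ((ContinuousLinearMap.proj (R := ℂ) (φ := fun _ : Fin 3 => ℂ) j).analyticAt _).comp hf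
  have hfac (j : Fin 3) : ∀ᶠ p in 𝓝 (0 : C5),
      P j p = p.1 * p.2.1 * (G' p j - leadingFactor p j) := by
    filter_upwards [hΘ'] with p hp
    simp only [P, hp, leading_eq, Pi.add_apply, Pi.smul_apply, smul_eq_mul]
    ring
  have hgd (v : C5) (j : Fin 3) : fderiv ℂ (fun p => G' p j - leadingFactor p j) 0 v
      = fderiv ℂ G' 0 v j - fderiv ℂ leadingFactor 0 v j := by
    have e1 := hasFDerivAt_pi'.1 hG'a.differentiableAt.hasFDerivAt j
    have e2 := hasFDerivAt_pi'.1 (analyticAt_leadingFactor 0).differentiableAt.hasFDerivAt j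
    have e3 : HasFDerivAt (fun p => G' p j - leadingFactor p j) _ 0 := e1.sub e2
    rw [e3.fderiv]
    rfl
  have hμz : μ (1, 0, 0) = (1, 0, 0) := by simp [hμ]
  have hμζ : μ (0, 1, 0) = (0, 1, 0) := by simp [hμ]
  refine ⟨L, P, ⟨fun j => ⟨?_, ?_, ?_⟩, ?_⟩, fun x => ?_⟩
  · have e1 : AnalyticAt ℂ (leading j) 0 := by
      have : leading j = fun p => p.1 * p.2.1 * leadingFactor p j := funext (leading_eq j)
      rw [this]
      exact ((zForm.analyticAt 0).mul (zetaForm.analyticAt 0)).mul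
        (hproj (analyticAt_leadingFactor 0) j)
    exact ((hproj hΘ'a j).sub (hproj (tauForm.analyticAt 0) j)).sub e1
  · have hga : AnalyticAt ℂ (fun p => G' p j - leadingFactor p j) 0 :=
      (hproj hG'a j).sub (hproj (analyticAt_leadingFactor 0) j)
    refine hasRemainderOrder_of_factor hga ?_ ?_ ?_ (hfac j)
    · rw [hG'0]
      fin_cases j <;> simp [leadingFactor]
    · rw [hgd, hG'd, hμz, ← hA, hLA, fderiv_leadingFactor]
      fin_cases j <;> simp
    · rw [hgd, hG'd, hμζ, ← hB, hLB, fderiv_leadingFactor]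
      fin_cases j <;> simp
  · have hz0 : Tendsto (fun p : C5 => ((0, p.2.1, p.2.2) : C5)) (𝓝 0) (𝓝 0) := by
      have : Continuous fun p : C5 => ((0, p.2.1, p.2.2) : C5) := by fun_prop
      simpa [Prod.mk_zero_zero] using this.tendsto 0
    have hζ0 : Tendsto (fun p : C5 => ((p.1, 0, p.2.2) : C5)) (𝓝 0) (𝓝 0) := by
      have : Continuous fun p : C5 => ((p.1, 0, p.2.2) : C5) := by fun_prop
      simpa [Prod.mk_zero_zero] using this.tendsto 0
    filter_upwards [hz0.eventually (hfac j), hζ0.eventually (hfac j)] with p e1 e2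
    rw [e1, e2]
    simp
  · filter_upwards [hμ0.eventually h.reality] with p hp j
    have e1 : conjSeries (theta P j) (p.2.1, p.1, fun k => theta P k p)
        = star (thetaVec P (star (p.2.1, p.1, thetaVec P p))) j := rfl
    rw [e1, hP]
    change _ = star (L (Θ (star p.2.1, star p.1, L.symm (star (L (Θ (μ p))))))) j
    rw [hLs', L.symm_apply_apply, ← hLs]
    have e2 : star (Θ (star p.2.1, star p.1, star (Θ (μ p)))) = L.symm p.2.2 := hp
    rw [e2, L.apply_symm_apply]
  · rw [hP]
    change x.2 = Θ (conjPt x) ↔ L x.2 = L (Θ (x.1, star x.1, L.symm (star (L x.2))))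
    rw [hLs', L.symm_apply_apply, L.injective.eq_iff]
    rfl

/-! ### Normal form at a point of a maximally minimal submanifold -/

/-- A generic submanifold of codimension three is, in suitable affine coordinates at a given point,
described by complex defining equations `w = Θ (z, conj z, conj w)`. -/
theorem exists_affine_coordinates {M : Set C4} (hMs : IsRealAnalyticSubmanifold 3 M)
    (hCR : IsCRGeneric M) {p : C4} (hp : p ∈ M) :
    ∃ (g : C4 ≃L[ℂ] C4) (Θ : C5 → Fin 3 → ℂ), IsRealDefining Θ ∧
      ∀ᶠ y in 𝓝 (0 : C4), (g.symm y + p ∈ M ↔ y ∈ realLocus Θ) := by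
  obtain ⟨ρ, hρ, hs, hM⟩ := hMs p hp
  have hT := tangentSpaceAt_eq_ker hρ hs hM hp
  have hgen := hCR p hp
  rw [hT] at hgen
  obtain ⟨g, hg⟩ := exists_linear_coordinates (fderiv ℝ ρ p) hs hgen
  let b : C4 →L[ℝ] C4 := (g.symm : C4 →L[ℂ] C4).restrictScalars ℝ
  have hb0 : b 0 + p = p := by rw [map_zero, zero_add]
  have hρ' : AnalyticAt ℝ ρ (b 0 + p) := by rwa [hb0]
  have hba : AnalyticAt ℝ (fun y => b y + p) 0 := (b.analyticAt 0).add analyticAt_const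
  have hr : AnalyticAt ℝ (fun y => ρ (b y + p)) 0 :=
    AnalyticAt.comp (f := fun y => b y + p) hρ' hba
  obtain ⟨Θ, hΘ, hr'⟩ := exists_isRealDefining hr (by
      rw [hb0]; exact hM.self_of_nhds.1 hp) (fun v j => by
    have e1 : HasFDerivAt (fun y => ρ (b y + p)) _ 0 :=
      HasFDerivAt.comp (f := fun y => b y + p) (0 : C4) hρ'.differentiableAt.hasFDerivAt
        (b.hasFDerivAt.add_const p)
    rw [e1.fderiv, hb0]
    change fderiv ℝ ρ p (g.symm v) j = _
    rw [← hg, g.apply_symm_apply])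
  refine ⟨g, Θ, hΘ, ?_⟩
  have hbt : Tendsto (fun y => b y + p) (𝓝 0) (𝓝 p) := by
    have := hba.continuousAt.tendsto
    rwa [hb0] at this
  filter_upwards [hr', hbt.eventually hM] with y h1 h2
  exact h2.trans h1

/-- Near each point, a maximally minimal submanifold is given, in suitable holomorphic coordinates,
by an admissible triple. -/
theorem exists_normal_coordinates {M : Set C4} (hMs : IsRealAnalyticSubmanifold 3 M)
    (hCR : IsCRGeneric M) (hMM : IsMaximallyMinimal M) {p : C4} (hp : p ∈ M) :
    ∃ (h : OpenPartialHomeomorph C4 C4) (P : Fin 3 → C5 → ℂ),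
      p ∈ h.source ∧ h p = 0 ∧ DifferentiableOn ℂ h h.source ∧
      DifferentiableOn ℂ h.symm h.target ∧ AdmissibleRemainders P ∧
      ∀ᶠ x in 𝓝 p, (x ∈ M ↔ SatisfiesEquations P (h x)) := by
  obtain ⟨g, Θ, hΘ, hMΘ⟩ := exists_affine_coordinates hMs hCR hp
  obtain ⟨φ, Θ', hφs, hφ0, hφa, hφb, hΘ'a, hΘ'r, hΘ'n, hφM⟩ := hΘ.exists_normal
  obtain ⟨G, hG, hΘG⟩ := exists_factor_of_normal (f := fun q => Θ' q - q.2.2)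
    (hΘ'a.sub (tauForm.analyticAt 0)) (by
      filter_upwards [hΘ'n] with q hq
      exact ⟨sub_eq_zero.2 hq.1, sub_eq_zero.2 hq.2⟩)
  have hΘG' : ∀ᶠ q in 𝓝 (0 : C5), Θ' q = q.2.2 + (q.1 * q.2.1) • G q :=
    hΘG.mono fun q hq => by rw [← hq]; abel
  have hΘ' := isRealDefining_of_normal hG hΘG' hΘ'r
  -- The affine change of coordinates.
  let a : C4 ≃ₜ C4 := (Homeomorph.subRight p).trans g.toHomeomorph
  have ha (x : C4) : a x = g (x - p) := rfl
  have hap : a p = 0 := by rw [ha, sub_self, map_zero]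
  have has (y : C4) : a.symm y = g.symm y + p := by
    rw [a.symm_apply_eq, ha, add_sub_cancel_right, g.apply_symm_apply]
  have haa (x : C4) : AnalyticAt ℂ a x :=
    ((g : C4 →L[ℂ] C4).analyticAt _).comp (analyticAt_id.sub analyticAt_const)
  have hasa (y : C4) : AnalyticAt ℂ a.symm y := by
    rw [show (a.symm : C4 → C4) = fun y => g.symm y + p from funext has]
    exact ((g.symm : C4 →L[ℂ] C4).analyticAt _).add analyticAt_const
  have hat : Tendsto a (𝓝 p) (𝓝 0) := by
    simpa only [hap] using a.continuous.tendsto p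
  have hφt : (0 : C4) ∈ φ.target := by rw [← hφ0]; exact φ.map_source hφs
  have hMφ : ∀ᶠ x in 𝓝 p, (x ∈ M ↔ φ (a x) ∈ realLocus Θ') := by
    filter_upwards [hat.eventually hMΘ, hat.eventually hφM] with x h1 h2
    rw [← h2, ← h1, ← has, a.symm_apply_apply]
  -- The ranks are biholomorphic invariants.
  have hrank : 5 ≤ Module.finrank ℝ (D3 (realLocus Θ') 0) := by
    have hφap : φ (a p) = 0 := by rw [hap, hφ0]
    have h1 := finrank_D3_le (h := fun x => φ (a x)) (g := fun y => a.symm (φ.symm y)) (p := p)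
      (M := M) (M' := realLocus Θ')
      (AnalyticAt.comp (by rw [hap]; exact hφa 0 hφs) (haa p))
      (by
        rw [hφap]
        exact AnalyticAt.comp (hasa _) (hφb 0 hφt))
      (by
        filter_upwards [hat.eventually (φ.open_source.mem_nhds hφs)] with x hx
        rw [φ.left_inv hx, a.symm_apply_apply])
      (by
        rw [hφap]
        filter_upwards [φ.open_target.mem_nhds hφt] with y hy
        rw [a.apply_symm_apply, φ.right_inv hy])
      hMφ
    rw [hφap, (hMM p hp).2.2] at h1
    exact h1
  have h0 : (0 : C4) ∈ realLocus Θ' := by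
    change (0 : C4).2 = Θ' (conjPt 0)
    rw [map_zero, hΘ'.map_zero]
    rfl
  obtain ⟨L, P, hP, hLP⟩ := exists_admissible hG hΘG' hΘ'
    (linearIndependent_of_finrank_D3 hΘ' (Eventually.of_forall fun _ => Iff.rfl) h0 hrank)
  let ψ : C4 ≃L[ℂ] C4 := (ContinuousLinearEquiv.refl ℂ ℂ).prodCongr L
  have hψ (x : C4) : ψ x = (x.1, L x.2) := rfl
  let h : OpenPartialHomeomorph C4 C4 :=
    a.transOpenPartialHomeomorph (φ.transHomeomorph ψ.toHomeomorph)
  have hh (x : C4) : h x = ψ (φ (a x)) := rfl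
  refine ⟨h, P, ?_, ?_, fun x hx => ?_, fun y hy => ?_, hP, ?_⟩
  · change a p ∈ φ.source
    rwa [hap]
  · rw [hh, hap, hφ0, map_zero]
  · have hx' : a x ∈ φ.source := hx
    exact (ψ.differentiableAt.comp x
      ((hφa _ hx').differentiableAt.comp x (haa x).differentiableAt)).differentiableWithinAt
  · have hy' : ψ.symm y ∈ φ.target := hy
    exact ((hasa _).differentiableAt.comp y
      ((hφb _ hy').differentiableAt.comp y ψ.symm.differentiableAt)).differentiableWithinAt
  · filter_upwards [hMφ] with x hx
    rw [hx, satisfiesEquations_iff, hLP, hh, hψ]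

end CRGeom

end

theorem mainTheorem9 :
    (∀ M : Set CRGeom.C4,
      CRGeom.IsRealAnalyticSubmanifold 3 M → CRGeom.IsCRGeneric M → CRGeom.IsMaximallyMinimal M →
      ∀ p ∈ M, ∃ (h : OpenPartialHomeomorph CRGeom.C4 CRGeom.C4)
        (P : Fin 3 → CRGeom.C5 → ℂ),
        p ∈ h.source ∧ h p = 0 ∧
        DifferentiableOn ℂ h h.source ∧ DifferentiableOn ℂ h.symm h.target ∧
        CRGeom.AdmissibleRemainders P ∧
        ∀ᶠ x in 𝓝 p, (x ∈ M ↔ CRGeom.SatisfiesEquations P (h x))) ∧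
    (∀ P : Fin 3 → CRGeom.C5 → ℂ, CRGeom.AdmissibleRemainders P →
      ∃ U : Set CRGeom.C4, IsOpen U ∧ (0 : CRGeom.C4) ∈ U ∧
        (0 : CRGeom.C4) ∈ {x ∈ U | CRGeom.SatisfiesEquations P x} ∧
        IsConnected {x ∈ U | CRGeom.SatisfiesEquations P x} ∧
        CRGeom.IsRealAnalyticSubmanifold 3 {x ∈ U | CRGeom.SatisfiesEquations P x} ∧
        CRGeom.IsCRGeneric {x ∈ U | CRGeom.SatisfiesEquations P x} ∧
        CRGeom.IsMaximallyMinimal {x ∈ U | CRGeom.SatisfiesEquations P x}) :=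
  ⟨fun _ hMs hCR hMM _ hp => CRGeom.exists_normal_coordinates hMs hCR hMM hp,
    fun _ hP => hP.exists_nhd⟩
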